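/- **Theorem 1.4.** Let $F$ be a non-Archimedean local field with ring of integers $\mathcal O_F$ and residue cardinality $q$, let $K_1/F$ be an unramified quadratic field extension and $K_2/F$ a quadratic étale algebra (for instance any separable quadratic field extension), with non-trivial involutions $\sigma_1,\sigma_2$. Fix generators $\mathcal O_{K_1}=\mathcal O_F[\zeta_1]$ and $\mathcal O_{K_2}=\mathcal O_F[\varpi_2]$ with $(\zeta_1-\zeta_1^{\sigma_1})(\zeta_1+\zeta_1^{\sigma_1})\neq 0$. Let $K_0=(K_1\otimes_F K_1)^{\sigma_1\otimes\sigma_1}$ and $K_3=(K_1\otimes_F K_2)^{\sigma_1\otimes\sigma_2}$, with generators $$\zeta_0=\frac{\zeta_1\otimes\zeta_1-\zeta_1^{\sigma_1}\otimes\zeta_1^{\sigma_1}}{\zeta_1^2-(\zeta_1^{\sigma_1})^2},\quad \zeta_0^{\sigma_0}=\frac{\zeta_1\otimes\zeta_1^{\sigma_1}-\zeta_1^{\sigma_1}\otimes\zeta_1}{\zeta_1^2-(\zeta_1^{\sigma_1})^2},\quad \varpi_3=\zeta_1\otimes\varpi_2+\zeta_1^{\sigma_1}\otimes\varpi_2^{\sigma_2},\quad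 \varpi_3^{\sigma_3}=\zeta_1^{\sigma_1}\otimes\varpi_2+\zeta_1\otimes\varpi_2^{\sigma_2}$$ (the scalar denominators act on the first factor), so that $K_0\cong F\times F$ with $\zeta_0=(1,0)$. Let $h\ge 1$. All embeddings below are $F$-algebra homomorphisms $A\to\mathrm{Mat}_{2h}(F)$ that make $F^{2h}$ a free $A$-module of rank $h$. For a pair $\alpha=(\alpha_1,\alpha_2):(K_1,K_2)\to \mathrm{Mat}_{2h}(F)$ put $$\mathbf w_\alpha=\alpha_1(\zeta_1)\alpha_2(\varpi_2)+\alpha_2(\varpi_2^{\sigma_2})\alpha_1(\zeta_1^{\sigma_1}),\qquad \mathbf z_\alpha=\alpha_2(\varpi_2)\alpha_1(\zeta_1)-\alpha_1(\zeta_1)\alpha_2(\varpi_2),$$ and define $\mathbf w_\beta,\mathbf z_\beta$ for a pair $\beta=(\beta_0,\beta_3):(K_0,K_3)\to\mathrm{Mat}_{2h}(F)$ by the same formulas with $(\zeta_0,\varpi_3)$. A pair is *regular semisimple* if $\mathbf z$ is invertible and $\mathbf w$ has distinct eigenvalues as an element of the centralizer ($\cong \mathrm{Mat}_h(A)$) of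 the first embedding. Pairs $\alpha,\beta$ *match* if some automorphism $j$ of the $K_1$-algebra $K_1\otimes_F\mathrm{Mat}_{2h}(F)$ carries $\mathrm{id}\otimes\beta$ to $\mathrm{id}\otimes\alpha$ under the identifications $K_1\otimes K_0\cong K_1\otimes K_1$ and $K_1\otimes K_3\cong K_1\otimes K_2$, $a\otimes k\mapsto (a\otimes 1)k$. Choose reference pairs $\alpha^{\mathrm{ref}}$, $\beta^{\mathrm{ref}}$ mapping rings of integers into $\mathrm{Mat}_{2h}(\mathcal O_F)$, and $g_i\in\mathrm{GL}_{2h}(F)$ with $\alpha_i=g_i\alpha_i^{\mathrm{ref}}g_i^{-1}$ $(i=1,2)$ and $\beta_i=g_i\beta_i^{\mathrm{ref}}g_i^{-1}$ $(i=0,3)$. Let $H_i\subset\mathrm{GL}_{2h}(F)$ be the centralizer of the $i$-th reference embedding, with the Haar measure for which $H_i\cap\mathrm{GL}_{2h}(\mathcal O_F)$ has volume $1$. Let $L^\times=g_1H_1g_1^{-1}\cap g_2H_2g_2^{-1}$ (resp. $g_0H_0g_0^{-1}\cap g_3H_3g_3^{-1}$), with the Haar measure for which its subgroup $\mathcal O_L^\times$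 of elements integral over $\mathcal O_F$ together with their inverses has volume $1$; it acts on $H_1\times H_2$ (resp. $H_0\times H_3$) on the left by $l\cdot(h,h')=(g_1^{-1}lg_1h,\,g_2^{-1}lg_2h')$ (resp. with $g_0,g_3$), and the quotient carries the quotient measure. For $f:\mathrm{GL}_{2h}(F)\to\mathbb C$ bi-invariant under $\mathrm{GL}_{2h}(\mathcal O_F)$ let $$\mathrm{Orb}(f,\alpha)=\int_{L^\times\backslash (H_1\times H_2)} f(h_1^{-1}g_1^{-1}g_2h_2),\qquad \mathrm{Orb}(f,\beta,s)=\int_{L^\times\backslash (H_0\times H_3)} f(h_0^{-1}g_0^{-1}g_3h_3)\,\Omega(g_0h_0\mathcal O_F^{2h},s),$$ where $\Omega(\Lambda,s)=[\Lambda_-:\mathbf z_\beta\Lambda_+]^s\,(-1)^{\log_q[\Lambda_-:\mathbf z_\beta\Lambda_+]}$, $\Lambda_+=\beta_0(\zeta_0)\Lambda$, $\Lambda_-=\beta_0(\zeta_0^{\sigma_0})\Lambda$, and $[\Lambda_1:\Lambda_2]=\#(\Lambda_1/\Lambda_1\cap\Lambda_2)/\#(\Lambda_2/\Lambda_1\cap\Lambda_2)$.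 Let $\mathbf 1$ be the characteristic function of $\mathrm{GL}_{2h}(\mathcal O_F)$. If $\alpha$ and $\beta$ are matching regular semisimple pairs and $\mathbf z_\alpha\in\mathrm{GL}_{2h}(\mathcal O_F)$, then both integrals converge absolutely and $$\mathrm{Orb}(\mathbf 1,\alpha)=\mathrm{Orb}(\mathbf 1,\beta,0).$$ Moreover, with $L=F[\mathbf w_\alpha]$ and $\mathcal O_L$ the integral closure of $\mathcal O_F$ in $L$, both are equal to the (finite) number of $\mathcal O_F[\mathbf w_\alpha]$-submodules $\Lambda\subset L$ with $\mathcal O_L\Lambda=\mathcal O_L$. -/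

import Mathlib

open scoped TensorProduct Matrix ValuativeRel ENNReal

noncomputable section

namespace BiquadraticFL

open MeasureTheory

/-! ## Quadratic algebras, their generators, and the algebras `K₀`, `K₃` -/

/-- `σ` is an involution of the `F`-algebra `K` whose ring of fixed points is `F`. -/
def IsQuadraticInvolution {F K : Type*} [Field F] [CommRing K] [Algebra F K]
    (σ : K ≃ₐ[F] K) : Prop :=
  (∀ x, σ (σ x) = x) ∧ ∀ x, σ x = x → ∃ a : F, algebraMap F K a = x

/-- The involutions `σ₁`, `σ₂` of `K₁`, `K₂` over the local field `F`, together with generators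
`ζ₁`, `ϖ₂` of the rings of integers over `𝒪[F]`, with `(ζ₁ - σ₁ ζ₁)(ζ₁ + σ₁ ζ₁)` invertible
in `K₁`. -/
structure QuadraticData (F K₁ K₂ : Type*) [Field F] [ValuativeRel F] [Field K₁] [CommRing K₂]
    [Algebra F K₁] [Algebra F K₂] where
  σ₁ : K₁ ≃ₐ[F] K₁
  σ₂ : K₂ ≃ₐ[F] K₂
  invol₁ : IsQuadraticInvolution σ₁
  invol₂ : IsQuadraticInvolution σ₂
  ζ₁ : K₁
  ϖ₂ : K₂
  isUnit_zeta : IsUnit ((ζ₁ - σ₁ ζ₁) * (ζ₁ + σ₁ ζ₁))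
  adjoin_zeta : Algebra.adjoin 𝒪[F] {ζ₁} = integralClosure 𝒪[F] K₁
  adjoin_varpi : Algebra.adjoin 𝒪[F] {ϖ₂} = integralClosure 𝒪[F] K₂

namespace QuadraticData

variable {F K₁ K₂ : Type*} [Field F] [ValuativeRel F] [Field K₁] [CommRing K₂]
  [Algebra F K₁] [Algebra F K₂] (D : QuadraticData F K₁ K₂)

/-- `K₀ ⊆ K₁ ⊗ K₁`, the subalgebra fixed by `σ₁ ⊗ σ₁`. -/
def K₀ : Subalgebra F (K₁ ⊗[F] K₁) :=
  AlgHom.equalizer (Algebra.TensorProduct.map D.σ₁.toAlgHom D.σ₁.toAlgHom)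
    (AlgHom.id F _)

/-- `K₃ ⊆ K₁ ⊗ K₂`, the subalgebra fixed by `σ₁ ⊗ σ₂`. -/
def K₃ : Subalgebra F (K₁ ⊗[F] K₂) :=
  AlgHom.equalizer (Algebra.TensorProduct.map D.σ₁.toAlgHom D.σ₂.toAlgHom)
    (AlgHom.id F _)

/-- `ζ₁² - (σ₁ ζ₁)²`. -/
def disc : K₁ := D.ζ₁ ^ 2 - D.σ₁ D.ζ₁ ^ 2

lemma σ₁_disc : D.σ₁ D.disc = -D.disc := by
  simp [disc, D.invol₁.1]

/-- The generator `ζ₀` of `K₀`; it is the nontrivial idempotent `(1, 0)` of `K₀ ≅ F × F`. -/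
def ζ₀ : D.K₀ :=
  ⟨(D.ζ₁ / D.disc) ⊗ₜ D.ζ₁ - (D.σ₁ D.ζ₁ / D.disc) ⊗ₜ D.σ₁ D.ζ₁, by
    simp only [K₀, AlgHom.mem_equalizer, map_sub, Algebra.TensorProduct.map_tmul,
      AlgEquiv.toAlgHom_apply, map_div₀, σ₁_disc, D.invol₁.1, AlgHom.id_apply, div_neg,
      TensorProduct.neg_tmul]
    abel⟩

/-- The conjugate `ζ₀^{σ₀}` of `ζ₀`, i.e. the idempotent `(0, 1)`. -/
def ζ₀c : D.K₀ :=
  ⟨(D.ζ₁ / D.disc) ⊗ₜ D.σ₁ D.ζ₁ - (D.σ₁ D.ζ₁ / D.disc) ⊗ₜ D.ζ₁, by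
    simp only [K₀, AlgHom.mem_equalizer, map_sub, Algebra.TensorProduct.map_tmul,
      AlgEquiv.toAlgHom_apply, map_div₀, σ₁_disc, D.invol₁.1, AlgHom.id_apply, div_neg,
      TensorProduct.neg_tmul]
    abel⟩

/-- The generator `ϖ₃ = ζ₁ ⊗ ϖ₂ + ζ₁^{σ₁} ⊗ ϖ₂^{σ₂}` of `K₃`. -/
def ϖ₃ : D.K₃ :=
  ⟨D.ζ₁ ⊗ₜ D.ϖ₂ + D.σ₁ D.ζ₁ ⊗ₜ D.σ₂ D.ϖ₂, by
    simp only [K₃, AlgHom.mem_equalizer, map_add, Algebra.TensorProduct.map_tmul,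
      AlgEquiv.toAlgHom_apply, D.invol₁.1, D.invol₂.1, AlgHom.id_apply]
    abel⟩

/-- The conjugate `ϖ₃^{σ₃} = ζ₁^{σ₁} ⊗ ϖ₂ + ζ₁ ⊗ ϖ₂^{σ₂}`. -/
def ϖ₃c : D.K₃ :=
  ⟨D.σ₁ D.ζ₁ ⊗ₜ D.ϖ₂ + D.ζ₁ ⊗ₜ D.σ₂ D.ϖ₂, by
    simp only [K₃, AlgHom.mem_equalizer, map_add, Algebra.TensorProduct.map_tmul,
      AlgEquiv.toAlgHom_apply, D.invol₁.1, D.invol₂.1, AlgHom.id_apply]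
    abel⟩

end QuadraticData

/-! ## Pairs of quadratic embeddings -/

/-- `2h × 2h` matrices over `F`. -/
abbrev Mat (h : ℕ) (F : Type*) := Matrix (Fin (2 * h)) (Fin (2 * h)) F

/-- `GL_{2h}(F)`. -/
abbrev GLn (h : ℕ) (F : Type*) [Field F] := GL (Fin (2 * h)) F

/-- The embedding `e : A → Mat_{2h}(F)` makes `F^{2h}` a free `A`-module of rank `h`. -/
def IsFreeEmbedding {F A : Type*} [Field F] [CommRing A] [Algebra F A] {h : ℕ}
    (e : A →ₐ[F] Mat h F) : Prop :=
  ∃ φ : (Fin h → A) ≃ₗ[F] (Fin (2 * h) → F), ∀ (a : A) (v : Fin h → A), φ (a • v) = e a *ᵥ φ v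

/-- A pair of (free) quadratic embeddings `(A, B) → Mat_{2h}(F)`. -/
structure EmbeddingPair (F A B : Type*) [Field F] [CommRing A] [Algebra F A] [CommRing B]
    [Algebra F B] (h : ℕ) where
  e₁ : A →ₐ[F] Mat h F
  e₂ : B →ₐ[F] Mat h F
  free₁ : IsFreeEmbedding e₁
  free₂ : IsFreeEmbedding e₂

section Pairs

variable {F A B : Type*} [Field F] [CommRing A] [Algebra F A] [CommRing B] [Algebra F B] {h : ℕ}

/-- The element `𝐰 = ζ ϖ + ϖ' ζ'` attached to a pair of embeddings and generators `ζ`, `ϖ` with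
conjugates `ζ'`, `ϖ'`. -/
def EmbeddingPair.w (p : EmbeddingPair F A B h) (ζ ζ' : A) (ϖ ϖ' : B) : Mat h F :=
  p.e₁ ζ * p.e₂ ϖ + p.e₂ ϖ' * p.e₁ ζ'

/-- The element `𝐳 = ϖ ζ - ζ ϖ` attached to a pair of embeddings and generators `ζ`, `ϖ`. -/
def EmbeddingPair.z (p : EmbeddingPair F A B h) (ζ : A) (ϖ : B) : Mat h F :=
  p.e₂ ϖ * p.e₁ ζ - p.e₁ ζ * p.e₂ ϖ

/-- A pair is regular semisimple if `𝐳` is invertible and `𝐰`, viewed as an element `W` of the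
centralizer `C(e₁) ≅ Mat_h(A)`, has distinct eigenvalues, i.e. a separable characteristic
polynomial. -/
def EmbeddingPair.IsRegularSemisimple (p : EmbeddingPair F A B h) (ζ ζ' : A) (ϖ ϖ' : B) : Prop :=
  (∃ (φ : (Fin h → A) ≃ₗ[F] (Fin (2 * h) → F)) (W : Matrix (Fin h) (Fin h) A),
    (∀ (a : A) (v : Fin h → A), φ (a • v) = p.e₁ a *ᵥ φ v) ∧
    (∀ v : Fin h → A, φ (W *ᵥ v) = p.w ζ ζ' ϖ ϖ' *ᵥ φ v) ∧
    W.charpoly.Separable) ∧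
  IsUnit (p.z ζ ϖ)

/-- `p` is obtained from the reference pair `r` by conjugating the two embeddings by `g₁`
and `g₂`. -/
def EmbeddingPair.IsConjOf (p r : EmbeddingPair F A B h) (g₁ g₂ : GLn h F) : Prop :=
  (∀ a, p.e₁ a = (g₁ : Mat h F) * r.e₁ a * ((g₁⁻¹ : GLn h F) : Mat h F)) ∧
  ∀ b, p.e₂ b = (g₂ : Mat h F) * r.e₂ b * ((g₂⁻¹ : GLn h F) : Mat h F)

/-- The pair restricts to embeddings `(𝒪_A, 𝒪_B) → Mat_{2h}(𝒪_F)` of the rings of integers. -/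
def EmbeddingPair.IsIntegralPair [ValuativeRel F] (p : EmbeddingPair F A B h) : Prop :=
  (∀ a : A, IsIntegral 𝒪[F] a → ∀ i j, p.e₁ a i j ∈ 𝒪[F]) ∧
  ∀ b : B, IsIntegral 𝒪[F] b → ∀ i j, p.e₂ b i j ∈ 𝒪[F]

end Pairs

/-- The pairs `β : (K₀, K₃) → Mat_{2h}(F)` and `α : (K₁, K₂) → Mat_{2h}(F)` match: there is an
automorphism `j` of the `K₁`-algebra `K₁ ⊗ Mat_{2h}(F)` with `j ∘ (id ⊗ β) = (id ⊗ α) ∘ c`,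
where `c` is the pair of isomorphisms `K₁ ⊗ K₀ → K₁ ⊗ K₁` and `K₁ ⊗ K₃ → K₁ ⊗ K₂` of
`K₁`-algebras given by `a ⊗ k ↦ a • k`. -/
def Matches {F K₁ K₂ : Type*} [Field F] [ValuativeRel F] [Field K₁] [CommRing K₂]
    [Algebra F K₁] [Algebra F K₂] (D : QuadraticData F K₁ K₂) {h : ℕ}
    (α : EmbeddingPair F K₁ K₂ h) (β : EmbeddingPair F D.K₀ D.K₃ h) : Prop :=
  ∃ j : (K₁ ⊗[F] Mat h F) ≃ₐ[K₁] (K₁ ⊗[F] Mat h F),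
    (∀ (a : K₁) (k : D.K₀),
      j (a ⊗ₜ β.e₁ k) =
        Algebra.TensorProduct.map (AlgHom.id F K₁) α.e₁ (a • (k : K₁ ⊗[F] K₁))) ∧
    ∀ (a : K₁) (k : D.K₃),
      j (a ⊗ₜ β.e₂ k) =
        Algebra.TensorProduct.map (AlgHom.id F K₁) α.e₂ (a • (k : K₁ ⊗[F] K₂))

/-! ## Groups and measures -/

/-- The subgroup `GL_{2h}(𝒪_F)` of `GL_{2h}(F)`. -/
def GLO (h : ℕ) (F : Type*) [Field F] [ValuativeRel F] : Subgroup (GLn h F) :=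
  (Matrix.GeneralLinearGroup.map (n := Fin (2 * h)) (algebraMap 𝒪[F] F)).range

section Groups

variable {F A B : Type*} [Field F] [CommRing A] [Algebra F A] [CommRing B] [Algebra F B] {h : ℕ}

/-- The centralizer `H` in `GL_{2h}(F)` of the image of an embedding. -/
def centralizerGL (e : A →ₐ[F] Mat h F) : Subgroup (GLn h F) where
  carrier := {g | ∀ a, (g : Mat h F) * e a = e a * g}
  one_mem' := by simp
  mul_mem' := by
    intro x y hx hy a
    simp only [Set.mem_ofPred_eq, Units.val_mul] at *
    rw [mul_assoc, hy, ← mul_assoc, hx, mul_assoc]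
  inv_mem' := by
    intro x hx a
    have hxa : (x : Mat h F) * e a = e a * x := hx a
    calc ((x⁻¹ : GLn h F) : Mat h F) * e a
        = ((x⁻¹ : GLn h F) : Mat h F) * (e a * x) * ((x⁻¹ : GLn h F) : Mat h F) := by
          rw [mul_assoc, mul_assoc, Units.mul_inv, mul_one]
      _ = e a * ((x⁻¹ : GLn h F) : Mat h F) := by
          rw [← hxa, ← mul_assoc, Units.inv_mul, one_mul]

/-- `L^× = g₁ H₁ g₁⁻¹ ∩ g₂ H₂ g₂⁻¹`, embedded in `H₁ × H₂` by `l ↦ (g₁⁻¹ l g₁, g₂⁻¹ l g₂)`. -/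
def stabilizerL (r : EmbeddingPair F A B h) (g₁ g₂ : GLn h F) :
    Subgroup (centralizerGL r.e₁ × centralizerGL r.e₂) where
  carrier := {x | g₁ * (x.1 : GLn h F) * g₁⁻¹ = g₂ * (x.2 : GLn h F) * g₂⁻¹}
  one_mem' := by simp
  mul_mem' := by
    intro x y hx hy
    have e : ∀ g a b : GLn h F, g * (a * b) * g⁻¹ = (g * a * g⁻¹) * (g * b * g⁻¹) := by
      intro g a b; group
    simp only [Set.mem_ofPred_eq, Prod.fst_mul, Prod.snd_mul, Subgroup.coe_mul] at *
    rw [e, e, hx, hy]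
  inv_mem' := by
    intro x hx
    have e : ∀ g a : GLn h F, g * a⁻¹ * g⁻¹ = (g * a * g⁻¹)⁻¹ := by
      intro g a; group
    simp only [Set.mem_ofPred_eq, Prod.fst_inv, Prod.snd_inv, Subgroup.coe_inv] at *
    rw [e, e, hx]

/-- The maximal compact subgroup `𝒪_L^×` of `L^×`: the elements integral over `𝒪[F]` together with
their inverse. -/
def integralUnitsL [ValuativeRel F] (r : EmbeddingPair F A B h) (g₁ g₂ : GLn h F) :
    Set (stabilizerL r g₁ g₂) :=
  {l | IsIntegral 𝒪[F] (((l.1.1 : GLn h F)) : Mat h F) ∧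
    IsIntegral 𝒪[F] ((((l.1.1 : GLn h F))⁻¹ : GLn h F) : Mat h F)}

end Groups

/-- `F` carries a σ-algebra; matrices get the product σ-algebra. -/
instance instMeasurableSpaceMat {h : ℕ} {F : Type*} [MeasurableSpace F] :
    MeasurableSpace (Mat h F) :=
  inferInstanceAs (MeasurableSpace (Fin (2 * h) → Fin (2 * h) → F))

/-- The quotient measure `ν / lam` on the space `N \ G` of right cosets `N g`, i.e. the measure
with `∫_G φ dν = ∫_{N\G} ∫_N φ(n g) dlam(n) d(ν / lam)(g)` for `φ ≥ 0` (see
`lintegral_quotientMeasure`). It is constructed as the supremum of the push-forwards of `w ν`, where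
`w ≥ 0` runs through the measurable functions on `G` with `∫_N w(n g) dlam(n) ≤ 1` for all `g`;
the supremum is attained whenever equality holds for some `w`. -/
def quotientMeasure {G : Type*} [Group G] [MeasurableSpace G] (N : Subgroup G)
    (ν : Measure G) (lam : Measure N) : Measure (Quotient (QuotientGroup.rightRel N)) :=
  ⨆ w ∈ {w : G → ℝ≥0∞ | Measurable w ∧ ∀ g, ∫⁻ n : N, w ((n : G) * g) ∂lam ≤ 1},
    (ν.withDensity w).map (Quotient.mk (QuotientGroup.rightRel N))

section QuotientMeasure

variable {G : Type*} [Group G] [MeasurableSpace G] [MeasurableMul₂ G] [MeasurableInv G]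
  {N : Subgroup G} {ν : Measure G} {lam : Measure N} [SFinite ν] [SFinite lam]
  [ν.IsMulLeftInvariant] [lam.IsInvInvariant]

lemma lintegral_mul_fiber {f w : G → ℝ≥0∞} (hf : Measurable f) (hw : Measurable w) :
    ∫⁻ g, f g * ∫⁻ n : N, w ((n : G) * g) ∂lam ∂ν =
      ∫⁻ g, w g * ∫⁻ n : N, f ((n : G) * g) ∂lam ∂ν := by
  have hmul : Measurable fun p : G × N => (p.2 : G) * p.1 :=
    (measurable_subtype_coe.comp measurable_snd).mul measurable_fst
  calc ∫⁻ g, f g * ∫⁻ n : N, w ((n : G) * g) ∂lam ∂ν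
      = ∫⁻ g, ∫⁻ n : N, f g * w ((n : G) * g) ∂lam ∂ν := by
        refine lintegral_congr fun g => (lintegral_const_mul _ ?_).symm
        exact hw.comp (measurable_subtype_coe.mul_const g)
    _ = ∫⁻ n : N, ∫⁻ g, f g * w ((n : G) * g) ∂ν ∂lam :=
        lintegral_lintegral_swap ((hf.comp measurable_fst).mul (hw.comp hmul)).aemeasurable
    _ = ∫⁻ n : N, ∫⁻ g, f ((n : G)⁻¹ * g) * w g ∂ν ∂lam := by
        refine lintegral_congr fun n => ?_
        rw [← lintegral_mul_left_eq_self (fun g => f ((n : G)⁻¹ * g) * w g) (n : G)]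
        simp
    _ = ∫⁻ n : N, ∫⁻ g, f ((n : G) * g) * w g ∂ν ∂lam := by
        have : MeasurableInv N := ⟨measurable_subtype_coe.inv.subtype_mk⟩
        rw [← lintegral_inv_eq_self (fun n : N => ∫⁻ g, f ((n : G) * g) * w g ∂ν)]
        simp
    _ = ∫⁻ g, ∫⁻ n : N, f ((n : G) * g) * w g ∂lam ∂ν :=
        (lintegral_lintegral_swap
          ((hf.comp hmul).mul (hw.comp measurable_fst)).aemeasurable).symm
    _ = ∫⁻ g, w g * ∫⁻ n : N, f ((n : G) * g) ∂lam ∂ν := by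
        refine lintegral_congr fun g => ?_
        have hfg : Measurable fun n : N => f ((n : G) * g) :=
          hf.comp (measurable_subtype_coe.mul_const g)
        rw [← lintegral_const_mul _ hfg]
        exact lintegral_congr fun n => mul_comm _ _

lemma quotientMeasure_eq {w₀ : G → ℝ≥0∞} (hw₀ : Measurable w₀)
    (hw₀' : ∀ g, ∫⁻ n : N, w₀ ((n : G) * g) ∂lam = 1) :
    quotientMeasure N ν lam =
      (ν.withDensity w₀).map (Quotient.mk (QuotientGroup.rightRel N)) := by
  have hπ : Measurable (Quotient.mk (QuotientGroup.rightRel N)) := measurable_quotient_mk''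
  refine le_antisymm (iSup₂_le fun w hw => Measure.le_iff.2 fun E hE => ?_)
    (le_iSup₂_of_le w₀ ⟨hw₀, fun g => (hw₀' g).le⟩ le_rfl)
  have hE' := hπ hE
  rw [Measure.map_apply hπ hE, Measure.map_apply hπ hE, withDensity_apply _ hE',
    withDensity_apply _ hE', ← lintegral_indicator hE', ← lintegral_indicator hE']
  set P := Quotient.mk (QuotientGroup.rightRel N) ⁻¹' E with hP
  have hmem : ∀ (n : N) (g : G), (n : G) * g ∈ P ↔ g ∈ P := by
    intro n g
    have : Quotient.mk (QuotientGroup.rightRel N) ((n : G) * g) = Quotient.mk _ g :=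
      Quotient.sound (QuotientGroup.rightRel_apply.2 (by simp))
    simp only [hP, Set.mem_preimage, this]
  calc ∫⁻ g, P.indicator w g ∂ν
      = ∫⁻ g, P.indicator w g * ∫⁻ n : N, w₀ ((n : G) * g) ∂lam ∂ν := by simp [hw₀']
    _ = ∫⁻ g, w₀ g * ∫⁻ n : N, P.indicator w ((n : G) * g) ∂lam ∂ν :=
        lintegral_mul_fiber (hw.1.indicator hE') hw₀
    _ ≤ ∫⁻ g, P.indicator w₀ g ∂ν := by
        refine lintegral_mono fun g => ?_
        by_cases hg : g ∈ P
        · simp only [Set.indicator, hmem, hg, if_true]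
          exact mul_le_of_le_one_right' (hw.2 g)
        · simp [Set.indicator, hmem, hg]

/-- The integration formula that characterizes the quotient measure. -/
theorem lintegral_quotientMeasure [lam.IsMulRightInvariant]
    (hw : ∃ w : G → ℝ≥0∞, Measurable w ∧ ∀ g, ∫⁻ n : N, w ((n : G) * g) ∂lam = 1)
    {φ : G → ℝ≥0∞} (hφ : Measurable φ) :
    ∫⁻ x, ∫⁻ n : N, φ ((n : G) * x.out) ∂lam ∂(quotientMeasure N ν lam) = ∫⁻ g, φ g ∂ν := by
  obtain ⟨w, hw, hw1⟩ := hw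
  have hπ : Measurable (Quotient.mk (QuotientGroup.rightRel N)) := measurable_quotient_mk''
  have hmul : Measurable fun p : G × N => (p.2 : G) * p.1 :=
    (measurable_subtype_coe.comp measurable_snd).mul measurable_fst
  have hfib : Measurable fun g : G => ∫⁻ n : N, φ ((n : G) * g) ∂lam :=
    (hφ.comp hmul).lintegral_prod_right'
  have hout : ∀ g : G, ∫⁻ n : N, φ ((n : G) *
      (Quotient.mk (QuotientGroup.rightRel N) g).out) ∂lam = ∫⁻ n : N, φ ((n : G) * g) ∂lam := by
    intro g
    have h1 : g * ((Quotient.mk (QuotientGroup.rightRel N) g).out)⁻¹ ∈ N :=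
      QuotientGroup.rightRel_apply.1 (Quotient.mk_out g)
    have : MeasurableMul N :=
      ⟨fun c => (measurable_subtype_coe.const_mul (c : G)).subtype_mk,
        fun c => (measurable_subtype_coe.mul_const (c : G)).subtype_mk⟩
    rw [← lintegral_mul_right_eq_self (μ := lam) _ ⟨_, h1⟩]
    simp [mul_assoc]
  have hfib' : Measurable fun x : Quotient (QuotientGroup.rightRel N) =>
      ∫⁻ n : N, φ ((n : G) * x.out) ∂lam := by
    refine measurable_from_quotient.2 ?_
    convert hfib using 1
    exact funext hout
  rw [quotientMeasure_eq hw hw1, lintegral_map hfib' hπ]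
  simp only [hout]
  rw [lintegral_withDensity_eq_lintegral_mul _ hw hfib]
  simp only [Pi.mul_apply]
  rw [← lintegral_mul_fiber hφ hw]
  simp [hw1]

end QuotientMeasure

/-- The normalized Haar measures entering an orbital integral: those on `H₁`, `H₂` giving volume
`1` to `Hᵢ ∩ GL_{2h}(𝒪_F)`, and the one on `L^×` giving volume `1` to `𝒪_L^×`. -/
structure OrbitalMeasures {F A B : Type*} [Field F] [ValuativeRel F] [TopologicalSpace F]
    [MeasurableSpace F] [CommRing A] [Algebra F A] [CommRing B] [Algebra F B] {h : ℕ}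
    (r : EmbeddingPair F A B h) (g₁ g₂ : GLn h F) where
  ν₁ : Measure (centralizerGL r.e₁)
  ν₂ : Measure (centralizerGL r.e₂)
  lam : Measure (stabilizerL r g₁ g₂)
  haar₁ : ν₁.IsHaarMeasure
  haar₂ : ν₂.IsHaarMeasure
  haarL : lam.IsHaarMeasure
  norm₁ : ν₁ {x | (x : GLn h F) ∈ GLO h F} = 1
  norm₂ : ν₂ {x | (x : GLn h F) ∈ GLO h F} = 1
  normL : lam (integralUnitsL r g₁ g₂) = 1

/-- The quotient measure on `L^× \ (H₁ × H₂)`. -/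
def OrbitalMeasures.μ {F A B : Type*} [Field F] [ValuativeRel F] [TopologicalSpace F]
    [MeasurableSpace F] [CommRing A] [Algebra F A] [CommRing B] [Algebra F B] {h : ℕ}
    {r : EmbeddingPair F A B h} {g₁ g₂ : GLn h F} (m : OrbitalMeasures r g₁ g₂) :
    Measure (Quotient (QuotientGroup.rightRel (stabilizerL r g₁ g₂))) :=
  quotientMeasure (stabilizerL r g₁ g₂) (m.ν₁.prod m.ν₂) m.lam

/-! ## Lattices and the transfer factor -/

section Lattices

variable {F : Type*} [Field F] [ValuativeRel F] {h : ℕ}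

/-- The lattice `𝒪_F^{2h}`. -/
def stdLattice (h : ℕ) (F : Type*) [Field F] [ValuativeRel F] : AddSubgroup (Fin (2 * h) → F) :=
  AddSubgroup.pi Set.univ fun _ => (𝒪[F]).toAddSubgroup

/-- The image `m Λ` of a subgroup `Λ` of `F^{2h}` under a matrix `m`. -/
def matImage (m : Mat h F) (Λ : AddSubgroup (Fin (2 * h) → F)) : AddSubgroup (Fin (2 * h) → F) :=
  Λ.map m.mulVecLin.toAddMonoidHom

/-- `[Λ₁ : Λ₂] = #(Λ₁ / Λ₁ ∩ Λ₂) / #(Λ₂ / Λ₁ ∩ Λ₂)`. -/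
def latticeIndex (Λ₁ Λ₂ : AddSubgroup (Fin (2 * h) → F)) : ℚ :=
  (Λ₂.relIndex Λ₁ : ℚ) / (Λ₁.relIndex Λ₂ : ℚ)

/-- The transfer factor `Ω(Λ, s) = [Λ₋ : 𝐳 Λ₊] ^ s * (-1) ^ (log_q [Λ₋ : 𝐳 Λ₊])`, where
`Λ₊ = e Λ` and `Λ₋ = e' Λ` for the two idempotents `e`, `e'` given by `ζ₀`, `ζ₀^{σ₀}`. -/
def transferFactor (e e' z : Mat h F) (Λ : AddSubgroup (Fin (2 * h) → F)) (s : ℂ) : ℂ :=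
  ((latticeIndex (matImage e' Λ) (matImage z (matImage e Λ)) : ℚ) : ℂ) ^ s *
    (-1 : ℂ) ^ Int.log (Nat.card 𝓀[F])
      (latticeIndex (matImage e' Λ) (matImage z (matImage e Λ)))

/-- The characteristic function of `GL_{2h}(𝒪_F)`. -/
def unitTest (h : ℕ) (F : Type*) [Field F] [ValuativeRel F] : GLn h F → ℂ :=
  Set.indicator (GLO h F : Set (GLn h F)) 1

end Lattices

/-! ## Orbital integrals -/

section Orbital

variable {F A B : Type*} [Field F] [ValuativeRel F] [TopologicalSpace F] [MeasurableSpace F]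
  [CommRing A] [Algebra F A] [CommRing B] [Algebra F B] {h : ℕ}

/-- The function `(h₁, h₂) ↦ f(h₁⁻¹ g₁⁻¹ g₂ h₂)` on `L^× \ (H₁ × H₂)`; it does not depend on the
chosen representative. -/
def geometricIntegrand (r : EmbeddingPair F A B h) (g₁ g₂ : GLn h F) (f : GLn h F → ℂ)
    (x : Quotient (QuotientGroup.rightRel (stabilizerL r g₁ g₂))) : ℂ :=
  f ((x.out.1 : GLn h F)⁻¹ * g₁⁻¹ * g₂ * (x.out.2 : GLn h F))

/-- The orbital integral `Orb(f, α)` of the pair obtained from `r` by conjugating with `g₁`,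
`g₂`. -/
def orb {r : EmbeddingPair F A B h} {g₁ g₂ : GLn h F} (m : OrbitalMeasures r g₁ g₂)
    (f : GLn h F → ℂ) : ℂ :=
  ∫ x, geometricIntegrand r g₁ g₂ f x ∂m.μ

/-- The function `(h₀, h₃) ↦ f(h₀⁻¹ g₀⁻¹ g₃ h₃) Ω(g₀ h₀ 𝒪_F^{2h}, s)` on `L^× \ (H₀ × H₃)`; it does
not depend on the chosen representative. -/
def analyticIntegrand (r : EmbeddingPair F A B h) (g₀ g₃ : GLn h F) (e e' z : Mat h F)
    (f : GLn h F → ℂ) (s : ℂ) (x : Quotient (QuotientGroup.rightRel (stabilizerL r g₀ g₃))) : ℂ :=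
  geometricIntegrand r g₀ g₃ f x *
    transferFactor e e' z
      (matImage ((g₀ * (x.out.1 : GLn h F) : GLn h F) : Mat h F) (stdLattice h F)) s

/-- The twisted orbital integral `Orb(f, β, s)`. -/
def twistedOrb {r : EmbeddingPair F A B h} {g₀ g₃ : GLn h F} (m : OrbitalMeasures r g₀ g₃)
    (e e' z : Mat h F) (f : GLn h F → ℂ) (s : ℂ) : ℂ :=
  ∫ x, analyticIntegrand r g₀ g₃ e e' z f s x ∂m.μ

end Orbital

/-- The primitive `𝒪_F[𝐰]`-lattices in `L = F[𝐰]`: the `𝒪_F`-submodules `Λ` of `L` stable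
under `𝐰` with `𝒪_L Λ = 𝒪_L`. Here `L` is realized as `F[X]` modulo the minimal polynomial
of `𝐰`. -/
def primitiveLattices {F : Type*} [Field F] [ValuativeRel F] {h : ℕ} (w : Mat h F) :
    Set (Submodule 𝒪[F] (AdjoinRoot (minpoly F w))) :=
  {Λ | (∀ x ∈ Λ, AdjoinRoot.root (minpoly F w) * x ∈ Λ) ∧
    Submodule.span (integralClosure 𝒪[F] (AdjoinRoot (minpoly F w)))
      (Λ : Set (AdjoinRoot (minpoly F w))) = 1}

end BiquadraticFL

end

open scoped TensorProduct Matrix ValuativeRel ENNReal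
-- Both integrals count lattices, and the count depends only on the minimal polynomial of `𝐰`.
--
-- Consider a pair with generators ζ, ϖ of traces T, t and norms N, n, such that T² - 4N is a unit
-- and `𝐳` and `𝐳⁻¹` are integral. For α the discriminant is a unit because K₁ is unramified; for β,
-- ζ₀ has trace 1 and norm 0, hence discriminant 1. The element `𝐰` commutes with ζ and ϖ, `𝐳ζ =
-- ζ'𝐳`, and u = `𝐳²` is a quadratic polynomial in `𝐰` with coefficients in 𝒪_F
-- (`IsQuadraticPair.z_sq`), so u is a unit of the order 𝒪_F[`𝐰`]. This order is finite over the
-- complete ring 𝒪_F with finite residue field, so the norm form a² + Tab + Nb², of unit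
-- discriminant, represents u: there is y = a + ζb of norm u with a, b in 𝒪_F[`𝐰`]
-- (`exists_quadForm_eq_of_adjoin`). Then τ = y⁻¹`𝐳` is an involution, semilinear for ζ ↦ ζ'
-- (`IsQuadraticPair.exists_involution`). Its fixed space V satisfies F^{2h} = V ⊕ ζV, and regular
-- semisimplicity makes V free of rank one over L = F[`𝐰`] (`exists_frame`). By unramified descent
-- the lattices stable under ζ and ϖ are exactly the M ⊕ ζM with M an 𝒪_F[`𝐰`]-lattice in L
-- (`exists_isLatticeFrame`).
--
-- A point (h₁, h₂) contributes to the integral when g₁h₁𝒪_F^{2h} = g₂h₂𝒪_F^{2h}. This common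
-- lattice is stable under both maximal orders. Conversely each stable lattice occurs, since
-- lattices over the maximal order of an étale algebra are free (`exists_linearEquiv_of_lattice`),
-- and it determines the point up to two compact subgroups of volume 1. The group L^× acts on the
-- lattices M by homothety, and the primitive members of a homothety class form a single orbit of
-- 𝒪_L^×, which has volume 1. So the integral is the number of primitive lattices
-- (`IsUnitPair.measure_orbitSupport`).
--
-- For β the transfer factor disappears: a stable Λ satisfies `𝐳`Λ = Λ, and `𝐳ζ₀ = ζ₀^{σ₀}𝐳` turns
-- this into `𝐳`Λ₊ = Λ₋. Matching makes `𝐰` and `𝐳` of the two pairs conjugate over K₁, so the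
-- minimal polynomials of `𝐰` agree and integrality of `𝐳` and `𝐳⁻¹` passes from α to β. That ζ₀ and
-- ϖ₃ generate the rings of integers of K₀ and K₃ is a Galois descent computation
-- (`IsQuadraticDescent.exists_eq_add`).
namespace BiquadraticFL
-- Norm forms of unit discriminant represent all units
section Norms

/-- Over a finite field, a binary quadratic form `a² + T a b + N b²` of nonzero discriminant
represents every element. -/
lemma exists_quadForm_eq_of_field {κ : Type*} [Field κ] [Finite κ] {T N : κ}
    (hδ : T ^ 2 - 4 * N ≠ 0) (u : κ) : ∃ a b : κ, a ^ 2 + T * a * b + N * b ^ 2 = u := by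
  by_cases h2 : ringChar κ = 2
  · obtain ⟨a, ha⟩ := FiniteField.isSquare_of_char_two h2 u
    exact ⟨a, 0, by rw [ha]; ring⟩
  · have : Fintype κ := Fintype.ofFinite κ
    have hc : Fintype.card κ % 2 = 1 := FiniteField.odd_card_of_char_ne_two h2
    have h2' : (2 : κ) ≠ 0 := Ring.two_ne_zero h2
    have h4 : (4 : κ) ≠ 0 := by
      have : (4 : κ) = 2 * 2 := by norm_num
      rw [this]; exact mul_ne_zero h2' h2'
    -- Completing the square turns the form into a² - ((T² - 4N)/4) b².
    obtain ⟨a, b, hab⟩ := FiniteField.exists_root_sum_quadratic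
      (f := Polynomial.C 1 * Polynomial.X ^ 2 + Polynomial.C 0 * Polynomial.X + Polynomial.C (-u))
      (g := Polynomial.C (-((T ^ 2 - 4 * N) / 4)) * Polynomial.X ^ 2 +
        Polynomial.C 0 * Polynomial.X + Polynomial.C 0)
      (Polynomial.degree_quadratic one_ne_zero)
      (Polynomial.degree_quadratic (neg_ne_zero.2 (div_ne_zero hδ h4))) hc
    refine ⟨a - T / 2 * b, b, ?_⟩
    simp only [Polynomial.eval_add, Polynomial.eval_mul, Polynomial.eval_C, Polynomial.eval_pow,
      Polynomial.eval_X] at hab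
    field_simp at hab ⊢
    linear_combination hab

variable {Q : Type*} [CommRing Q]

/-- Lifting of a representation by the form `a² + T a b + N b²` along an ideal for which the
equations `Z² - Z - n d = 0`, with `d` in the ideal, have unit solutions. -/
lemma exists_quadForm_eq_of_sub_mem {T N u : Q} (hδ : IsUnit (T ^ 2 - 4 * N))
    (I : Ideal Q) (hI : ∀ d ∈ I, ∀ n : Q, ∃ Z : Q, IsUnit Z ∧ Z ^ 2 - Z - n * d = 0)
    (hunit : ∀ v : Q, u - v ∈ I → IsUnit v)
    {a b : Q} (hab : u - (a ^ 2 + T * a * b + N * b ^ 2) ∈ I) :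
    ∃ a b : Q, a ^ 2 + T * a * b + N * b ^ 2 = u := by
  obtain ⟨δ, hδ⟩ := hδ.exists_right_inv
  obtain ⟨v', hv⟩ := (hunit _ hab).exists_right_inv
  set v := a ^ 2 + T * a * b + N * b ^ 2 with hvdef
  -- The form is the norm of a + bθ, where θ has trace T and norm N. The element p + rθ is chosen of
  -- trace one, so 1 + X(p + rθ) has norm 1 + X + nX² with n the norm of p + rθ. Multiplying a + bθ
  -- by it corrects v to u if X + nX² = d for d = (u - v)/v. The substitution X = d/Z turns this
  -- into Z² - Z - nd = 0, which has a root near 1 even in residue characteristic two.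
  set p := -2 * N * δ with hp
  set r := T * δ with hr
  have htr : 2 * p + T * r = 1 := by rw [hp, hr]; linear_combination hδ
  obtain ⟨Z, hZ, hZ2⟩ := hI ((u - v) * v') (I.mul_mem_right _ hab) (p ^ 2 + T * p * r + N * r ^ 2)
  obtain ⟨Z', hZ'⟩ := hZ.exists_right_inv
  set X := (u - v) * v' * Z' with hX
  refine ⟨a * (1 + X * p) - N * b * (X * r), a * (X * r) + b * (1 + X * p) + T * b * (X * r), ?_⟩
  have key : (1 + X * p) ^ 2 + T * (1 + X * p) * (X * r) + N * (X * r) ^ 2 = u * v' := by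
    have h1 : (1 + X * p) ^ 2 + T * (1 + X * p) * (X * r) + N * (X * r) ^ 2 =
        1 + X * (2 * p + T * r) + X ^ 2 * (p ^ 2 + T * p * r + N * r ^ 2) := by ring
    rw [h1, htr]
    have h2 : X * Z = (u - v) * v' := by rw [hX]; linear_combination (u - v) * v' * hZ'
    have h3 : X + X ^ 2 * (p ^ 2 + T * p * r + N * r ^ 2) = (u - v) * v' := by
      have : X * (Z ^ 2 - Z - (p ^ 2 + T * p * r + N * r ^ 2) * ((u - v) * v')) * Z' = 0 := by
        rw [hZ2]; ring
      rw [← h2] at this ⊢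
      linear_combination -this + X * (Z - 1 - (p ^ 2 + T * p * r + N * r ^ 2) * X) * hZ'
    linear_combination h3 - hv
  calc _ = v * ((1 + X * p) ^ 2 + T * (1 + X * p) * (X * r) + N * (X * r) ^ 2) := by
        rw [hvdef]; ring
    _ = u := by rw [key]; linear_combination u * hv

/-- A form `a² + T a b + N b²` of unit discriminant over a finite ring represents all units. -/
lemma exists_quadForm_eq_of_finite [Finite Q] {T N u : Q} (hδ : IsUnit (T ^ 2 - 4 * N))
    (hu : IsUnit u) : ∃ a b : Q, a ^ 2 + T * a * b + N * b ^ 2 = u := by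
  -- Modulo the nilradical the ring is a finite product of finite fields, where the form represents
  -- everything.
  have hred : ∃ a b : Q ⧸ nilradical Q, a ^ 2 + Ideal.Quotient.mk _ T * a * b +
      Ideal.Quotient.mk _ N * b ^ 2 = Ideal.Quotient.mk (nilradical Q) u := by
    have : Finite (Q ⧸ nilradical Q) :=
      Finite.of_surjective _ Ideal.Quotient.mk_surjective
    have : IsArtinianRing (Q ⧸ nilradical Q) := inferInstance
    have : IsReduced (Q ⧸ nilradical Q) :=
      (Ideal.isRadical_iff_quotient_reduced _).1 (Ideal.radical_isRadical _)
    set e := IsArtinianRing.equivPi (Q ⧸ nilradical Q)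
    have hloc : ∀ I : MaximalSpectrum (Q ⧸ nilradical Q), ∃ a b : (Q ⧸ nilradical Q) ⧸ I.asIdeal,
        a ^ 2 + e (Ideal.Quotient.mk _ T) I * a * b + e (Ideal.Quotient.mk _ N) I * b ^ 2 =
          e (Ideal.Quotient.mk _ u) I := by
      intro I
      let := Ideal.Quotient.field I.asIdeal
      have : Finite ((Q ⧸ nilradical Q) ⧸ I.asIdeal) :=
        Finite.of_surjective _ Ideal.Quotient.mk_surjective
      refine exists_quadForm_eq_of_field ?_ _
      have h1 := ((hδ.map (Ideal.Quotient.mk (nilradical Q))).map e).map (Pi.evalRingHom _ I)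
      have h2 := h1.ne_zero
      simpa [map_ofNat] using h2
    choose a b hab using hloc
    refine ⟨e.symm a, e.symm b, e.injective (funext fun I => ?_)⟩
    simpa using hab I
  obtain ⟨a, b, hab⟩ := hred
  obtain ⟨a, rfl⟩ := Ideal.Quotient.mk_surjective a
  obtain ⟨b, rfl⟩ := Ideal.Quotient.mk_surjective b
  refine exists_quadForm_eq_of_sub_mem hδ (nilradical Q) (fun d hd n => ?_) (fun v hv => ?_)
    (a := a) (b := b) ?_
  -- Newton iteration from 1: there Z² - Z - nd has nilpotent value and derivative 1.
  · obtain ⟨Z, ⟨hZ, hZ'⟩, -⟩ := Polynomial.existsUnique_nilpotent_sub_and_aeval_eq_zero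
      (R := Q) (S := Q) (x := 1)
      (P := Polynomial.X ^ 2 - Polynomial.X - Polynomial.C (n * d)) (by
        simp only [map_sub, map_pow, Polynomial.aeval_X, Polynomial.aeval_C,
          Algebra.algebraMap_self, RingHom.id_apply]
        have : (1 : Q) ^ 2 - 1 - n * d = -(n * d) := by ring
        rw [this]
        exact ((Commute.all n d).isNilpotent_mul_left (mem_nilradical.1 hd)).neg) (by
        simp)
    refine ⟨Z, ?_, by simpa using hZ'⟩
    have := IsNilpotent.isUnit_add_left_of_commute hZ.neg isUnit_one (Commute.all _ _)
    simpa using this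
  · have := IsNilpotent.isUnit_add_left_of_commute (mem_nilradical.1 hv).neg hu (Commute.all _ _)
    simpa using this
  · rw [← Ideal.Quotient.eq_zero_iff_mem, map_sub, ← hab]
    simp

/-- A form `a² + T a b + N b²` of unit discriminant over an `I`-adically complete ring with
finite quotient by `I` represents all units. -/
lemma exists_quadForm_eq {E : Type*} [CommRing E] (I : Ideal E) [IsAdicComplete I E]
    [Finite (E ⧸ I)] {T N u : E} (hδ : IsUnit (T ^ 2 - 4 * N)) (hu : IsUnit u) :
    ∃ a b : E, a ^ 2 + T * a * b + N * b ^ 2 = u := by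
  have hjac : ∀ v x : E, IsUnit v → x ∈ I → IsUnit (v + x) := by
    intro v x hv hx
    obtain ⟨v, rfl⟩ := hv
    have h1 := Ideal.mem_jacobson_bot.1 (IsAdicComplete.le_jacobson_bot I hx) (↑v⁻¹ : E)
    have : (v : E) + x = v * (x * ↑v⁻¹ + 1) := by
      rw [mul_add, mul_comm x, ← mul_assoc, Units.mul_inv]; ring
    rw [this]
    exact v.isUnit.mul h1
  obtain ⟨a, b, hab⟩ := exists_quadForm_eq_of_finite (Q := E ⧸ I) (T := Ideal.Quotient.mk I T)
    (N := Ideal.Quotient.mk I N) (by simpa [map_ofNat] using hδ.map (Ideal.Quotient.mk I))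
    (hu.map (Ideal.Quotient.mk I))
  obtain ⟨a, rfl⟩ := Ideal.Quotient.mk_surjective a
  obtain ⟨b, rfl⟩ := Ideal.Quotient.mk_surjective b
  refine exists_quadForm_eq_of_sub_mem hδ I (fun d hd n => ?_) (fun v hv => ?_)
    (a := a) (b := b) ?_
  · obtain ⟨Z, hZ, hZ'⟩ := HenselianRing.is_henselian (I := I)
      (Polynomial.X ^ 2 - Polynomial.X - Polynomial.C (n * d)) (by monicity!) 1 (by
        simpa using I.mul_mem_left n hd) (by simp)
    refine ⟨Z, ?_, by simpa [Polynomial.IsRoot] using hZ⟩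
    simpa using hjac 1 _ isUnit_one hZ'
  · simpa using hjac u _ hu (I.neg_mem hv)
  · rw [← Ideal.Quotient.eq_zero_iff_mem, map_sub, ← hab]
    simp

/-- A finite algebra over a complete Noetherian local ring is complete. -/
lemma isAdicComplete_of_finite {R E : Type*} [CommRing R] [IsNoetherianRing R] (m : Ideal R)
    [IsAdicComplete m R] [CommRing E] [Algebra R E] [Module.Finite R E] :
    IsAdicComplete (m.map (algebraMap R E)) E := by
  rw [IsAdicComplete.map_algebraMap_iff]
  -- Separatedness is Krull's intersection theorem, since the ideal lies in the Jacobson radical.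
  -- Precompleteness passes to `E` as a quotient of a finite free module.
  have h1 : IsHausdorff m E := IsHausdorff.of_le_jacobson m E (IsAdicComplete.le_jacobson_bot m)
  have h2 : IsPrecomplete m E := by
    obtain ⟨n, f, hf⟩ := Module.Finite.exists_fin' R E
    refine ⟨fun g hg => ?_⟩
    have hpi : IsPrecomplete m (Fin n → R) := by
      rw [← AdicCompletion.of_surjective_iff]
      intro x
      choose y hy using fun i => AdicCompletion.of_surjective m R (AdicCompletion.piEquivFin m n x i)
      refine ⟨y, (AdicCompletion.piEquivFin m n).injective (funext fun i => ?_)⟩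
      rw [← hy]
      simp only [AdicCompletion.piEquivFin_apply]
      rfl
    have hE : IsPrecomplete m E := by
      rw [← AdicCompletion.of_surjective_iff]
      intro x
      obtain ⟨y, rfl⟩ := AdicCompletion.map_surjective m hf x
      obtain ⟨z, rfl⟩ := AdicCompletion.of_surjective m (Fin n → R) y
      exact ⟨f z, (AdicCompletion.map_of m f z).symm⟩
    exact hE.prec hg
  exact { }

end Norms

/-! ### Lattices over the maximal order of an étale algebra -/

section EtaleLattices

lemma isIntegral_pi_iff {R ι : Type*} [CommRing R] [Finite ι] {K : ι → Type*}
    [∀ i, CommRing (K i)] [∀ i, Algebra R (K i)] {x : ∀ i, K i} :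
    IsIntegral R x ↔ ∀ i, IsIntegral R (x i) := by
  refine ⟨fun hx i => hx.map (Pi.evalAlgHom R K i), fun hx => ?_⟩
  have := Fintype.ofFinite ι
  choose p hp hp' using hx
  refine ⟨∏ i, p i, Polynomial.monic_prod_of_monic _ _ fun i _ => hp i, funext fun i => ?_⟩
  rw [← Polynomial.aeval_def]
  have h1 : Polynomial.aeval x (∏ i, p i) i = Polynomial.aeval (x i) (∏ i, p i) :=
    (Polynomial.aeval_algHom_apply (Pi.evalAlgHom R K i) x _).symm
  rw [h1, map_prod]
  exact Finset.prod_eq_zero (Finset.mem_univ i) (hp' i)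

variable {R F : Type*} [CommRing R] [IsDomain R] [IsDiscreteValuationRing R] [Field F]
  [Algebra R F] [IsFractionRing R F]

-- The integral closure is Dedekind and has finitely many maximal ideals, all lying over that of
-- `R`; a semilocal Dedekind domain is principal.
variable (R F) in
lemma isPrincipalIdealRing_integralClosure (K : Type*) [Field K] [Algebra F K] [Algebra R K]
    [IsScalarTower R F K] [FiniteDimensional F K] [Algebra.IsSeparable F K] :
    IsPrincipalIdealRing (integralClosure R K) := by
  have hD := integralClosure.isDedekindDomain R F K
  have : Module.IsTorsionFree R K := Module.IsTorsionFree.trans_faithfulSMul R F K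
  have : Module.IsTorsionFree R (integralClosure R K) := inferInstance
  refine IsPrincipalIdealRing.of_finite_maximals
    ((IsDedekindDomain.primesOver_finite (IsLocalRing.maximalIdeal R)
      (integralClosure R K)).subset fun I hI => ?_)
  have hI' : I.IsMaximal := hI
  refine ⟨hI'.isPrime, ⟨?_⟩⟩
  exact (IsLocalRing.eq_maximalIdeal (Ideal.isMaximal_comap_of_isIntegral_of_isMaximal I)).symm

/-- A lattice over the ring of integers of a finite separable field extension `K` in `K ^ h`
is the image of the standard lattice under an automorphism. -/
lemma exists_linearEquiv_of_lattice_field {K : Type*} [Field K] [Algebra F K] [Algebra R K]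
    [IsScalarTower R F K] [FiniteDimensional F K] [Algebra.IsSeparable F K] {h : ℕ}
    (Λ : Submodule R (Fin h → K)) (hfg : Λ.FG) (hspan : ∀ v, ∃ r : R, r ≠ 0 ∧ r • v ∈ Λ)
    (hstab : ∀ a : K, IsIntegral R a → ∀ v ∈ Λ, a • v ∈ Λ) :
    ∃ G : (Fin h → K) ≃ₗ[K] (Fin h → K), ∀ v, v ∈ Λ ↔ ∀ j, IsIntegral R (G v j) := by
  have hpid := isPrincipalIdealRing_integralClosure R F K
  have : Module.IsTorsionFree R K := Module.IsTorsionFree.trans_faithfulSMul R F K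
  have hfrac : IsFractionRing (integralClosure R K) K :=
    integralClosure.isFractionRing_of_finite_extension F K
  let Λ' : Submodule (integralClosure R K) (Fin h → K) :=
    { Λ.toAddSubmonoid with
      smul_mem' := fun a v hv => hstab a a.2 v hv }
  have hmem : ∀ v, v ∈ Λ' ↔ v ∈ Λ := fun v => Iff.rfl
  have hlat : Λ'.IsLattice K := by
    refine ⟨?_, ?_⟩
    · obtain ⟨s, hs⟩ := hfg
      refine ⟨s, le_antisymm (Submodule.span_le.2 fun x hx => ?_) fun x hx => ?_⟩
      · exact (hmem x).2 (hs ▸ Submodule.subset_span hx)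
      · have : x ∈ Submodule.span R (s : Set (Fin h → K)) := hs ▸ hx
        exact Submodule.span_le_restrictScalars R (integralClosure R K) _ this
    · refine eq_top_iff.2 fun v _ => ?_
      obtain ⟨r, hr, hv⟩ := hspan v
      have hr' : algebraMap R K r ≠ 0 := by simpa using hr
      have : v = (algebraMap R K r)⁻¹ • (r • v) := by
        rw [← algebraMap_smul K r v, smul_smul, inv_mul_cancel₀ hr', one_smul]
      rw [this]
      exact Submodule.smul_mem _ _ (Submodule.subset_span hv)
  have hcard : Module.finrank (integralClosure R K) Λ' = h := by
    simpa using Submodule.IsLattice.finrank_of_pi (K := K) Λ'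
  let b₀ := Module.finBasisOfFinrankEq (integralClosure R K) Λ' hcard
  refine ⟨(b₀.extendOfIsLattice K).equivFun, fun v => ⟨fun hv j => ?_, fun hv => ?_⟩⟩
  · have h1 : v = ∑ k, (b₀.repr ⟨v, hv⟩ k : K) • b₀.extendOfIsLattice K k := by
      have h2 := congrArg Subtype.val (b₀.sum_repr ⟨v, hv⟩)
      simp only [Module.Basis.extendOfIsLattice_apply]
      refine h2.symm.trans ?_
      rw [AddSubmonoidClass.coe_finsetSum]
      rfl
    rw [h1, Module.Basis.equivFun_apply, Module.Basis.repr_sum_self]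
    exact (b₀.repr ⟨v, hv⟩ j).2
  · rw [← (b₀.extendOfIsLattice K).sum_repr v]
    refine Λ.sum_mem fun k _ => hstab _ (hv k) _ ?_
    rw [Module.Basis.extendOfIsLattice_apply]
    exact (b₀ k).2

/-- A lattice over the ring of integers of a finite étale algebra `A` in `A ^ h` is free: it is
the image of the standard lattice under an automorphism. -/
lemma exists_linearEquiv_of_lattice_aux {ι : Type*} [Finite ι] {K : ι → Type*} [∀ i, Field (K i)]
    [∀ i, Algebra F (K i)] [∀ i, Algebra R (K i)] [∀ i, IsScalarTower R F (K i)]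
    [∀ i, FiniteDimensional F (K i)] [∀ i, Algebra.IsSeparable F (K i)]
    {A : Type*} [CommRing A] [Algebra R A] (e : A ≃ₐ[R] ∀ i, K i) {h : ℕ}
    (Λ : Submodule R (Fin h → A)) (hfg : Λ.FG) (hspan : ∀ v, ∃ r : R, r ≠ 0 ∧ r • v ∈ Λ)
    (hstab : ∀ a : A, IsIntegral R a → ∀ v ∈ Λ, a • v ∈ Λ) :
    ∃ P : (Fin h → A) ≃ₗ[A] (Fin h → A), ∀ v, P v ∈ Λ ↔ ∀ j, IsIntegral R (v j) := by
  classical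
  have := Fintype.ofFinite ι
  have hint : ∀ a : A, IsIntegral R a ↔ ∀ i, IsIntegral R (e a i) := fun a => by
    rw [← isIntegral_pi_iff]
    exact (isIntegral_algEquiv e).symm
  let pr : ∀ i, (Fin h → A) →ₗ[R] (Fin h → K i) := fun i =>
    LinearMap.pi fun j => (LinearMap.proj i).comp (e.toLinearMap.comp (LinearMap.proj j))
  have hpr : ∀ i v j, pr i v j = e (v j) i := fun i v j => rfl
  have hprsurj : ∀ i (v : Fin h → K i), ∃ u, pr i u = v := fun i v =>
    ⟨fun j => e.symm (Pi.single i (v j)), funext fun j => by simp [hpr]⟩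
  -- The idempotents of the product are integral, so they preserve Λ, and Λ is the product of its
  -- projections to the factors.
  have hmem : ∀ v, v ∈ Λ ↔ ∀ i, pr i v ∈ Λ.map (pr i) := by
    refine fun v => ⟨fun hv i => Submodule.mem_map_of_mem hv, fun hv => ?_⟩
    choose u hu hu' using hv
    have : v = ∑ i, e.symm (Pi.single i 1) • u i := by
      refine funext fun j => e.injective (funext fun i => ?_)
      have h1 := congrFun (hu' i) j
      rw [hpr, hpr] at h1
      simp only [Finset.sum_apply, Pi.smul_apply, smul_eq_mul, map_sum, map_mul,
        AlgEquiv.apply_symm_apply, Pi.mul_apply]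
      rw [Finset.sum_eq_single i (fun k _ hk => by simp [Pi.single_eq_of_ne' hk]) (by simp)]
      simpa using h1.symm
    rw [this]
    refine Λ.sum_mem fun i _ => hstab _ ?_ _ (hu i)
    rw [hint]
    intro k
    rw [AlgEquiv.apply_symm_apply]
    by_cases hik : k = i
    · subst hik; simpa using isIntegral_one
    · simpa [hik] using isIntegral_zero
  have hb : ∀ i, ∃ G : (Fin h → K i) ≃ₗ[K i] (Fin h → K i),
      ∀ v, v ∈ Λ.map (pr i) ↔ ∀ j, IsIntegral R (G v j) := by
    intro i
    refine exists_linearEquiv_of_lattice_field (F := F) _ (hfg.map _) (fun v => ?_) ?_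
    · obtain ⟨u, rfl⟩ := hprsurj i v
      obtain ⟨r, hr, hu⟩ := hspan u
      exact ⟨r, hr, by rw [← map_smul]; exact Submodule.mem_map_of_mem hu⟩
    · rintro a ha _ ⟨u, hu, rfl⟩
      refine ⟨e.symm (Pi.single i a) • u, hstab _ ?_ _ hu, funext fun j => by simp [hpr]⟩
      rw [hint]
      intro k
      rw [AlgEquiv.apply_symm_apply]
      by_cases hik : k = i
      · subst hik; simpa using ha
      · simpa [hik] using isIntegral_zero
  choose G hG using hb
  let P : (Fin h → A) ≃ₗ[A] (Fin h → A) :=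
    { toFun := fun v j => e.symm fun i => (G i).symm (fun k => e (v k) i) j
      invFun := fun u k => e.symm fun i => G i (fun j => e (u j) i) k
      map_add' := fun v w => funext fun j => e.injective (funext fun i => by
        simp only [map_add, Pi.add_apply, AlgEquiv.apply_symm_apply]
        exact congrFun ((G i).symm.map_add (fun k => e (v k) i) (fun k => e (w k) i)) j)
      map_smul' := fun a v => funext fun j => e.injective (funext fun i => by
        simp only [AlgEquiv.apply_symm_apply, Pi.smul_apply, smul_eq_mul,
          RingHom.id_apply, map_mul, Pi.mul_apply]
        exact congrFun ((G i).symm.map_smul (e a i) (fun k => e (v k) i)) j)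
      left_inv := fun v => funext fun j => e.injective (funext fun i => by simp)
      right_inv := fun v => funext fun j => e.injective (funext fun i => by simp) }
  refine ⟨P, fun v => ?_⟩
  rw [hmem]
  have hPv : ∀ i, pr i (P v) = (G i).symm (fun k => e (v k) i) := fun i =>
    funext fun j => by simp [hpr, P]
  simp only [hG, hPv, hint, LinearEquiv.apply_symm_apply]
  exact forall_comm

/-- A finite unramified algebra over a field is a finite product of finite separable extensions, so
the product case applies. -/
lemma exists_linearEquiv_of_lattice (F) {R : Type*} [CommRing R] [IsDomain R]
    [IsDiscreteValuationRing R] [Field F] [Algebra R F] [IsFractionRing R F]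
    {A : Type*} [CommRing A] [Algebra F A] [Algebra R A] [IsScalarTower R F A]
    [Module.Finite F A] [Algebra.FormallyUnramified F A] {h : ℕ}
    (Λ : Submodule R (Fin h → A)) (hfg : Λ.FG) (hspan : ∀ v, ∃ r : R, r ≠ 0 ∧ r • v ∈ Λ)
    (hstab : ∀ a : A, IsIntegral R a → ∀ v ∈ Λ, a • v ∈ Λ) :
    ∃ P : (Fin h → A) ≃ₗ[A] (Fin h → A), ∀ v, P v ∈ Λ ↔ ∀ j, IsIntegral R (v j) := by
  have : IsArtinianRing A := .of_finite F A
  have : IsReduced A := Algebra.FormallyUnramified.isReduced_of_field F A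
  let (I : MaximalSpectrum A) : Field (A ⧸ I.asIdeal) := Ideal.Quotient.field I.asIdeal
  have (I : MaximalSpectrum A) : Algebra.FormallyUnramified F (A ⧸ I.asIdeal) := 
    .of_surjective (Ideal.Quotient.mkₐ F I.asIdeal) (Ideal.Quotient.mkₐ_surjective F _)
  have (I : MaximalSpectrum A) : Algebra.IsSeparable F (A ⧸ I.asIdeal) :=
    Algebra.FormallyUnramified.isSeparable F (A ⧸ I.asIdeal)
  exact exists_linearEquiv_of_lattice_aux (F := F)
    ((IsArtinianRing.equivPi A).restrictScalars R) Λ hfg hspan hstab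

/-- The integral closure embeds into the product of the integral closures in the separable field
factors, each a Noetherian module over `R`. -/
lemma finite_integralClosure (F) {R : Type*} [CommRing R] [IsDomain R]
    [IsDiscreteValuationRing R] [Field F] [Algebra R F] [IsFractionRing R F]
    (A : Type*) [CommRing A] [Algebra F A] [Algebra R A] [IsScalarTower R F A]
    [Module.Finite F A] [Algebra.FormallyUnramified F A] :
    (integralClosure R A).toSubmodule.FG := by
  have : IsArtinianRing A := .of_finite F A
  have : IsReduced A := Algebra.FormallyUnramified.isReduced_of_field F A
  let (I : MaximalSpectrum A) : Field (A ⧸ I.asIdeal) := Ideal.Quotient.field I.asIdeal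
  have (I : MaximalSpectrum A) : Algebra.FormallyUnramified F (A ⧸ I.asIdeal) := 
    .of_surjective (Ideal.Quotient.mkₐ F I.asIdeal) (Ideal.Quotient.mkₐ_surjective F _)
  have (I : MaximalSpectrum A) : Algebra.IsSeparable F (A ⧸ I.asIdeal) :=
    Algebra.FormallyUnramified.isSeparable F (A ⧸ I.asIdeal)
  have hN (I : MaximalSpectrum A) : IsNoetherian R (integralClosure R (A ⧸ I.asIdeal)) :=
    IsIntegralClosure.isNoetherian R F (A ⧸ I.asIdeal) _
  let e := (IsArtinianRing.equivPi A).restrictScalars R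
  have hint : ∀ (a : integralClosure R A) I, IsIntegral R (e a I) := fun a I =>
    isIntegral_pi_iff.1 ((isIntegral_algEquiv e).2 a.2) I
  let f : integralClosure R A →ₗ[R] ∀ I : MaximalSpectrum A, integralClosure R (A ⧸ I.asIdeal) :=
    { toFun := fun a I => ⟨e a I, hint a I⟩
      map_add' := fun a b => by ext; simp
      map_smul' := fun a b => by ext; simp [Algebra.smul_def] }
  have hf : Function.Injective f := fun a b hab => Subtype.ext (e.injective (funext fun I =>
    congrArg Subtype.val (congrFun hab I)))
  have : Finite (MaximalSpectrum A) := inferInstance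
  have : IsNoetherian R (integralClosure R A) := isNoetherian_of_injective f hf
  exact Module.Finite.iff_fg.1 (inferInstanceAs (Module.Finite R (integralClosure R A)))

end EtaleLattices

/-- An algebra generated by a root of a polynomial `f`, at which `f'` is a unit, is formally
unramified. -/
lemma formallyUnramified_of_generator {R A : Type*} [CommRing R] [CommRing A] [Algebra R A]
    (θ : A) (hθ : Algebra.adjoin R {θ} = ⊤) (f : Polynomial R) (hf : Polynomial.aeval θ f = 0)
    (hf' : IsUnit (Polynomial.aeval θ f.derivative)) : Algebra.FormallyUnramified R A := by
  refine Algebra.FormallyUnramified.iff_comp_injective.2 fun B _ _ I hI g₁ g₂ hg => ?_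
  have hx : g₁ θ - g₂ θ ∈ I := by
    rw [← Ideal.Quotient.eq]
    exact DFunLike.congr_fun hg θ
  refine AlgHom.ext_of_adjoin_eq_top hθ fun x hx' => ?_
  obtain rfl : x = θ := hx'
  -- Both lifts send θ to roots of f whose difference has square zero. In the Taylor expansion only
  -- f' times the difference survives, and f' is a unit there.
  obtain ⟨k, hk⟩ := Polynomial.binomExpansion (f.map (algebraMap R B)) (g₂ x) (g₁ x - g₂ x)
  have h1 : (f.map (algebraMap R B)).eval (g₁ x) = 0 := by
    rw [Polynomial.eval_map_algebraMap, Polynomial.aeval_algHom_apply, hf, map_zero]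
  have h2 : (f.map (algebraMap R B)).eval (g₂ x) = 0 := by
    rw [Polynomial.eval_map_algebraMap, Polynomial.aeval_algHom_apply, hf, map_zero]
  have h3 : (g₁ x - g₂ x) ^ 2 = 0 := by
    have := Ideal.pow_mem_pow hx 2
    rwa [hI] at this
  rw [add_sub_cancel, h1, h2, h3, Polynomial.derivative_map, Polynomial.eval_map_algebraMap,
    Polynomial.aeval_algHom_apply] at hk
  have h4 := (hf'.map g₂).mul_right_eq_zero.1
    (show _ * (g₁ x - g₂ x) = 0 by linear_combination -hk)
  exact sub_eq_zero.1 h4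

/-! ### Identities between ζ, ϖ, `𝐰` and `𝐳` -/

section
variable {F M : Type*} [Field F] [Ring M] [Algebra F M]

/-- Two elements `ζ`, `ϖ` of an `F`-algebra that are roots of quadratic polynomials with traces
`T`, `t` and norms `N`, `n`, with conjugates `ζ'`, `ϖ'`. -/
structure IsQuadraticPair (ζ ζ' ϖ ϖ' : M) (T N t n : F) : Prop where
  add₁ : ζ + ζ' = T • (1 : M)
  mul₁ : ζ * ζ' = N • (1 : M)
  add₂ : ϖ + ϖ' = t • (1 : M)
  mul₂ : ϖ * ϖ' = n • (1 : M)

namespace IsQuadraticPair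
variable {ζ ζ' ϖ ϖ' : M} {T N t n : F} (H : IsQuadraticPair ζ ζ' ϖ ϖ' T N t n)
include H

lemma eq₁ : ζ' = T • 1 - ζ := by rw [← H.add₁]; abel
lemma eq₂ : ϖ' = t • 1 - ϖ := by rw [← H.add₂]; abel
lemma sq₁ : ζ * ζ = T • ζ - N • 1 := by
  rw [← H.mul₁, H.eq₁, mul_sub, mul_smul_comm, mul_one]; abel
lemma sq₂ : ϖ * ϖ = t • ϖ - n • 1 := by
  rw [← H.mul₂, H.eq₂, mul_sub, mul_smul_comm, mul_one]; abel
lemma sq₁' (x : M) : ζ * (ζ * x) = T • (ζ * x) - N • x := by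
  rw [← mul_assoc, H.sq₁, sub_mul, smul_mul_assoc, smul_mul_assoc, one_mul]
lemma sq₂' (x : M) : ϖ * (ϖ * x) = t • (ϖ * x) - n • x := by
  rw [← mul_assoc, H.sq₂, sub_mul, smul_mul_assoc, smul_mul_assoc, one_mul]

lemma ζ_mul_z : ζ * (ϖ * ζ - ζ * ϖ) = (ϖ * ζ - ζ * ϖ) * ζ' := by
  simp only [H.eq₁, mul_sub, sub_mul, mul_assoc, H.sq₁, H.sq₁', mul_smul_comm, mul_one]
  module

/-- Together with `ϖ_mul_w` this places `𝐰` in the centre of the algebra generated by ζ and ϖ. -/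
lemma ζ_mul_w : ζ * (ζ * ϖ + ϖ' * ζ') = (ζ * ϖ + ϖ' * ζ') * ζ := by
  simp only [H.eq₁, H.eq₂, mul_sub, sub_mul, mul_add, add_mul, mul_assoc, H.sq₁, H.sq₁',
    mul_smul_comm, smul_mul_assoc, mul_one, one_mul, smul_sub]
  module

lemma ϖ_mul_w : ϖ * (ζ * ϖ + ϖ' * ζ') = (ζ * ϖ + ϖ' * ζ') * ϖ := by
  simp only [H.eq₁, H.eq₂, mul_sub, sub_mul, mul_add, add_mul, mul_assoc, H.sq₂, H.sq₂',
    mul_smul_comm, smul_mul_assoc, mul_one, one_mul, smul_sub]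
  module

/-- When T² - 4N is a unit, ζ - ζ' is invertible and this recovers ϖ integrally from ζ, `𝐰` and `𝐳`;
so stability of a lattice under ϖ can be tested on those three. -/
lemma sub_mul_ϖ : (ζ - ζ') * ϖ = (ζ * ϖ + ϖ' * ζ') - (ϖ * ζ - ζ * ϖ) - t • ζ' := by
  simp only [H.eq₁, H.eq₂, mul_sub, sub_mul,
    mul_smul_comm, smul_mul_assoc, mul_one, one_mul, smul_sub]
  module

/-- The pivotal identity: although `𝐳` is not a polynomial in `𝐰`, its square is one. For integral
traces and norms the coefficients are integral, so `𝐳²` lies in the order generated by `𝐰`, where it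
can be compared with norms. -/
lemma z_sq : (ϖ * ζ - ζ * ϖ) * (ϖ * ζ - ζ * ϖ) = (ζ * ϖ + ϖ' * ζ') * (ζ * ϖ + ϖ' * ζ') -
    (t * T) • (ζ * ϖ + ϖ' * ζ') + (t ^ 2 * N + T ^ 2 * n - 4 * N * n) • 1 := by
  simp only [H.eq₁, H.eq₂, mul_sub, sub_mul, mul_add, add_mul, mul_assoc, H.sq₁, H.sq₁', H.sq₂,
    H.sq₂', mul_smul_comm, smul_mul_assoc, mul_one, one_mul, smul_sub, smul_add]
  module

lemma sub_sq : (ζ - ζ') * (ζ - ζ') = (T ^ 2 - 4 * N) • 1 := by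
  simp only [H.eq₁, mul_sub, sub_mul, H.sq₁,
    mul_smul_comm, smul_mul_assoc, mul_one, one_mul, smul_sub]
  module

end IsQuadraticPair
end

/-! ### The algebra F[`𝐰`] and its action -/

section PolynomialAction
variable {F M : Type*} [Field F] [Ring M] [Algebra F M]

/-- The embedding of `F[X] / (minpoly w)` into an algebra containing `w`. -/
noncomputable def polyAction (w : M) : AdjoinRoot (minpoly F w) →ₐ[F] M :=
  Ideal.Quotient.liftₐ _ (Polynomial.aeval w) fun a ha => by
    obtain ⟨b, rfl⟩ := Ideal.mem_span_singleton.1 ha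
    simp

lemma polyAction_mk (w : M) (p : Polynomial F) :
    polyAction w (AdjoinRoot.mk (minpoly F w) p) = Polynomial.aeval w p := rfl

lemma polyAction_root (w : M) : polyAction w (AdjoinRoot.root (minpoly F w)) = w := by
  rw [← AdjoinRoot.mk_X, polyAction_mk, Polynomial.aeval_X]

lemma polyAction_injective (w : M) : Function.Injective (polyAction (F := F) w) := by
  rw [injective_iff_map_eq_zero]
  intro a ha
  obtain ⟨p, rfl⟩ := AdjoinRoot.mk_surjective a
  rw [polyAction_mk] at ha
  exact AdjoinRoot.mk_eq_zero.2 (minpoly.dvd F w ha)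

lemma commute_polyAction {w m : M} (hm : m * w = w * m) (x : AdjoinRoot (minpoly F w)) :
    m * polyAction w x = polyAction w x * m := by
  obtain ⟨p, rfl⟩ := AdjoinRoot.mk_surjective x
  rw [polyAction_mk]
  have h1 : p.aeval w ∈ Algebra.adjoin F {w} := Polynomial.aeval_mem_adjoin_singleton F w
  have h2 : p.aeval w ∈ Subalgebra.centralizer F {m} :=
    Algebra.adjoin_le (S := Subalgebra.centralizer F {m}) (Set.singleton_subset_iff.2
      ((Subalgebra.mem_centralizer_iff F).2 (by simpa using hm))) h1
  exact (Subalgebra.mem_centralizer_iff F).1 h2 m rfl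

end PolynomialAction

/-! ### The norm form over the order generated by an integral element -/

section Order
variable {F : Type*} [Field F] [ValuativeRel F] [TopologicalSpace F] [IsNonarchimedeanLocalField F]

/-- The norm form of an unramified quadratic extension represents all units of an order
`𝒪[F][θ]`. -/
lemma exists_quadForm_eq_of_adjoin {L : Type*} [CommRing L] [Algebra 𝒪[F] L] {θ : L}
    (hθ : IsIntegral 𝒪[F] θ) {T N : 𝒪[F]} (hδ : IsUnit (T ^ 2 - 4 * N)) {u u' : L}
    (hu : u ∈ Algebra.adjoin 𝒪[F] {θ}) (huu' : u * u' = 1) (hu' : IsIntegral 𝒪[F] u') :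
    u' ∈ Algebra.adjoin 𝒪[F] {θ} ∧ ∃ a ∈ Algebra.adjoin 𝒪[F] {θ}, ∃ b ∈ Algebra.adjoin 𝒪[F] {θ},
      a ^ 2 + algebraMap 𝒪[F] L T * a * b + algebraMap 𝒪[F] L N * b ^ 2 = u := by
  set E := Algebra.adjoin 𝒪[F] {θ} with hE
  have hfin : Module.Finite 𝒪[F] E :=
    Module.Finite.iff_fg.2 hθ.fg_adjoin_singleton
  have hEle : E ≤ integralClosure 𝒪[F] L := Algebra.adjoin_le (Set.singleton_subset_iff.2 hθ)
  -- The order is contained integrally in the integral closure, and along an injective integral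
  -- extension only units become units. So the inverse of u lies in the order itself.
  have huunit : IsUnit (⟨u, hu⟩ : E) := by
    have hint : (Subalgebra.inclusion hEle).toRingHom.IsIntegral := fun x => by
      have h1 : IsIntegral 𝒪[F] x := Algebra.IsIntegral.isIntegral x
      exact RingHom.IsIntegralElem.of_comp (f := algebraMap 𝒪[F] E) h1
    have := hint.isLocalHom (Subalgebra.inclusion_injective hEle)
    refine this.map_nonunit _ ?_
    exact IsUnit.of_mul_eq_one ⟨u', hu'⟩ (Subtype.ext huu')
  obtain ⟨v, hv⟩ := huunit.exists_right_inv
  have hv' : u' = v := by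
    have h1 : u * (v : L) = 1 := congrArg Subtype.val hv
    calc u' = u' * (u * v) := by rw [h1, mul_one]
      _ = v := by rw [← mul_assoc, mul_comm u', huu', one_mul]
  refine ⟨hv' ▸ v.2, ?_⟩
  let := IsTopologicalAddGroup.rightUniformSpace F
  have := isUniformAddGroup_of_addCommGroup (G := F)
  have hc : IsAdicComplete 𝓂[F] 𝒪[F] := inferInstance
  have hc' := isAdicComplete_of_finite (E := E) 𝓂[F]
  have hfinite : Finite (E ⧸ (𝓂[F].map (algebraMap 𝒪[F] E))) := by
    have h1 : Finite (𝒪[F] ⧸ 𝓂[F]) := inferInstanceAs (Finite 𝓀[F])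
    exact Module.finite_of_finite (𝒪[F] ⧸ 𝓂[F])
  obtain ⟨a, b, hab⟩ := exists_quadForm_eq (𝓂[F].map (algebraMap 𝒪[F] E))
    (T := algebraMap 𝒪[F] E T) (N := algebraMap 𝒪[F] E N)
    (by simpa [map_ofNat] using hδ.map (algebraMap 𝒪[F] E)) huunit
  exact ⟨a, a.2, b, b.2, congrArg Subtype.val hab⟩

end Order

/-! ### From a norm equation for `𝐳²` to a semilinear involution -/

section Descent
variable {F M : Type*} [Field F] [Ring M] [Algebra F M]
  {ζ ζ' ϖ ϖ' : M} {T N t n : F}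

namespace IsQuadraticPair

lemma ζ'_mul_w (H : IsQuadraticPair ζ ζ' ϖ ϖ' T N t n) :
    ζ' * (ζ * ϖ + ϖ' * ζ') = (ζ * ϖ + ϖ' * ζ') * ζ' := by
  have := H.ζ_mul_w
  rw [show ζ' = T • 1 - ζ from H.eq₁] at this ⊢
  simp only [sub_mul, mul_sub, smul_mul_assoc, mul_smul_comm, one_mul, mul_one] at this ⊢
  rw [this]

lemma z_mul_ζ (H : IsQuadraticPair ζ ζ' ϖ ϖ' T N t n) :
    (ϖ * ζ - ζ * ϖ) * ζ = ζ' * (ϖ * ζ - ζ * ϖ) := by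
  have := H.ζ_mul_z
  generalize ϖ * ζ - ζ * ϖ = z at this ⊢
  rw [H.eq₁, mul_sub, mul_smul_comm, mul_one] at this
  rw [H.eq₁, sub_mul, smul_mul_assoc, one_mul, this]
  abel

lemma mul₁' (H : IsQuadraticPair ζ ζ' ϖ ϖ' T N t n) : ζ' * ζ = N • (1 : M) := by
  rw [← H.mul₁, H.eq₁]
  simp [mul_sub, sub_mul]

lemma z_mul_w (H : IsQuadraticPair ζ ζ' ϖ ϖ' T N t n) :
    (ϖ * ζ - ζ * ϖ) * (ζ * ϖ + ϖ' * ζ') = (ζ * ϖ + ϖ' * ζ') * (ϖ * ζ - ζ * ϖ) := by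
  have h1 := H.ζ_mul_w
  have h2 := H.ϖ_mul_w
  set w := ζ * ϖ + ϖ' * ζ'
  rw [sub_mul, mul_sub, mul_assoc, h1, mul_assoc, h2, ← mul_assoc, ← mul_assoc, h1, h2, mul_assoc,
    mul_assoc]

end IsQuadraticPair

/-- Norm-one descent: if `𝐳²` is the norm of `y = a + ζ b` with `a`, `b` polynomials in `𝐰`, then
`τ = y⁻¹ 𝐳` is an involution which is semilinear with respect to `ζ ↦ ζ'`. -/
lemma IsQuadraticPair.exists_involution (H : IsQuadraticPair ζ ζ' ϖ ϖ' T N t n)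
    {w z : M} (hw : w = ζ * ϖ + ϖ' * ζ') (hz : z = ϖ * ζ - ζ * ϖ)
    {a b u u' : AdjoinRoot (minpoly F w)} (hab : a ^ 2 + T • (a * b) + N • b ^ 2 = u)
    (hu : polyAction w u = z * z) (huu' : u * u' = 1) {τ : M}
    (hτ : τ = (polyAction w a + ζ' * polyAction w b) * z * polyAction w u') :
    τ * τ = 1 ∧ τ * ζ = ζ' * τ ∧ (∀ x, τ * polyAction (F := F) w x = polyAction w x * τ) ∧
      z = (polyAction w a + ζ * polyAction w b) * τ := by
  have cζ : ∀ x, ζ * polyAction (F := F) w x = polyAction w x * ζ := commute_polyAction (hw ▸ H.ζ_mul_w)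
  have cζ' : ∀ x, ζ' * polyAction (F := F) w x = polyAction w x * ζ' :=
    commute_polyAction (hw ▸ H.ζ'_mul_w)
  have cz : ∀ x, z * polyAction (F := F) w x = polyAction w x * z :=
    commute_polyAction (by rw [hw, hz]; exact H.z_mul_w)
  have hzζ : z * ζ = ζ' * z := by rw [hz]; exact H.z_mul_ζ
  have hζz : ζ * z = z * ζ' := by rw [hz]; exact H.ζ_mul_z
  have hζζ' := H.mul₁
  have hζ'ζ := H.mul₁'
  have hadd := H.add₁
  set ι := polyAction (F := F) w with hι
  have hcomm : ∀ x y, ι x * ι y = ι y * ι x := fun x y => by rw [← map_mul, mul_comm, map_mul]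
  have huu : ι u * ι u' = 1 := by rw [← map_mul, huu', map_one]
  -- With y = a + ζb and y' = a + ζ'b one has yy' = y'y = u and `𝐳`y' = y`𝐳`. Hence τ = y'`𝐳`u⁻¹
  -- equals y⁻¹`𝐳`, and τ² = y'y `𝐳²` u⁻² = 1.
  have hyy' : (ι a + ζ * ι b) * (ι a + ζ' * ι b) = ι u := by
    rw [← hab]
    simp only [map_add, map_pow, map_smul, map_mul]
    calc _ = ι a * ι a + (ι a * ζ') * ι b + (ζ * (ι b * ι a)) + ζ * (ι b * ζ') * ι b := by
          noncomm_ring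
      _ = ι a * ι a + (ζ + ζ') * (ι a * ι b) + ζ * ζ' * (ι b * ι b) := by
          rw [← cζ', ← cζ', hcomm b a]; noncomm_ring
      _ = _ := by rw [hadd, hζζ']; simp [sq]
  have hy'y : (ι a + ζ' * ι b) * (ι a + ζ * ι b) = ι u := by
    rw [← hab]
    simp only [map_add, map_pow, map_smul, map_mul]
    calc _ = ι a * ι a + (ι a * ζ) * ι b + (ζ' * (ι b * ι a)) + ζ' * (ι b * ζ) * ι b := by
          noncomm_ring
      _ = ι a * ι a + (ζ + ζ') * (ι a * ι b) + ζ' * ζ * (ι b * ι b) := by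
          rw [← cζ, ← cζ, hcomm b a]; noncomm_ring
      _ = _ := by rw [hadd, hζ'ζ]; simp [sq]
  have hzy' : z * (ι a + ζ' * ι b) = (ι a + ζ * ι b) * z := by
    rw [mul_add, add_mul, cz, ← mul_assoc, ← hζz, mul_assoc, cz, mul_assoc]
  set y := ι a + ζ * ι b with hy
  set y' := ι a + ζ' * ι b with hy'
  have cy' : ∀ x, y' * ι x = ι x * y' := fun x => by
    rw [hy', add_mul, mul_add, hcomm, mul_assoc, hcomm b x, ← mul_assoc, cζ', mul_assoc]
  refine ⟨?_, ?_, fun x => ?_, ?_⟩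
  · calc τ * τ = y' * z * (ι u' * y') * z * ι u' := by rw [hτ]; noncomm_ring
      _ = y' * (z * y') * (ι u' * z) * ι u' := by rw [← cy']; noncomm_ring
      _ = (y' * y) * (z * z) * ι u' * ι u' := by rw [hzy', ← cz]; noncomm_ring
      _ = ι u * (ι u * ι u') * ι u' := by rw [hy'y, ← hu]; noncomm_ring
      _ = 1 := by rw [huu, mul_one, huu]
  · have h1 : y' * ζ' = ζ' * y' := by
      rw [hy', add_mul, mul_add, ← cζ', mul_assoc, ← cζ']
    calc τ * ζ = y' * z * (ι u' * ζ) := by rw [hτ]; noncomm_ring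
      _ = y' * (z * ζ) * ι u' := by rw [← cζ]; noncomm_ring
      _ = (y' * ζ') * z * ι u' := by rw [hzζ]; noncomm_ring
      _ = ζ' * τ := by rw [h1, hτ]; noncomm_ring
  · calc τ * ι x = y' * z * (ι u' * ι x) := by rw [hτ]; noncomm_ring
      _ = y' * (z * ι x) * ι u' := by rw [hcomm]; noncomm_ring
      _ = (y' * ι x) * z * ι u' := by rw [cz]; noncomm_ring
      _ = ι x * τ := by rw [cy', hτ]; noncomm_ring
  · calc z = z * (ι u * ι u') := by rw [huu, mul_one]
      _ = (z * ι u) * ι u' := by noncomm_ring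
      _ = (y * y') * z * ι u' := by rw [cz, hyy']
      _ = y * τ := by rw [hτ]; noncomm_ring

end Descent

/-! ### A cyclic vector fixed by the involution -/

section Frame
variable {F : Type*} [Field F] {h : ℕ}

/-- The `F[X] / (minpoly w)`-linear coordinates `(x, y) ↦ x(w) v + ζ y(w) v`. -/
noncomputable def frameMap (ζ w : Mat h F) (v : Fin (2 * h) → F) :
    (AdjoinRoot (minpoly F w) × AdjoinRoot (minpoly F w)) →ₗ[F] (Fin (2 * h) → F) where
  toFun x := polyAction w x.1 *ᵥ v + ζ *ᵥ (polyAction w x.2 *ᵥ v)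
  map_add' x y := by
    simp only [Prod.fst_add, Prod.snd_add, map_add, Matrix.add_mulVec, Matrix.mulVec_add]
    abel
  map_smul' c x := by
    simp only [Prod.smul_fst, Prod.smul_snd, map_smul, Matrix.smul_mulVec, Matrix.mulVec_smul,
      smul_add, RingHom.id_apply]

lemma frameMap_apply (ζ w : Mat h F) (v : Fin (2 * h) → F)
    (x : AdjoinRoot (minpoly F w) × AdjoinRoot (minpoly F w)) :
    frameMap ζ w v x = polyAction w x.1 *ᵥ v + ζ *ᵥ (polyAction w x.2 *ᵥ v) := rfl

/-- A commuting pair consisting of a matrix `w` with minimal polynomial of degree at least `h` and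
a descent datum `ζ`, `τ` has a `τ`-invariant cyclic vector. -/
lemma exists_frame {ζ ζ' w τ : Mat h F} {c : F} (hc : c ≠ 0)
    (hs : (ζ - ζ') * (ζ - ζ') = c • 1) (hζw : ζ * w = w * ζ)
    (hττ : τ * τ = 1) (hτζ : τ * ζ = ζ' * τ) (hτw : τ * w = w * τ)
    (hdeg : h ≤ (minpoly F w).natDegree) :
    ∃ v, τ *ᵥ v = v ∧ Function.Bijective (frameMap ζ w v) := by
  set V := Fin (2 * h) → F
  -- The fixed space of τ is stable under `w`, and the whole space will be V₁ + ζV₁.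
  let V₁ : Submodule F V := LinearMap.ker (Matrix.mulVecLin τ - LinearMap.id)
  have hV₁ : ∀ v, v ∈ V₁ ↔ τ *ᵥ v = v := fun v => by
    rw [LinearMap.mem_ker, LinearMap.sub_apply, sub_eq_zero]; rfl
  have hsinj : ∀ v : V, (ζ - ζ') *ᵥ v = 0 → v = 0 := fun v hv => by
    have : ((ζ - ζ') * (ζ - ζ')) *ᵥ v = 0 := by rw [← Matrix.mulVec_mulVec, hv, Matrix.mulVec_zero]
    rw [hs, Matrix.smul_mulVec, Matrix.one_mulVec] at this
    exact (smul_eq_zero.1 this).resolve_left hc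
  have hwV₁ : ∀ v ∈ V₁, Matrix.mulVecLin w v ∈ V₁ := fun v hv => by
    rw [hV₁] at hv ⊢
    rw [Matrix.mulVecLin_apply, Matrix.mulVec_mulVec, hτw, ← Matrix.mulVec_mulVec, hv]
  let w₁ : Module.End F V₁ := (Matrix.mulVecLin w).restrict hwV₁
  have hw₁ : ∀ (p : Polynomial F) (v : V₁), ((Polynomial.aeval w₁ p v : V₁) : V) =
      Polynomial.aeval w p *ᵥ (v : V) := by
    intro p v
    induction p using Polynomial.induction_on' with
    | add p q hp hq => simp [hp, hq, Matrix.add_mulVec]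
    | monomial k a =>
      simp only [Polynomial.aeval_monomial, ← Algebra.smul_def, Matrix.smul_mulVec,
        LinearMap.smul_apply, Submodule.coe_smul]
      congr 1
      induction k generalizing v with
      | zero => simp
      | succ k ih =>
        rw [pow_succ, Module.End.mul_apply, ih, pow_succ, ← Matrix.mulVec_mulVec]
        rfl
  -- Over the principal ideal domain F[X], some vector of V₁ has the same annihilator as all of V₁.
  -- It is the candidate for a cyclic vector.
  obtain ⟨x, hx⟩ := Module.exists_ker_toSpanSingleton_eq_annihilator
    (R := Polynomial F) (M := Module.AEval' w₁)
  obtain ⟨v₀, rfl⟩ := (Module.AEval.of F V₁ w₁).surjective x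
  have hv₀ : τ *ᵥ (v₀ : V) = v₀ := (hV₁ _).1 v₀.2
  have hcyc : ∀ p : Polynomial F, Polynomial.aeval w p *ᵥ (v₀ : V) = 0 →
      Polynomial.aeval w p = 0 := by
    intro p hp
    have h1 : p ∈ LinearMap.ker (LinearMap.toSpanSingleton (Polynomial F) _
        (Module.AEval.of F V₁ w₁ v₀)) := by
      rw [LinearMap.mem_ker, LinearMap.toSpanSingleton_apply, ← Module.AEval.of_aeval_smul]
      have : Polynomial.aeval w₁ p v₀ = 0 := Subtype.ext ((hw₁ p v₀).trans hp)
      rw [Module.End.smul_def, this, map_zero]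
    rw [hx, Module.mem_annihilator] at h1
    have h2 : ∀ v ∈ V₁, Polynomial.aeval w p *ᵥ v = 0 := by
      intro v hv
      have h3 := h1 (Module.AEval.of F V₁ w₁ ⟨v, hv⟩)
      rw [← Module.AEval.of_aeval_smul, LinearEquiv.map_eq_zero_iff] at h3
      rw [← hw₁ p ⟨v, hv⟩]
      exact congrArg Subtype.val h3
    have hpζ : ζ * Polynomial.aeval w p = Polynomial.aeval w p * ζ := by
      have := commute_polyAction hζw (AdjoinRoot.mk _ p)
      rwa [polyAction_mk] at this
    have h3 : ∀ v : V, Polynomial.aeval w p *ᵥ v = 0 := by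
      intro v
      set s := ζ - ζ' with hsdef
      have hτs : τ * s = -(s * τ) := by
        have hτζ' : τ * ζ' = ζ * τ := by
          calc τ * ζ' = τ * (ζ' * (τ * τ)) := by rw [hττ, mul_one]
            _ = τ * (τ * ζ) * τ := by rw [hτζ]; noncomm_ring
            _ = ζ * τ := by rw [← mul_assoc, hττ, one_mul]
        rw [hsdef, mul_sub, hτζ, hτζ']; noncomm_ring
      -- If v = v₁ + ζv₂ with both vectors fixed, then v - τv = (ζ - ζ')v₂, and (ζ - ζ')² = c
      -- determines v₂. This decomposition extends annihilation from V₁ to the whole space because ζ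
      -- commutes with `w`.
      set v₂ := c⁻¹ • (s *ᵥ (v - τ *ᵥ v)) with hv₂
      have hv₂mem : v₂ ∈ V₁ := by
        rw [hV₁, hv₂, Matrix.mulVec_smul, Matrix.mulVec_mulVec, hτs, Matrix.neg_mulVec,
          ← Matrix.mulVec_mulVec, Matrix.mulVec_sub, Matrix.mulVec_mulVec, hττ, Matrix.one_mulVec,
          ← Matrix.mulVec_neg, neg_sub]
      have hsv₂ : s *ᵥ v₂ = v - τ *ᵥ v := by
        rw [hv₂, Matrix.mulVec_smul, Matrix.mulVec_mulVec, hs, Matrix.smul_mulVec,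
          Matrix.one_mulVec, smul_smul, inv_mul_cancel₀ hc, one_smul]
      have hv₁mem : v - ζ *ᵥ v₂ ∈ V₁ := by
        rw [hV₁, Matrix.mulVec_sub, Matrix.mulVec_mulVec, hτζ, ← Matrix.mulVec_mulVec,
          (hV₁ _).1 hv₂mem]
        rw [hsdef, Matrix.sub_mulVec] at hsv₂
        rw [sub_eq_sub_iff_add_eq_add] at hsv₂ ⊢
        rw [add_comm, ← hsv₂, add_comm]
      have : v = (v - ζ *ᵥ v₂) + ζ *ᵥ v₂ := by abel
      rw [this, Matrix.mulVec_add, h2 _ hv₁mem, Matrix.mulVec_mulVec, ← hpζ,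
        ← Matrix.mulVec_mulVec, h2 _ hv₂mem, Matrix.mulVec_zero, add_zero]
    exact Matrix.ext_of_mulVec_single fun i => by rw [h3, Matrix.zero_mulVec]
  refine ⟨v₀, hv₀, ?_⟩
  have hcyc' : ∀ x : AdjoinRoot (minpoly F w), polyAction w x *ᵥ (v₀ : V) = 0 → x = 0 := by
    intro x hx
    obtain ⟨p, rfl⟩ := AdjoinRoot.mk_surjective x
    apply polyAction_injective
    rw [map_zero, polyAction_mk]
    exact hcyc p hx
  have hinj : Function.Injective (frameMap ζ w v₀) := by
    rw [injective_iff_map_eq_zero]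
    rintro ⟨x, y⟩ hxy
    rw [frameMap_apply] at hxy
    simp only at hxy
    have hfix : ∀ x, τ *ᵥ (polyAction (F := F) w x *ᵥ (v₀ : V)) = polyAction w x *ᵥ (v₀ : V) := fun x => by
      rw [Matrix.mulVec_mulVec, commute_polyAction hτw, ← Matrix.mulVec_mulVec, hv₀]
    have h1 := congrArg (τ *ᵥ ·) hxy
    simp only [Matrix.mulVec_add, Matrix.mulVec_zero] at h1
    rw [hfix, Matrix.mulVec_mulVec, hτζ, ← Matrix.mulVec_mulVec, hfix] at h1
    have h2 : y = 0 := hcyc' y (hsinj _ (by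
      rw [Matrix.sub_mulVec]
      have := congrArg₂ (· - ·) hxy h1
      simpa using this))
    subst h2
    refine Prod.ext (hcyc' x ?_) rfl
    simpa using hxy
  have hint : IsIntegral F w := Algebra.IsIntegral.isIntegral w
  have hL : Module.finrank F (AdjoinRoot (minpoly F w)) = (minpoly F w).natDegree :=
    (AdjoinRoot.powerBasis (minpoly.ne_zero hint)).finrank.trans (AdjoinRoot.powerBasis_dim _)
  have : Module.Finite F (AdjoinRoot (minpoly F w)) :=
    (AdjoinRoot.powerBasis (minpoly.ne_zero hint)).finite
  -- Injectivity gives 2 deg ≤ 2h, and the hypothesis on the degree forces equality, hence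
  -- bijectivity.
  have hle := LinearMap.finrank_le_finrank_of_injective hinj
  have hV : Module.finrank F V = 2 * h := by simp [V]
  have hfr : Module.finrank F (AdjoinRoot (minpoly F w) × AdjoinRoot (minpoly F w)) =
      Module.finrank F V := by
    rw [Module.finrank_prod, hL, hV] at hle ⊢
    omega
  exact ⟨hinj, (LinearMap.injective_iff_surjective_of_finrank_eq_finrank hfr).1 hinj⟩

end Frame

/-! ### Consequences of regular semisimplicity -/

section Regular

/-- A matrix over a field whose characteristic polynomial is separable has its characteristic
polynomial dividing every polynomial that annihilates it. -/
lemma charpoly_dvd_of_separable {k : Type*} [Field k] {m : Type*} [Fintype m] [DecidableEq m]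
    (W : Matrix m m k) (hW : W.charpoly.Separable) {p : Polynomial k} (hp0 : p ≠ 0)
    (hp : Polynomial.aeval W p = 0) : W.charpoly ∣ p := by
  let K := AlgebraicClosure k
  let WK : Matrix m m K := W.map (algebraMap k K)
  have hcp : WK.charpoly = W.charpoly.map (algebraMap k K) := W.charpoly_map (algebraMap k K)
  have haev : Polynomial.aeval WK (p.map (algebraMap k K)) = 0 := by
    have h1 : Polynomial.aeval WK p = 0 := by
      have := Polynomial.aeval_algHom_apply ((Algebra.ofId k K).mapMatrix (m := m)) W p
      rw [hp, map_zero] at this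
      exact this
    rw [Polynomial.aeval_map_algebraMap, h1]
  rw [← Polynomial.map_dvd_map' (algebraMap k K), ← hcp]
  -- Over an algebraic closure the characteristic polynomial has simple roots. Each is an eigenvalue
  -- and therefore a root of `p`, which gives divisibility.
  have hsp : WK.charpoly.Splits := IsAlgClosed.splits _
  refine hsp.dvd_of_roots_le_roots (WK.charpoly_monic.ne_zero) ?_
  have hnd : WK.charpoly.roots.Nodup := Polynomial.nodup_roots (hcp ▸ hW.map)
  refine (Multiset.le_iff_subset hnd).2 fun r hr => ?_
  have hr' := Polynomial.isRoot_of_mem_roots hr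
  rw [Polynomial.mem_roots ((Polynomial.map_ne_zero_iff (algebraMap k K).injective).2 hp0)]
  rw [← Matrix.charpoly_toLin', ← Module.End.hasEigenvalue_iff_isRoot_charpoly,
    Module.End.hasEigenvalue_iff_isRoot] at hr'
  refine hr'.dvd (minpoly.dvd _ _ ?_)
  have := Polynomial.aeval_algHom_apply (Matrix.toLinAlgEquiv' (R := K) (n := m)).toAlgHom WK
    (p.map (algebraMap k K))
  rw [haev, map_zero] at this
  exact this

variable {F A B : Type*} [Field F] [CommRing A] [Algebra F A] [CommRing B] [Algebra F B] {h : ℕ}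

/-- The minimal polynomial of `𝐰` for a regular semisimple pair. -/
lemma EmbeddingPair.IsRegularSemisimple.minpoly_w [Nontrivial A] {p : EmbeddingPair F A B h}
    {ζ ζ' : A} {ϖ ϖ' : B} (hp : p.IsRegularSemisimple ζ ζ' ϖ ϖ') :
    h ≤ (minpoly F (p.w ζ ζ' ϖ ϖ')).natDegree ∧
      ((minpoly F (p.w ζ ζ' ϖ ϖ')).natDegree ≤ h → (minpoly F (p.w ζ ζ' ϖ ϖ')).Separable) := by
  obtain ⟨⟨φ, W, -, hW, hsep⟩, -⟩ := hp
  set w := p.w ζ ζ' ϖ ϖ'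
  have hint : IsIntegral F w := Algebra.IsIntegral.isIntegral w
  -- `A` need not be a field. Reduction modulo a maximal ideal keeps the degree h and the
  -- separability of the characteristic polynomial.
  obtain ⟨𝔪, h𝔪⟩ := Ideal.exists_maximal A
  let := Ideal.Quotient.field 𝔪
  have hWp : ∀ (q : Polynomial F) (v : Fin h → A),
      φ (Polynomial.aeval W q *ᵥ v) = Polynomial.aeval w q *ᵥ φ v := by
    intro q v
    induction q using Polynomial.induction_on' with
    | add p q hp hq => simp [hp, hq, Matrix.add_mulVec]
    | monomial k a =>
      simp only [Polynomial.aeval_monomial, ← Algebra.smul_def, Matrix.smul_mulVec, map_smul]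
      congr 1
      induction k generalizing v with
      | zero => simp
      | succ k ih =>
        rw [pow_succ, ← Matrix.mulVec_mulVec, ih, pow_succ, ← Matrix.mulVec_mulVec, hW]
  have hWμ : Polynomial.aeval W (minpoly F w) = 0 := by
    refine Matrix.ext_of_mulVec_single fun i => φ.injective ?_
    rw [hWp, minpoly.aeval, Matrix.zero_mulVec, Matrix.zero_mulVec, map_zero]
  let W' : Matrix (Fin h) (Fin h) (A ⧸ 𝔪) := W.map (Ideal.Quotient.mk 𝔪)
  have hcp : W'.charpoly = W.charpoly.map (Ideal.Quotient.mk 𝔪) :=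
    W.charpoly_map (Ideal.Quotient.mk 𝔪)
  have hW' : Polynomial.aeval W' (minpoly F w) = 0 := by
    have := Polynomial.aeval_algHom_apply ((Ideal.Quotient.mkₐ F 𝔪).mapMatrix (m := Fin h)) W
      (minpoly F w)
    rw [hWμ, map_zero] at this
    exact this
  have hdvd : W'.charpoly ∣ (minpoly F w).map (algebraMap F (A ⧸ 𝔪)) := by
    refine charpoly_dvd_of_separable W' (hcp ▸ hsep.map) ?_ ?_
    · exact (Polynomial.map_ne_zero_iff (algebraMap F (A ⧸ 𝔪)).injective).2 (minpoly.ne_zero hint)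
    · rw [Polynomial.aeval_map_algebraMap, hW']
  have hdeg : W'.charpoly.natDegree = h := by simp
  have hmonic := (minpoly.monic hint).map (algebraMap F (A ⧸ 𝔪))
  refine ⟨?_, fun hle => ?_⟩
  · exact hdeg.symm.le.trans ((Polynomial.natDegree_le_of_dvd hdvd hmonic.ne_zero).trans_eq
      (Polynomial.natDegree_map _))
  · have := Polynomial.eq_of_monic_of_dvd_of_natDegree_le W'.charpoly_monic hmonic hdvd
      (by rw [hdeg, Polynomial.natDegree_map]; exact hle)
    rw [← Polynomial.separable_map (algebraMap F (A ⧸ 𝔪)), this, hcp]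
    exact hsep.map

lemma formallyUnramified_adjoinRoot {f : Polynomial F} (hf : f.Separable) :
    Algebra.FormallyUnramified F (AdjoinRoot f) := by
  refine formallyUnramified_of_generator (AdjoinRoot.root f) AdjoinRoot.adjoinRoot_eq_top f
    (by simp) ?_
  obtain ⟨a, b, hab⟩ := hf
  have := congrArg (Polynomial.aeval (AdjoinRoot.root f)) hab
  simp only [map_add, map_mul, AdjoinRoot.aeval_eq, AdjoinRoot.mk_self, mul_zero, zero_add,
    map_one] at this ⊢
  exact IsUnit.of_mul_eq_one _ (by rw [mul_comm]; exact this)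

end Regular

/-! ### Lattices stable under both embeddings -/

section LatticeFrame
variable {F : Type*} [Field F] [ValuativeRel F] {h : ℕ}

/-- The matrices that map an `𝒪[F]`-submodule of `F^{2h}` to itself. -/
def stabilizerAlgebra (Λ : Submodule 𝒪[F] (Fin (2 * h) → F)) : Subalgebra 𝒪[F] (Mat h F) where
  carrier := {m | ∀ v ∈ Λ, m *ᵥ v ∈ Λ}
  mul_mem' {a b} ha hb v hv := by
    rw [← Matrix.mulVec_mulVec]
    exact ha _ (hb v hv)
  add_mem' {a b} ha hb v hv := by
    rw [Matrix.add_mulVec]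
    exact Λ.add_mem (ha v hv) (hb v hv)
  algebraMap_mem' r v hv := by
    rw [Algebra.algebraMap_eq_smul_one, Matrix.smul_mulVec, Matrix.one_mulVec]
    exact Λ.smul_mem r hv

lemma smul_one_mem_stabilizerAlgebra (Λ : Submodule 𝒪[F] (Fin (2 * h) → F)) (c : 𝒪[F]) :
    (c : F) • (1 : Mat h F) ∈ stabilizerAlgebra Λ := by
  have := (stabilizerAlgebra Λ).algebraMap_mem c
  rwa [Algebra.algebraMap_eq_smul_one] at this

lemma polyAction_mem_stabilizerAlgebra {Λ : Submodule 𝒪[F] (Fin (2 * h) → F)} {w : Mat h F}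
    (hw : w ∈ stabilizerAlgebra Λ) {x : AdjoinRoot (minpoly F w)}
    (hx : x ∈ Algebra.adjoin 𝒪[F] {AdjoinRoot.root (minpoly F w)}) :
    polyAction w x ∈ stabilizerAlgebra Λ := by
  let g : AdjoinRoot (minpoly F w) →ₐ[𝒪[F]] Mat h F := (polyAction w).restrictScalars 𝒪[F]
  have h1 : Algebra.adjoin 𝒪[F] {AdjoinRoot.root (minpoly F w)} ≤ (stabilizerAlgebra Λ).comap g :=
    Algebra.adjoin_le (Set.singleton_subset_iff.2 (by
      change polyAction (F := F) w _ ∈ stabilizerAlgebra Λ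
      rwa [polyAction_root]))
  exact h1 hx

/-- Coordinates on `F^{2h}` in which the lattices stable under `ζ` and `ϖ` are the sums `M ⊕ ζ M`
for the `𝒪[F][𝐰]`-lattices `M` in `F[𝐰]`. -/
structure IsLatticeFrame (ζ ϖ z' w : Mat h F) (v₀ : Fin (2 * h) → F) : Prop where
  bijective : Function.Bijective (frameMap ζ w v₀)
  stable_iff : ∀ Λ : Submodule 𝒪[F] (Fin (2 * h) → F),
    (ζ ∈ stabilizerAlgebra Λ ∧ ϖ ∈ stabilizerAlgebra Λ) ↔
      ∃ M : Submodule 𝒪[F] (AdjoinRoot (minpoly F w)),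
        (∀ x ∈ M, AdjoinRoot.root (minpoly F w) * x ∈ M) ∧
          ∀ x y, frameMap ζ w v₀ (x, y) ∈ Λ ↔ x ∈ M ∧ y ∈ M
  inv_mem : ∀ Λ : Submodule 𝒪[F] (Fin (2 * h) → F), ζ ∈ stabilizerAlgebra Λ →
    ϖ ∈ stabilizerAlgebra Λ → z' ∈ stabilizerAlgebra Λ
  commutant : ∀ l : Mat h F, l * ζ = ζ * l → l * ϖ = ϖ * l → ∃ x, l = polyAction (F := F) w x
  comm_ζ : ∀ x, ζ * polyAction (F := F) w x = polyAction w x * ζ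
  comm_ϖ : ∀ x, ϖ * polyAction (F := F) w x = polyAction w x * ϖ

variable [TopologicalSpace F] [IsNonarchimedeanLocalField F]

/-- Unramified descent at the level of lattices. A lattice stable under ζ and ϖ is stable under `𝐰`
and `𝐳`, hence under τ, whose coefficients lie in the order of `𝐰`; since (ζ - ζ')² is a unit, the
lattice splits as M ⊕ ζM with M its fixed part. Conversely M ⊕ ζM is stable under ζ, τ and `𝐰`,
hence under `𝐳 = yτ` and finally under ϖ. -/
theorem exists_isLatticeFrame {ζ ζ' ϖ ϖ' : Mat h F} {T N t n : 𝒪[F]}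
    (H : IsQuadraticPair ζ ζ' ϖ ϖ' (T : F) N t n) (hδ : IsUnit (T ^ 2 - 4 * N)) {w z z' : Mat h F}
    (hw : w = ζ * ϖ + ϖ' * ζ') (hz : z = ϖ * ζ - ζ * ϖ) (hzz' : z * z' = 1)
    (hzint : IsIntegral 𝒪[F] z) (hzint' : IsIntegral 𝒪[F] z')
    (hdeg : h ≤ (minpoly F w).natDegree) : ∃ v₀, IsLatticeFrame ζ ϖ z' w v₀ := by
  have hz'z : z' * z = 1 := mul_eq_one_comm.1 hzz'
  set L := AdjoinRoot (minpoly F w)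
  set ι : L →ₐ[F] Mat h F := polyAction w with hι
  set θ : L := AdjoinRoot.root (minpoly F w) with hθ
  have hιθ : ι θ = w := polyAction_root w
  have hιinj : Function.Injective ι := polyAction_injective w
  have hιint : ∀ x : L, IsIntegral 𝒪[F] (ι x) → IsIntegral 𝒪[F] x := fun x hx =>
    (isIntegral_algHom_iff (ι.restrictScalars 𝒪[F]) hιinj).1 hx
  have hwint : IsIntegral F w := Algebra.IsIntegral.isIntegral w
  have cζw : ζ * w = w * ζ := by rw [hw]; exact H.ζ_mul_w
  have cϖw : ϖ * w = w * ϖ := by rw [hw]; exact H.ϖ_mul_w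
  set c : 𝒪[F] := t ^ 2 * N + T ^ 2 * n - 4 * N * n with hc
  set u : L := θ * θ - algebraMap 𝒪[F] L (t * T) * θ + algebraMap 𝒪[F] L c with hu
  have hιu : ι u = z * z := by
    rw [hz, H.z_sq, ← hw, hu, map_add, map_sub, map_mul, map_mul, hιθ]
    have h1 : ∀ r : 𝒪[F], ι (algebraMap 𝒪[F] L r) = (r : F) • (1 : Mat h F) := fun r => by
      rw [IsScalarTower.algebraMap_apply 𝒪[F] F L, AlgHom.commutes,
        Algebra.algebraMap_eq_smul_one]
      rfl
    rw [h1, h1, smul_mul_assoc, one_mul, hc]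
    push_cast
    rfl
  have huint : IsIntegral 𝒪[F] u := hιint u (hιu ▸ by
    have := hzint.pow 2
    rwa [sq] at this)
  -- Integrality of `𝐰` is not assumed. It follows from that of u = `𝐳²`, because θ is a root of the
  -- monic polynomial X² - tT X + (c - u) over the integral closure.
  have hθint : IsIntegral 𝒪[F] θ := by
    let C := integralClosure 𝒪[F] L
    refine isIntegral_trans (A := C) θ ⟨Polynomial.X ^ 2 - Polynomial.C (algebraMap 𝒪[F] C (t * T)) *
      Polynomial.X + Polynomial.C (algebraMap 𝒪[F] C c - ⟨u, huint⟩), by monicity!, ?_⟩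
    simp only [Polynomial.eval₂_add, Polynomial.eval₂_sub, Polynomial.eval₂_mul,
      Polynomial.eval₂_pow, Polynomial.eval₂_X, Polynomial.eval₂_C]
    have h1 : algebraMap C L (algebraMap 𝒪[F] C c - ⟨u, huint⟩) = algebraMap 𝒪[F] L c - u := rfl
    have h2 : algebraMap C L (algebraMap 𝒪[F] C (t * T)) = algebraMap 𝒪[F] L (t * T) := rfl
    rw [h1, h2, hu]
    ring
  obtain ⟨u', huu'⟩ : ∃ u', u * u' = 1 := by
    have : Module.Finite F L := (AdjoinRoot.powerBasis (minpoly.ne_zero hwint)).finite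
    have hinj : Function.Injective (LinearMap.mulLeft F u) := by
      rw [injective_iff_map_eq_zero]
      intro x hx
      apply hιinj
      have h1 : z * z * ι x = 0 := by
        rw [← hιu, ← map_mul]
        exact (congrArg ι hx).trans (map_zero ι)
      calc ι x = (z' * (z' * z) * z) * ι x := by rw [hz'z, mul_one, hz'z, one_mul]
        _ = z' * z' * (z * z * ι x) := by noncomm_ring
        _ = ι 0 := by rw [h1, mul_zero, map_zero]
    obtain ⟨u', hu'⟩ := LinearMap.injective_iff_surjective.1 hinj 1
    exact ⟨u', hu'⟩
  have hιu' : ι u' = z' * z' := by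
    have h1 : z * z * ι u' = 1 := by rw [← hιu, ← map_mul, huu', map_one]
    calc ι u' = (z' * (z' * z) * z) * ι u' := by rw [hz'z, mul_one, hz'z, one_mul]
      _ = z' * z' * (z * z * ι u') := by noncomm_ring
      _ = z' * z' := by rw [h1, mul_one]
  have hu'int : IsIntegral 𝒪[F] u' := hιint u' (hιu' ▸ by
    have := hzint'.pow 2
    rwa [sq] at this)
  have huE : u ∈ Algebra.adjoin 𝒪[F] {θ} :=
    add_mem (sub_mem (mul_mem (Algebra.self_mem_adjoin_singleton _ _)
      (Algebra.self_mem_adjoin_singleton _ _)) (mul_mem (Subalgebra.algebraMap_mem _ _)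
      (Algebra.self_mem_adjoin_singleton _ _))) (Subalgebra.algebraMap_mem _ _)
  obtain ⟨hu'E, a, ha, b, hb, hab⟩ := exists_quadForm_eq_of_adjoin hθint hδ huE huu' hu'int
  have hab' : a ^ 2 + (T : F) • (a * b) + (N : F) • b ^ 2 = u := by
    rw [← hab, Algebra.smul_def, Algebra.smul_def, mul_assoc]
    rfl
  obtain ⟨hττ, hτζ, hτι, hzτ⟩ := H.exists_involution hw hz hab' hιu huu' rfl
  set τ := (ι a + ζ' * ι b) * z * ι u' with hτ
  have hsδ := H.sub_sq
  obtain ⟨ε, hε⟩ := hδ.exists_right_inv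
  have hε' : ((T : F) ^ 2 - 4 * (N : F)) * (ε : F) = 1 := by
    have := congrArg (algebraMap 𝒪[F] F) hε
    simp only [map_mul, map_sub, map_pow, map_one, map_ofNat] at this
    exact this
  have hδ0 : (T : F) ^ 2 - 4 * (N : F) ≠ 0 := left_ne_zero_of_mul_eq_one hε'
  obtain ⟨v₀, hv₀, hbij⟩ := exists_frame hδ0 hsδ cζw hττ hτζ
    (by rw [← hιθ]; exact hτι θ) hdeg
  have hfm : ∀ x y, frameMap ζ w v₀ (x, y) = ι x *ᵥ v₀ + ζ *ᵥ (ι y *ᵥ v₀) := fun _ _ => rfl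
  have hfm0 : ∀ x, frameMap ζ w v₀ (x, 0) = ι x *ᵥ v₀ := fun x => by
    rw [hfm, map_zero, Matrix.zero_mulVec, Matrix.mulVec_zero, add_zero]
  have hfix : ∀ x, τ *ᵥ (ι x *ᵥ v₀) = ι x *ᵥ v₀ := fun x => by
    rw [Matrix.mulVec_mulVec, hτι, ← Matrix.mulVec_mulVec, hv₀]
  have hsinv : ((ε : F) • (1 : Mat h F)) * (ζ - ζ') * (ζ - ζ') = 1 := by
    rw [mul_assoc, hsδ, smul_mul_assoc, one_mul, smul_smul, mul_comm (ε : F), hε', one_smul]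
  -- The relation `sub_mul_ϖ` solved for ϖ; ε is the inverse of the discriminant, so ε(ζ - ζ') is
  -- the inverse of ζ - ζ'.
  have hϖeq : ϖ = ((ε : F) • (1 : Mat h F)) * (ζ - ζ') * (w - z - (t : F) • (1 : Mat h F) * ζ') := by
    have h1 := H.sub_mul_ϖ
    rw [← hw, ← hz] at h1
    calc ϖ = ((ε : F) • (1 : Mat h F)) * (ζ - ζ') * (ζ - ζ') * ϖ := by rw [hsinv, one_mul]
      _ = ((ε : F) • (1 : Mat h F)) * (ζ - ζ') * ((ζ - ζ') * ϖ) := by rw [mul_assoc]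
      _ = _ := by rw [h1, smul_mul_assoc _ 1 ζ', one_mul]
  -- This makes `𝐳⁻¹` preserve every stable lattice, since u⁻¹ belongs to the order of `𝐰`.
  have hz'eq : z' = z * ι u' := by
    rw [hιu', ← mul_assoc, hzz', one_mul]
  have hζ'mem : ∀ Λ : Submodule 𝒪[F] (Fin (2 * h) → F), ζ ∈ stabilizerAlgebra Λ →
      ζ' ∈ stabilizerAlgebra Λ := fun Λ hΛ => by
    rw [H.eq₁]
    exact sub_mem (smul_one_mem_stabilizerAlgebra Λ T) hΛ
  have hmem : ∀ Λ : Submodule 𝒪[F] (Fin (2 * h) → F), ζ ∈ stabilizerAlgebra Λ →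
      ϖ ∈ stabilizerAlgebra Λ → w ∈ stabilizerAlgebra Λ ∧ z ∈ stabilizerAlgebra Λ := by
    intro Λ h1 h2
    have h1' := hζ'mem Λ h1
    have h2' : ϖ' ∈ stabilizerAlgebra Λ := by
      rw [H.eq₂]
      exact sub_mem (smul_one_mem_stabilizerAlgebra Λ t) h2
    rw [hw, hz]
    exact ⟨add_mem (mul_mem h1 h2) (mul_mem h2' h1'), sub_mem (mul_mem h2 h1) (mul_mem h1 h2)⟩
  refine ⟨v₀, hbij, fun Λ => ⟨?_, ?_⟩, ?_, ?_, commute_polyAction cζw,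
    commute_polyAction cϖw⟩
  · rintro ⟨h1, h2⟩
    obtain ⟨hwΛ, hzΛ⟩ := hmem Λ h1 h2
    have h1' := hζ'mem Λ h1
    have hιΛ : ∀ x ∈ Algebra.adjoin 𝒪[F] {θ}, ι x ∈ stabilizerAlgebra Λ := fun x hx =>
      polyAction_mem_stabilizerAlgebra hwΛ hx
    have hτΛ : τ ∈ stabilizerAlgebra Λ :=
      mul_mem (mul_mem (add_mem (hιΛ a ha) (mul_mem h1' (hιΛ b hb))) hzΛ) (hιΛ u' hu'E)
    let Θ : L →ₗ[𝒪[F]] (Fin (2 * h) → F) :=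
      ((frameMap ζ w v₀).comp (LinearMap.inl F L L)).restrictScalars 𝒪[F]
    have hΘ : ∀ x, Θ x = ι x *ᵥ v₀ := hfm0
    refine ⟨Λ.comap Θ, fun x hx => ?_, fun x y => ⟨fun hxy => ?_, ?_⟩⟩
    · rw [Submodule.mem_comap, hΘ] at hx ⊢
      rw [map_mul, ← Matrix.mulVec_mulVec, hιθ]
      exact hwΛ _ hx
    · rw [Submodule.mem_comap, Submodule.mem_comap, hΘ, hΘ]
      rw [hfm] at hxy
      -- For v = x + ζy in Λ, the difference v - τv is (ζ - ζ')y, and ε(ζ - ζ') preserves Λ; so y,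
      -- and then x, lies in Λ.
      have h3 := Λ.sub_mem hxy (hτΛ _ hxy)
      rw [Matrix.mulVec_add, hfix, Matrix.mulVec_mulVec _ τ ζ, hτζ, ← Matrix.mulVec_mulVec, hfix,
        add_sub_add_left_eq_sub, ← Matrix.sub_mulVec] at h3
      have h4 : ι y *ᵥ v₀ ∈ Λ := by
        have h5 := mul_mem (smul_one_mem_stabilizerAlgebra Λ ε) (sub_mem h1 h1') _ h3
        rwa [Matrix.mulVec_mulVec, hsinv, Matrix.one_mulVec] at h5
      refine ⟨?_, h4⟩
      have := Λ.sub_mem hxy (h1 _ h4)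
      rwa [add_sub_cancel_right] at this
    · rintro ⟨hx, hy⟩
      rw [Submodule.mem_comap, hΘ] at hx hy
      exact Λ.add_mem hx (h1 _ hy)
  · rintro ⟨M, hM, hMΛ⟩
    have hstab : ∀ m : Mat h F, (∀ x ∈ M, ∀ y ∈ M, m *ᵥ frameMap ζ w v₀ (x, y) ∈ Λ) →
        m ∈ stabilizerAlgebra Λ := by
      intro m hm v hv
      obtain ⟨⟨x, y⟩, rfl⟩ := hbij.2 v
      obtain ⟨hx, hy⟩ := (hMΛ x y).1 hv
      exact hm x hx y hy
    have hζΛ : ζ ∈ stabilizerAlgebra Λ := by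
      refine hstab _ fun x hx y hy => ?_
      have : ζ *ᵥ frameMap ζ w v₀ (x, y) = frameMap ζ w v₀ (-(N • y), x + T • y) := by
        have e1 : ι (N • y) = (N : F) • ι y := map_smul ι (N : F) y
        have e2 : ι (T • y) = (T : F) • ι y := map_smul ι (T : F) y
        rw [hfm, hfm]
        rw [map_neg, map_add, e1, e2, Matrix.mulVec_add, Matrix.mulVec_mulVec _ ζ ζ, H.sq₁]
        simp only [Matrix.sub_mulVec, Matrix.add_mulVec, Matrix.neg_mulVec, Matrix.smul_mulVec,
          Matrix.mulVec_add, Matrix.mulVec_smul, Matrix.one_mulVec]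
        abel
      rw [this, hMΛ]
      exact ⟨M.neg_mem (M.smul_mem _ hy), M.add_mem hx (M.smul_mem _ hy)⟩
    have hζ'Λ := hζ'mem Λ hζΛ
    have hτΛ : τ ∈ stabilizerAlgebra Λ := by
      refine hstab _ fun x hx y hy => ?_
      have hx' : ι x *ᵥ v₀ ∈ Λ := by
        have := (hMΛ x 0).2 ⟨hx, M.zero_mem⟩
        rwa [hfm0] at this
      have hy' : ι y *ᵥ v₀ ∈ Λ := by
        have := (hMΛ y 0).2 ⟨hy, M.zero_mem⟩
        rwa [hfm0] at this
      rw [hfm]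
      rw [Matrix.mulVec_add, hfix, Matrix.mulVec_mulVec _ τ ζ, hτζ, ← Matrix.mulVec_mulVec, hfix]
      exact Λ.add_mem hx' (hζ'Λ _ hy')
    have hwΛ : w ∈ stabilizerAlgebra Λ := by
      refine hstab _ fun x hx y hy => ?_
      have : w *ᵥ frameMap ζ w v₀ (x, y) = frameMap ζ w v₀ (θ * x, θ * y) := by
        rw [hfm, hfm]
        rw [map_mul, map_mul, hιθ, Matrix.mulVec_add, Matrix.mulVec_mulVec _ w ζ, ← cζw,
          ← Matrix.mulVec_mulVec, ← Matrix.mulVec_mulVec, ← Matrix.mulVec_mulVec]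
      rw [this, hMΛ]
      exact ⟨hM x hx, hM y hy⟩
    have hιΛ : ∀ x ∈ Algebra.adjoin 𝒪[F] {θ}, ι x ∈ stabilizerAlgebra Λ := fun x hx =>
      polyAction_mem_stabilizerAlgebra hwΛ hx
    have hzΛ : z ∈ stabilizerAlgebra Λ := by
      rw [hzτ]
      exact mul_mem (add_mem (hιΛ a ha) (mul_mem hζΛ (hιΛ b hb))) hτΛ
    refine ⟨hζΛ, ?_⟩
    rw [hϖeq]
    exact mul_mem (mul_mem (smul_one_mem_stabilizerAlgebra Λ ε) (sub_mem hζΛ hζ'Λ))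
      (sub_mem (sub_mem hwΛ hzΛ) (mul_mem (smul_one_mem_stabilizerAlgebra Λ t) hζ'Λ))
  · intro Λ h1 h2
    obtain ⟨hwΛ, hzΛ⟩ := hmem Λ h1 h2
    rw [hz'eq]
    exact mul_mem hzΛ (polyAction_mem_stabilizerAlgebra hwΛ hu'E)
  · intro l hlζ hlϖ
    have hlζ' : l * ζ' = ζ' * l := by
      rw [H.eq₁, mul_sub, sub_mul, hlζ]; simp
    have hlϖ' : l * ϖ' = ϖ' * l := by
      rw [H.eq₂, mul_sub, sub_mul, hlϖ]; simp
    have hlz : l * z = z * l := by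
      calc l * z = (l * ϖ) * ζ - (l * ζ) * ϖ := by rw [hz]; noncomm_ring
        _ = ϖ * (l * ζ) - ζ * (l * ϖ) := by rw [hlϖ, hlζ, mul_assoc, mul_assoc, hlζ, hlϖ]
        _ = z * l := by rw [hz, hlζ, hlϖ]; noncomm_ring
    have hlw : l * w = w * l := by
      calc l * w = (l * ζ) * ϖ + (l * ϖ') * ζ' := by rw [hw]; noncomm_ring
        _ = ζ * (l * ϖ) + ϖ' * (l * ζ') := by rw [hlζ, hlϖ', mul_assoc, mul_assoc]
        _ = w * l := by rw [hw, hlϖ, hlζ']; noncomm_ring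
    have hlι : ∀ x, l * ι x = ι x * l := commute_polyAction hlw
    -- An element of the commutant commutes with τ, so it sends the fixed vector v₀ to a fixed
    -- vector x(`𝐰`)v₀. As v₀ generates everything under `𝐰` and ζ, the element is x(`𝐰`).
    have hlτ : l * τ = τ * l := by
      rw [hτ]
      have e1 : l * (ι a + ζ' * ι b) = (ι a + ζ' * ι b) * l := by
        rw [mul_add, add_mul, hlι, ← mul_assoc, hlζ', mul_assoc, hlι, mul_assoc]
      rw [← mul_assoc, ← mul_assoc, e1, mul_assoc _ l z, hlz, mul_assoc, mul_assoc _ l, hlι]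
      noncomm_ring
    obtain ⟨⟨x, y⟩, hxy⟩ := hbij.2 (l *ᵥ v₀)
    have hfixl : τ *ᵥ (l *ᵥ v₀) = l *ᵥ v₀ := by
      rw [Matrix.mulVec_mulVec, ← hlτ, ← Matrix.mulVec_mulVec, hv₀]
    have hy : y = 0 := by
      rw [← hxy, hfm] at hfixl
      rw [Matrix.mulVec_add, hfix, Matrix.mulVec_mulVec _ τ ζ, hτζ, ← Matrix.mulVec_mulVec, hfix,
        add_right_inj] at hfixl
      have h1 : (ζ - ζ') *ᵥ (ι y *ᵥ v₀) = 0 := by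
        rw [Matrix.sub_mulVec, hfixl, sub_self]
      have h2 : ι y *ᵥ v₀ = 0 := by
        rw [← Matrix.one_mulVec (ι y *ᵥ v₀), ← hsinv, ← Matrix.mulVec_mulVec, h1,
          Matrix.mulVec_zero]
      have h3 : frameMap ζ w v₀ (y, 0) = frameMap ζ w v₀ 0 := by
        rw [map_zero, hfm0, h2]
      exact congrArg Prod.fst (hbij.1 h3)
    refine ⟨x, Matrix.ext_of_mulVec_single fun i => ?_⟩
    obtain ⟨⟨p, q⟩, hpq⟩ := hbij.2 (Pi.single i 1)
    have hlx : ι x *ᵥ v₀ = l *ᵥ v₀ := by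
      rw [← hxy, hy, hfm0]
    have key : ∀ p, l *ᵥ (ι p *ᵥ v₀) = ι x *ᵥ (ι p *ᵥ v₀) := fun p => by
      rw [Matrix.mulVec_mulVec, hlι, ← Matrix.mulVec_mulVec, ← hlx, Matrix.mulVec_mulVec,
        Matrix.mulVec_mulVec, ← map_mul, ← map_mul, mul_comm p x]
    have hζx : ζ * ι x = ι x * ζ := commute_polyAction cζw x
    rw [← hpq, hfm]
    rw [Matrix.mulVec_add, Matrix.mulVec_add, key, Matrix.mulVec_mulVec _ l ζ, hlζ,
      ← Matrix.mulVec_mulVec, key, Matrix.mulVec_mulVec _ (ι x) ζ, ← hζx, ← Matrix.mulVec_mulVec]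

end LatticeFrame

/-! ### Topology and measurability of GL_{2h}(F) -/

section Topology
open MeasureTheory ValuativeRel

lemma mem_GLO_iff {F : Type*} [Field F] [ValuativeRel F] {h : ℕ} {g : GLn h F} :
    g ∈ GLO h F ↔ (∀ i j, (g : Mat h F) i j ∈ 𝒪[F]) ∧
      ∀ i j, ((g⁻¹ : GLn h F) : Mat h F) i j ∈ 𝒪[F] := by
  constructor
  · rintro ⟨u, rfl⟩
    refine ⟨fun i j => ?_, fun i j => ?_⟩
    · exact ((u : Matrix _ _ 𝒪[F]) i j).2
    · rw [← map_inv]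
      exact (((u⁻¹ : GL _ 𝒪[F]) : Matrix _ _ 𝒪[F]) i j).2
  · rintro ⟨h1, h2⟩
    have hinj : Function.Injective (fun m : Matrix (Fin (2 * h)) (Fin (2 * h)) 𝒪[F] =>
        m.map (algebraMap 𝒪[F] F)) := Matrix.map_injective Subtype.val_injective
    refine ⟨⟨Matrix.of fun i j => ⟨_, h1 i j⟩, Matrix.of fun i j => ⟨_, h2 i j⟩, hinj ?_, hinj ?_⟩, ?_⟩
    · simp only [Matrix.map_mul]
      rw [Matrix.map_one _ (map_zero _) (map_one _)]
      exact g.mul_inv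
    · simp only [Matrix.map_mul]
      rw [Matrix.map_one _ (map_zero _) (map_one _)]
      exact g.inv_mul
    · ext i j
      rfl

/-- The σ-algebra of the group is pulled back from the matrices, so measurability can be tested
entry by entry, with no comparison to the Borel sets of the group topology. -/
lemma measurable_GLn_iff {F : Type*} [Field F] [MeasurableSpace F] {h : ℕ} {X : Type*} [MeasurableSpace X] {f : X → GLn h F} :
    Measurable f ↔ ∀ i j, Measurable fun x => (f x : Mat h F) i j := by
  rw [measurable_comap_iff]
  change Measurable (fun x => (f x : Mat h F)) ↔ _
  refine ⟨fun h i j => (measurable_pi_apply j).comp ((measurable_pi_apply i).comp h), fun h => ?_⟩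
  exact measurable_pi_lambda _ fun i => measurable_pi_lambda _ fun j => h i j

lemma measurable_GLn_apply {F : Type*} [Field F] [MeasurableSpace F] {h : ℕ} (i j : Fin (2 * h)) : Measurable fun g : GLn h F => (g : Mat h F) i j :=
  measurable_GLn_iff.1 measurable_id i j

section
variable (F : Type*) [Field F] [ValuativeRel F] [TopologicalSpace F] [IsNonarchimedeanLocalField F]

/-- The value group is countable, so F is covered by countably many closed balls, which are compact;
the topology is also pseudometrizable. -/
lemma secondCountableTopology_localField : SecondCountableTopology F := by
  have hc : Countable (ValueGroupWithZero F) :=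
    have : Countable (WithZero (Multiplicative ℤ)) :=
      inferInstanceAs (Countable (Option (Multiplicative ℤ)))
    (IsNonarchimedeanLocalField.valueGroupWithZeroIsoInt F).injective.countable
  let := IsTopologicalAddGroup.rightUniformSpace F
  have := isUniformAddGroup_of_addCommGroup (G := F)
  have h0 : (nhds (0 : F)).IsCountablyGenerated :=
    (IsValuativeTopology.hasBasis_nhds_zero' F).isCountablyGenerated
  have : (uniformity F).IsCountablyGenerated := IsUniformAddGroup.uniformity_countably_generated
  let := UniformSpace.pseudoMetricSpace F
  have : SigmaCompactSpace F := by
    refine ⟨?_⟩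
    have h1 : IsSigmaCompact (⋃ γ : ValueGroupWithZero F, {x : F | valuation F x ≤ γ}) :=
      isSigmaCompact_iUnion_of_isCompact _ fun γ => IsNonarchimedeanLocalField.isCompact_closedBall F γ
    convert h1
    exact (Set.iUnion_eq_univ_iff.2 fun x => ⟨valuation F x, by simp⟩).symm
  exact EMetric.secondCountable_of_sigmaCompact F

lemma t2Space_localField : T2Space F := by
  let := IsTopologicalAddGroup.rightUniformSpace F
  have := isUniformAddGroup_of_addCommGroup (G := F)
  have : T0Space F := ValuedRing.separated (Γ₀ := ValueGroupWithZero F)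
  infer_instance

end

variable {F : Type*} [Field F] [ValuativeRel F] [TopologicalSpace F] [IsNonarchimedeanLocalField F]
  {h : ℕ}

lemma isOpen_GLO : IsOpen (GLO h F : Set (GLn h F)) := by
  have hO : IsOpen (𝒪[F] : Set F) := Valuation.isOpen_integer
  have : (GLO h F : Set (GLn h F)) =
      (⋂ i, ⋂ j, {g : GLn h F | (g : Mat h F) i j ∈ 𝒪[F]}) ∩
        ⋂ i, ⋂ j, {g : GLn h F | ((g⁻¹ : GLn h F) : Mat h F) i j ∈ 𝒪[F]} := by
    ext g
    simp [mem_GLO_iff]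
  rw [this]
  refine (isOpen_iInter_of_finite fun i => isOpen_iInter_of_finite fun j => ?_).inter
    (isOpen_iInter_of_finite fun i => isOpen_iInter_of_finite fun j => ?_)
  · exact hO.preimage (Units.continuous_val.matrix_elem i j)
  · exact hO.preimage (Units.continuous_coe_inv.matrix_elem i j)

lemma secondCountableTopology_GLn : SecondCountableTopology (GLn h F) := by
  have := secondCountableTopology_localField F
  have : SecondCountableTopology (Mat h F) :=
    inferInstanceAs (SecondCountableTopology (Fin (2 * h) → Fin (2 * h) → F))
  have : SecondCountableTopology (Mat h F)ᵐᵒᵖ :=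
    MulOpposite.opHomeomorph.symm.isInducing.secondCountableTopology
  have hi : Topology.IsInducing (Units.embedProduct (Mat h F)) := Units.isEmbedding_embedProduct.1
  exact hi.secondCountableTopology

variable [MeasurableSpace F] [BorelSpace F]

lemma measurableMul₂_GLn : MeasurableMul₂ (GLn h F) := by
  have := secondCountableTopology_localField F
  refine ⟨measurable_GLn_iff.2 fun i j => ?_⟩
  simp only [Units.val_mul, Matrix.mul_apply]
  exact Finset.measurable_fun_sum _ fun k _ => ((measurable_GLn_apply i k).comp measurable_fst).mul
    ((measurable_GLn_apply k j).comp measurable_snd)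

/-- Cramer's rule writes the entries of the inverse as quotients of polynomials in the entries. -/
lemma measurableInv_GLn : MeasurableInv (GLn h F) := by
  have := secondCountableTopology_localField F
  have := t2Space_localField F
  have hdet : ∀ M : GLn h F → Mat h F, (∀ i j, Measurable fun g => M g i j) →
      Measurable fun g => (M g).det := by
    intro M hM
    simp only [Matrix.det_apply']
    exact Finset.measurable_fun_sum _ fun σ _ => (Finset.measurable_fun_prod _ fun i _ => hM _ _).const_mul _
  refine ⟨measurable_GLn_iff.2 fun i j => ?_⟩
  simp only [Matrix.coe_units_inv, Matrix.inv_def, Matrix.smul_apply, Ring.inverse_eq_inv',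
    smul_eq_mul, Matrix.adjugate_apply]
  refine (hdet _ measurable_GLn_apply).inv.mul (hdet _ fun k l => ?_)
  by_cases hk : k = j
  · subst hk
    simp
  · simpa [Matrix.updateRow_ne hk] using measurable_GLn_apply k l

lemma measurableSet_GLO : MeasurableSet (GLO h F : Set (GLn h F)) := by
  have := measurableInv_GLn (F := F) (h := h)
  have hO : MeasurableSet (𝒪[F] : Set F) := (Valuation.isOpen_integer).measurableSet
  have : (GLO h F : Set (GLn h F)) =
      (⋂ i, ⋂ j, {g : GLn h F | (g : Mat h F) i j ∈ 𝒪[F]}) ∩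
        ⋂ i, ⋂ j, {g : GLn h F | ((g⁻¹ : GLn h F) : Mat h F) i j ∈ 𝒪[F]} := by
    ext g
    simp [mem_GLO_iff]
  rw [this]
  refine (MeasurableSet.iInter fun i => MeasurableSet.iInter fun j => ?_).inter
    (MeasurableSet.iInter fun i => MeasurableSet.iInter fun j => ?_)
  · exact measurable_GLn_apply i j hO
  · exact (measurable_GLn_apply i j).comp measurable_inv hO

end Topology

/-! ### Computing the quotient measure by slices -/

section QuotientMeasure
open MeasureTheory

/-- A set that is the disjoint union of the `K`-cosets indexed by a finite set `S` has measure `#S`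
if `K` has measure one. -/
theorem measure_eq_ncard {G : Type*} [Group G] [MeasurableSpace G] [MeasurableMul₂ G]
    {ν : Measure G} [ν.IsMulLeftInvariant] {K P : Set G} (hK : ν K = 1) {ι : Type*} {S : Set ι} (hS : S.Finite)
    (hKm : MeasurableSet K) (c : G → ι) (hsurj : ∀ i ∈ S, ∃ g ∈ P, c g = i) (hc : ∀ g ∈ P, c g ∈ S)
    (hKc : ∀ g ∈ P, ∀ g', g' ∈ P ∧ c g = c g' ↔ g⁻¹ * g' ∈ K) :
    MeasurableSet P ∧ ν P = S.ncard := by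
  choose! x hxP hx using hsurj
  have hU : P = ⋃ i ∈ S, (fun g => (x i)⁻¹ * g) ⁻¹' K := by
    ext g
    simp only [Set.mem_iUnion, Set.mem_preimage]
    refine ⟨fun hg => ⟨c g, hc g hg, (hKc _ (hxP _ (hc g hg)) g).1 ⟨hg, hx _ (hc g hg)⟩⟩, ?_⟩
    rintro ⟨i, hi, hg⟩
    exact ((hKc _ (hxP _ hi) g).2 hg).1
  have hm : ∀ i, MeasurableSet ((fun g => (x i)⁻¹ * g) ⁻¹' K) := fun i =>
    measurable_const_mul _ hKm
  refine ⟨hU ▸ hS.measurableSet_biUnion fun i _ => hm i, ?_⟩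
  have hd : S.PairwiseDisjoint fun i => (fun g => (x i)⁻¹ * g) ⁻¹' K := by
    intro i hi j hj hij
    refine Set.disjoint_left.2 fun g h1 h2 => hij ?_
    rw [← hx i hi, ← hx j hj, ((hKc _ (hxP _ hi) g).2 h1).2, ((hKc _ (hxP _ hj) g).2 h2).2]
  rw [hU, measure_biUnion hS.countable hd fun i _ => hm i]
  simp only [measure_preimage_mul, hK]
  rw [ENNReal.tsum_const, mul_one, Set.ncard, ENat.card_coe_set_eq, ← hS.cast_ncard_eq]
  simp

variable {G : Type*} [Group G] [MeasurableSpace G] [MeasurableMul₂ G] [MeasurableInv G]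
  {N : Subgroup G} {ν : Measure G} {lam : Measure N} [SFinite ν] [SFinite lam]
  [ν.IsMulLeftInvariant]

/-- If `P` meets every `N`-orbit over `E` in a set of measure one, then the quotient measure of `E`
is the measure of `P`. -/
theorem quotientMeasure_apply_eq {Y : Set (Quotient (QuotientGroup.rightRel N))} (hY : MeasurableSet Y)
    {P : Set G} (hP : MeasurableSet P) (hPY : ∀ g ∈ P, Quotient.mk (QuotientGroup.rightRel N) g ∈ Y)
    (h1 : ∀ g, Quotient.mk (QuotientGroup.rightRel N) g ∈ Y → lam {n : N | (n : G) * g ∈ P} = 1)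
    (h2 : ∀ g, Quotient.mk (QuotientGroup.rightRel N) g ∈ Y → lam {n : N | (n : G)⁻¹ * g ∈ P} = 1) :
    quotientMeasure N ν lam Y = ν P := by
  set π : G → Quotient (QuotientGroup.rightRel N) := Quotient.mk (QuotientGroup.rightRel N) with hπd
  have hπ : Measurable π := measurable_quotient_mk''
  have hmem : ∀ (n : N) (g : G), π ((n : G) * g) = π g := fun n g =>
    Quotient.sound (QuotientGroup.rightRel_apply.2 (by simp))
  have hmul : Measurable fun p : G × N => (p.2 : G) * p.1 :=
    (measurable_subtype_coe.comp measurable_snd).mul measurable_fst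
  have hmul' : Measurable fun p : G × N => (p.2 : G)⁻¹ * p.1 :=
    (measurable_subtype_coe.comp measurable_snd).inv.mul measurable_fst
  have hind : Measurable (P.indicator (1 : G → ℝ≥0∞)) := measurable_one.indicator hP
  have hset : ∀ g, MeasurableSet {n : N | (n : G) * g ∈ P} := fun g =>
    (measurable_subtype_coe.mul_const g) hP
  have hset' : ∀ g, MeasurableSet {n : N | (n : G)⁻¹ * g ∈ P} := fun g =>
    (measurable_subtype_coe.inv.mul_const g) hP
  have hint : ∀ g, ∫⁻ n : N, P.indicator (1 : G → ℝ≥0∞) ((n : G) * g) ∂lam =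
      lam {n : N | (n : G) * g ∈ P} := fun g => by
    rw [← lintegral_indicator_one (hset g)]
    rfl
  have hint' : ∀ g, ∫⁻ n : N, P.indicator (1 : G → ℝ≥0∞) ((n : G)⁻¹ * g) ∂lam =
      lam {n : N | (n : G)⁻¹ * g ∈ P} := fun g => by
    rw [← lintegral_indicator_one (hset' g)]
    rfl
  apply le_antisymm
  -- A supremum of measures is bounded above by exhibiting a measure above all its members. The
  -- infinite multiple of counting measure off `Y` makes the comparison trivial there, so only
  -- subsets of `Y` need an argument.
  · set ρ : Measure (Quotient (QuotientGroup.rightRel N)) :=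
      (ν.restrict P).map π + (⊤ : ℝ≥0∞) • (Measure.count.restrict Yᶜ) with hρ
    have hle : quotientMeasure N ν lam ≤ ρ := by
      refine iSup₂_le fun w hw => Measure.le_iff.2 fun E hE => ?_
      by_cases hEY : E ⊆ Y
      · have hE' := hπ hE
        refine le_trans ?_ (le_add_right le_rfl : (ν.restrict P).map π E ≤ _)
        rw [Measure.map_apply hπ hE, Measure.map_apply hπ hE, withDensity_apply _ hE',
          Measure.restrict_apply hE', ← lintegral_indicator hE']
        have hw' := hw.1.indicator hE'
        -- Insert ∫ 1_P(n⁻¹g) dn, which equals 1 over `Y`, exchange the integrals, and translate g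
        -- by n: there remains 1_P(g) ∫ w(ng) dn ≤ 1_P(g). Assuming the normalization for n⁻¹ as
        -- well as for n avoids inversion invariance of `lam`.
        calc ∫⁻ g, (π ⁻¹' E).indicator w g ∂ν
            = ∫⁻ g, ∫⁻ n : N, (π ⁻¹' E).indicator w g *
                P.indicator (1 : G → ℝ≥0∞) ((n : G)⁻¹ * g) ∂lam ∂ν := by
              refine lintegral_congr fun g => ?_
              have hm : Measurable fun n : N => P.indicator (1 : G → ℝ≥0∞) ((n : G)⁻¹ * g) :=
                hind.comp (measurable_subtype_coe.inv.mul_const g)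
              rw [lintegral_const_mul _ hm, hint']
              by_cases hg : g ∈ π ⁻¹' E
              · rw [h2 g (hEY hg), mul_one]
              · rw [Set.indicator_of_notMem hg, zero_mul]
          _ = ∫⁻ n : N, ∫⁻ g, (π ⁻¹' E).indicator w g *
                P.indicator (1 : G → ℝ≥0∞) ((n : G)⁻¹ * g) ∂ν ∂lam :=
              lintegral_lintegral_swap
                ((hw'.comp measurable_fst).mul (hind.comp hmul')).aemeasurable
          _ = ∫⁻ n : N, ∫⁻ g, (π ⁻¹' E).indicator w ((n : G) * g) *
                P.indicator (1 : G → ℝ≥0∞) g ∂ν ∂lam := by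
              refine lintegral_congr fun n => ?_
              rw [← lintegral_mul_left_eq_self (fun g => (π ⁻¹' E).indicator w g *
                P.indicator (1 : G → ℝ≥0∞) ((n : G)⁻¹ * g)) (n : G)]
              simp
          _ = ∫⁻ g, ∫⁻ n : N, (π ⁻¹' E).indicator w ((n : G) * g) *
                P.indicator (1 : G → ℝ≥0∞) g ∂lam ∂ν :=
              (lintegral_lintegral_swap
                ((hw'.comp hmul).mul (hind.comp measurable_fst)).aemeasurable).symm
          _ ≤ ∫⁻ g, (π ⁻¹' E ∩ P).indicator 1 g ∂ν := by
              refine lintegral_mono fun g => ?_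
              have hm : Measurable fun n : N => (π ⁻¹' E).indicator w ((n : G) * g) :=
                hw'.comp (measurable_subtype_coe.mul_const g)
              rw [lintegral_mul_const _ hm]
              by_cases hgE : g ∈ π ⁻¹' E
              · by_cases hgP : g ∈ P
                · rw [Set.indicator_of_mem hgP, Set.indicator_of_mem (Set.mem_inter hgE hgP), Pi.one_apply,
                    mul_one]
                  refine le_trans (lintegral_mono fun n => ?_) (hw.2 g)
                  exact Set.indicator_le_self _ _ _
                · rw [Set.indicator_of_notMem hgP, mul_zero]
                  exact zero_le
              · have : ∀ n : N, (π ⁻¹' E).indicator w ((n : G) * g) = 0 := fun n =>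
                  Set.indicator_of_notMem (by rwa [Set.mem_preimage, hmem]) _
                simp [this]
          _ = ν (π ⁻¹' E ∩ P) := lintegral_indicator_one (hE'.inter hP)
      · obtain ⟨e, heE, heY⟩ := Set.not_subset.1 hEY
        have : Measure.count.restrict Yᶜ E ≠ 0 := by
          rw [Measure.restrict_apply hE]
          exact Measure.count_ne_zero ⟨e, heE, heY⟩
        have htop : ρ E = ⊤ := by
          rw [hρ, Measure.add_apply, Measure.smul_apply, smul_eq_mul, ENNReal.top_mul this]
          exact add_top _
        rw [htop]
        exact le_top
    refine (Measure.le_iff.1 hle Y hY).trans ?_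
    rw [hρ, Measure.add_apply, Measure.smul_apply, Measure.restrict_apply hY, Set.inter_compl_self,
      measure_empty, smul_zero, add_zero, Measure.map_apply hπ hY, Measure.restrict_apply (hπ hY)]
    exact measure_mono Set.inter_subset_right
  -- For the lower bound, the indicator of `P` is itself one of the weights in the supremum.
  · have hadm : P.indicator (1 : G → ℝ≥0∞) ∈
        {w : G → ℝ≥0∞ | Measurable w ∧ ∀ g, ∫⁻ n : N, w ((n : G) * g) ∂lam ≤ 1} := by
      refine ⟨hind, fun g => ?_⟩
      rw [hint]
      by_cases hg : π g ∈ Y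
      · rw [h1 g hg]
      · have : {n : N | (n : G) * g ∈ P} = ∅ := by
          ext n
          simp only [Set.mem_ofPred_eq, Set.mem_empty_iff_false, iff_false]
          intro hn
          exact hg (hmem n g ▸ hPY _ hn)
        simp [this]
    have hle : (ν.withDensity (P.indicator 1)).map π ≤ quotientMeasure N ν lam :=
      le_iSup₂ (f := fun (w : G → ℝ≥0∞) (_ : w ∈ {w : G → ℝ≥0∞ | Measurable w ∧
        ∀ g, ∫⁻ n : N, w ((n : G) * g) ∂lam ≤ 1}) => (ν.withDensity w).map π) _ hadm
    refine le_trans ?_ (Measure.le_iff.1 hle Y hY)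
    rw [Measure.map_apply hπ hY, withDensity_indicator_one hP, Measure.restrict_apply (hπ hY)]
    exact measure_mono (Set.subset_inter hPY le_rfl)

end QuotientMeasure

/-! ### Primitive lattices in an étale algebra -/

section PrimitiveLattices
variable {F : Type*} [Field F] [ValuativeRel F]

lemma exists_smul_mem_of_fg {V : Type*} [AddCommGroup V] [Module 𝒪[F] V]
    {O E : Submodule 𝒪[F] V} (hO : O.FG)
    (hE : ∀ x, ∃ r : 𝒪[F], r ≠ 0 ∧ r • x ∈ E) : ∃ r : 𝒪[F], r ≠ 0 ∧ ∀ x ∈ O, r • x ∈ E := by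
  obtain ⟨s, rfl⟩ := hO
  choose r hr hrE using hE
  refine ⟨∏ x ∈ s, r x, Finset.prod_ne_zero_iff.2 fun x _ => hr x, fun x hx => ?_⟩
  have : Submodule.span 𝒪[F] (s : Set V) ≤ E.comap (LinearMap.lsmul 𝒪[F] V (∏ x ∈ s, r x)) := by
    classical
    refine Submodule.span_le.2 fun y hy => ?_
    change (∏ x ∈ s, r x) • y ∈ E
    rw [← Finset.prod_erase_mul _ _ hy, mul_smul]
    exact E.smul_mem _ (hrE y)
  exact this hx

variable {L : Type*} [CommRing L] [Algebra F L]

lemma exists_smul_isIntegral [Module.Finite F L] (x : L) : ∃ r : 𝒪[F], r ≠ 0 ∧ IsIntegral 𝒪[F] (r • x) := by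
  have hx : IsAlgebraic F x := (Algebra.IsIntegral.isIntegral x).isAlgebraic
  obtain ⟨r, hr, h⟩ := ((IsFractionRing.isAlgebraic_iff 𝒪[F] F L).2 hx).exists_integral_multiple
  exact ⟨r, hr, h⟩

lemma span_map_mulLeft (M : Submodule 𝒪[F] L) (u : L) :
    Submodule.span (integralClosure 𝒪[F] L) (M.map (LinearMap.mulLeft 𝒪[F] u) : Set L) =
      (Submodule.span (integralClosure 𝒪[F] L) (M : Set L)).map
        (LinearMap.mulLeft (integralClosure 𝒪[F] L) u) := by
  rw [Submodule.map_span]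
  rfl

lemma le_of_span_eq_one {M : Submodule 𝒪[F] L}
    (hM : Submodule.span (integralClosure 𝒪[F] L) (M : Set L) = 1) :
    M ≤ (integralClosure 𝒪[F] L).toSubmodule := by
  intro x hx
  have h1 : x ∈ Submodule.span (integralClosure 𝒪[F] L) (M : Set L) := Submodule.subset_span hx
  rw [hM, Submodule.mem_one] at h1
  obtain ⟨y, rfl⟩ := h1
  exact y.2

/-- The primitive lattices in the homothety class of a primitive lattice are its multiples by
integral units. -/
lemma span_map_eq_one_iff {M : Submodule 𝒪[F] L}
    (hM : Submodule.span (integralClosure 𝒪[F] L) (M : Set L) = 1) (u : Lˣ) :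
    Submodule.span (integralClosure 𝒪[F] L) (M.map (LinearMap.mulLeft 𝒪[F] (u : L)) : Set L) = 1 ↔
      IsIntegral 𝒪[F] (u : L) ∧ IsIntegral 𝒪[F] ((u⁻¹ : Lˣ) : L) := by
  rw [span_map_mulLeft, hM]
  have hmem : ∀ x : L, x ∈ (1 : Submodule (integralClosure 𝒪[F] L) L) ↔ IsIntegral 𝒪[F] x := by
    intro x
    rw [Submodule.mem_one]
    exact ⟨by rintro ⟨y, rfl⟩; exact y.2, fun hx => ⟨⟨x, hx⟩, rfl⟩⟩
  constructor
  · intro h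
    constructor
    · rw [← hmem, ← h]
      exact ⟨1, (hmem 1).2 isIntegral_one, by simp⟩
    · have : (1 : L) ∈ (1 : Submodule (integralClosure 𝒪[F] L) L) := (hmem 1).2 isIntegral_one
      rw [← h] at this
      obtain ⟨y, hy, hy'⟩ := this
      have : ((u⁻¹ : Lˣ) : L) = y := by
        rw [← mul_one ((u⁻¹ : Lˣ) : L), ← hy', LinearMap.mulLeft_apply, Units.inv_mul_cancel_left]
      rw [this]
      exact (hmem y).1 hy
  · rintro ⟨h1, h2⟩
    ext x
    rw [Submodule.mem_map]
    constructor
    · rintro ⟨y, hy, rfl⟩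
      exact (hmem _).2 (h1.mul ((hmem y).1 hy))
    · intro hx
      exact ⟨(u⁻¹ : Lˣ) * x, (hmem _).2 (h2.mul ((hmem x).1 hx)), by simp⟩

variable [TopologicalSpace F] [IsNonarchimedeanLocalField F]

lemma finite_quotient_span_singleton {c : 𝒪[F]} (hc : c ≠ 0) :
    Finite (𝒪[F] ⧸ Ideal.span {c}) := by
  have h1 : Finite (𝒪[F] ⧸ IsLocalRing.maximalIdeal 𝒪[F]) := inferInstanceAs (Finite 𝓀[F])
  obtain ⟨n, hn⟩ := exists_maximalIdeal_pow_eq_of_principal 𝒪[F] inferInstance (Ideal.span {c})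
    (by simpa using hc)
  have := Ideal.finite_quotient_pow
    (IsNoetherian.noetherian (IsLocalRing.maximalIdeal 𝒪[F])) n
  rwa [← hn] at this

/-- The lattices between cO and O correspond to submodules of O/cO, a finite module over the finite
ring 𝒪_F/c. -/
lemma finite_setOf_le_le {V : Type*} [AddCommGroup V] [Module 𝒪[F] V] {O : Submodule 𝒪[F] V}
    (hO : O.FG) {c : 𝒪[F]} (hc : c ≠ 0) :
    {M : Submodule 𝒪[F] V | M ≤ O ∧ ∀ x ∈ O, c • x ∈ M}.Finite := by
  have := finite_quotient_span_singleton hc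
  have hfin : Module.Finite 𝒪[F] O := Module.Finite.iff_fg.2 hO
  let D : Submodule 𝒪[F] O := Ideal.span {c} • (⊤ : Submodule 𝒪[F] O)
  have hD : Finite (O ⧸ D) := Module.finite_of_finite (𝒪[F] ⧸ Ideal.span {c})
  have h1 : ∀ M ∈ {M : Submodule 𝒪[F] V | M ≤ O ∧ ∀ x ∈ O, c • x ∈ M},
      ((M.comap O.subtype).map D.mkQ).comap D.mkQ = M.comap O.subtype := by
    rintro M ⟨_, hM⟩
    rw [Submodule.comap_map_mkQ, sup_eq_right]
    refine Submodule.smul_le.2 fun r hr x _ => ?_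
    obtain ⟨a, rfl⟩ := Ideal.mem_span_singleton'.1 hr
    rw [mul_smul]
    exact Submodule.smul_mem _ a (hM x x.2)
  have hfinS : Finite (Submodule 𝒪[F] (O ⧸ D)) :=
    Finite.of_injective (fun M => (M : Set (O ⧸ D))) SetLike.coe_injective
  refine Set.Finite.of_finite_image (f := fun M => (M.comap O.subtype).map D.mkQ)
    (Set.toFinite _) fun M hM M' hM' hMM' => ?_
  have h2 : M.comap O.subtype = M'.comap O.subtype := by
    rw [← h1 M hM, ← h1 M' hM']
    exact congrArg _ hMM'
  ext x
  refine ⟨fun hx => ?_, fun hx => ?_⟩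
  · have : (⟨x, hM.1 hx⟩ : O) ∈ M'.comap O.subtype := h2 ▸ hx
    exact this
  · have : (⟨x, hM'.1 hx⟩ : O) ∈ M.comap O.subtype := h2 ▸ hx
    exact this

lemma exists_smul_mem_adjoin {θ : L} (hθ : Algebra.adjoin F {θ} = ⊤) (x : L) :
    ∃ r : 𝒪[F], r ≠ 0 ∧ r • x ∈ Algebra.adjoin 𝒪[F] {θ} := by
  have hx : x ∈ Algebra.adjoin F {θ} := hθ ▸ Algebra.mem_top
  have hinj : ∀ r : 𝒪[F], r • (1 : L) = algebraMap 𝒪[F] L r := fun r =>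
    (Algebra.algebraMap_eq_smul_one r).symm
  induction hx using Algebra.adjoin_induction with
  | mem x hx => exact ⟨1, one_ne_zero, by rw [one_smul]; exact Algebra.subset_adjoin hx⟩
  | algebraMap a =>
    obtain ⟨n, d, hd, rfl⟩ := IsFractionRing.div_surjective (A := 𝒪[F]) a
    have hd0 : d ≠ 0 := nonZeroDivisors.ne_zero hd
    have hd1 : algebraMap 𝒪[F] F d ≠ 0 := by simpa using hd0
    refine ⟨d, hd0, ?_⟩
    have : d • algebraMap F L (algebraMap 𝒪[F] F n / algebraMap 𝒪[F] F d) =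
        algebraMap 𝒪[F] L n := by
      rw [Algebra.smul_def, IsScalarTower.algebraMap_apply 𝒪[F] F L,
        IsScalarTower.algebraMap_apply 𝒪[F] F L, ← map_mul, mul_div_cancel₀ _ hd1]
    rw [this]
    exact Subalgebra.algebraMap_mem _ _
  | add x y _ _ hx hy =>
    obtain ⟨r, hr, hx⟩ := hx
    obtain ⟨s, hs, hy⟩ := hy
    refine ⟨r * s, mul_ne_zero hr hs, ?_⟩
    rw [smul_add]
    refine add_mem ?_ ?_
    · rw [mul_comm, mul_smul]
      exact Subalgebra.smul_mem _ hx s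
    · rw [mul_smul]
      exact Subalgebra.smul_mem _ hy r
  | mul x y _ _ hx hy =>
    obtain ⟨r, hr, hx⟩ := hx
    obtain ⟨s, hs, hy⟩ := hy
    refine ⟨r * s, mul_ne_zero hr hs, ?_⟩
    rw [← smul_mul_smul_comm]
    exact mul_mem hx hy

variable [Module.Finite F L] [Algebra.FormallyUnramified F L]

/-- A homothety class of lattices contains a primitive one. -/
lemma exists_span_map_eq_one {M : Submodule 𝒪[F] L} (hfg : M.FG)
    (hspan : ∀ x, ∃ r : 𝒪[F], r ≠ 0 ∧ r • x ∈ M) :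
    ∃ u : Lˣ, Submodule.span (integralClosure 𝒪[F] L)
      (M.map (LinearMap.mulLeft 𝒪[F] (u : L)) : Set L) = 1 := by
  have hfin : Module.Finite 𝒪[F] (integralClosure 𝒪[F] L) :=
    Module.Finite.iff_fg.2 (finite_integralClosure F L)
  set J := (Submodule.span (integralClosure 𝒪[F] L) (M : Set L)) with hJ
  have hJfg : (J.restrictScalars 𝒪[F]).FG := (Submodule.FG.span hfg).restrictScalars
  let e : (Fin 1 → L) ≃ₗ[𝒪[F]] L := LinearEquiv.funUnique (Fin 1) 𝒪[F] L
  -- The lattice J generated over the maximal order is free of rank one: it is generated by `P 1 0`.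
  -- Multiplication by the inverse of this generator makes it the unit lattice.
  obtain ⟨P, hP⟩ := exists_linearEquiv_of_lattice F
    ((J.restrictScalars 𝒪[F]).map e.symm.toLinearMap) (hJfg.map _)
    (fun v => by
      obtain ⟨r, hr, h⟩ := hspan (v 0)
      refine ⟨r, hr, r • v 0, Submodule.subset_span h, ?_⟩
      ext i
      fin_cases i
      rfl)
    (by
      rintro a ha _ ⟨x, hx, rfl⟩
      refine ⟨a * x, J.smul_mem ⟨a, ha⟩ hx, ?_⟩
      ext i
      rfl)
  have hP' : ∀ x : L, x * P 1 0 ∈ J ↔ IsIntegral 𝒪[F] x := fun x => by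
    have h1 : P (fun _ => x) = x • P 1 := by
      rw [← map_smul]
      congr 1
      ext i
      simp
    have h2 := hP fun _ => x
    rw [h1] at h2
    have h3 : x • P 1 ∈ (J.restrictScalars 𝒪[F]).map e.symm.toLinearMap ↔ x * P 1 0 ∈ J := by
      constructor
      · rintro ⟨y, hy, h⟩
        have : y = x * P 1 0 := congrFun h 0
        exact this ▸ hy
      · intro h
        refine ⟨_, h, ?_⟩
        ext i
        fin_cases i
        rfl
    rw [← h3, h2]
    simp
  obtain ⟨v, hv⟩ := P.surjective 1
  have hunit : v 0 * P 1 0 = 1 := by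
    have h1 : v = v 0 • (1 : Fin 1 → L) := by
      ext i
      fin_cases i
      simp
    rw [h1, map_smul] at hv
    exact congrFun hv 0
  refine ⟨⟨v 0, P 1 0, hunit, by rw [mul_comm, hunit]⟩, ?_⟩
  rw [span_map_mulLeft, ← hJ]
  ext x
  simp only [Submodule.mem_map, Submodule.mem_one, LinearMap.mulLeft_apply]
  constructor
  · rintro ⟨y, hy, rfl⟩
    refine ⟨⟨v 0 * y, (hP' _).1 ?_⟩, rfl⟩
    rwa [mul_right_comm, hunit, one_mul]
  · rintro ⟨y, rfl⟩
    refine ⟨y * P 1 0, (hP' _).2 y.2, ?_⟩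
    rw [mul_left_comm, hunit, mul_one]
    rfl

/-- Primitive lattices contain a common multiple of the maximal order. -/
lemma exists_smul_le_of_span_eq_one {θ : L} (hθ : Algebra.adjoin F {θ} = ⊤) :
    ∃ c : 𝒪[F], c ≠ 0 ∧ ∀ M : Submodule 𝒪[F] L, (∀ x ∈ M, θ * x ∈ M) →
      Submodule.span (integralClosure 𝒪[F] L) (M : Set L) = 1 →
        ∀ x, IsIntegral 𝒪[F] x → c • x ∈ M := by
  -- The constant c multiplies the maximal order into the order of θ. If x = Σ fᵢgᵢ with fᵢ integral
  -- and gᵢ in M, then each cfᵢ acts on M, so cx lies in M.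
  obtain ⟨c, hc, hcE⟩ := exists_smul_mem_of_fg (finite_integralClosure F (R := 𝒪[F]) L)
    (E := (Algebra.adjoin 𝒪[F] {θ}).toSubmodule) (exists_smul_mem_adjoin hθ)
  refine ⟨c, hc, fun M hθM hM x hx => ?_⟩
  have hE : ∀ a ∈ Algebra.adjoin 𝒪[F] {θ}, ∀ x ∈ M, a * x ∈ M := fun a ha => by
    induction ha using Algebra.adjoin_induction with
    | mem y hy =>
      rw [Set.mem_singleton_iff] at hy
      exact hy ▸ hθM
    | algebraMap r =>
      intro x hx
      rw [← Algebra.smul_def]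
      exact M.smul_mem r hx
    | add a b _ _ ha hb =>
      intro x hx
      rw [add_mul]
      exact M.add_mem (ha x hx) (hb x hx)
    | mul a b _ _ ha hb =>
      intro x hx
      rw [mul_assoc]
      exact ha _ (hb x hx)
  have h1 : x ∈ Submodule.span (integralClosure 𝒪[F] L) (M : Set L) := by
    rw [hM, Submodule.mem_one]
    exact ⟨⟨x, hx⟩, rfl⟩
  obtain ⟨n, f, g, rfl⟩ := Submodule.mem_span_set'.1 h1
  rw [Finset.smul_sum]
  refine M.sum_mem fun i _ => ?_
  have h2 : c • (f i • (g i : L)) = (c • (f i : L)) * g i := by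
    rw [smul_mul_assoc]
    rfl
  rw [h2]
  exact hE _ (hcE _ (f i).2) _ (g i).2

end PrimitiveLattices

/-! ### Lattices as cosets of GL_{2h}(𝒪_F), and transitivity of centralizers -/

section Lattices
variable {F : Type*} [Field F] [ValuativeRel F] {h : ℕ}

/-- The lattice `g 𝒪_F^{2h}`. -/
def latticeOf (g : GLn h F) : Submodule 𝒪[F] (Fin (2 * h) → F) where
  carrier := {v | ∀ i, (((g⁻¹ : GLn h F) : Mat h F) *ᵥ v) i ∈ 𝒪[F]}
  add_mem' {u v} hu hv i := by
    rw [Matrix.mulVec_add]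
    exact add_mem (hu i) (hv i)
  zero_mem' i := by
    rw [Matrix.mulVec_zero]
    exact zero_mem _
  smul_mem' c v hv i := by
    have : c • v = (c : F) • v := rfl
    rw [this, Matrix.mulVec_smul]
    exact mul_mem c.2 (hv i)

lemma mem_latticeOf {g : GLn h F} {v : Fin (2 * h) → F} :
    v ∈ latticeOf g ↔ ∀ i, (((g⁻¹ : GLn h F) : Mat h F) *ᵥ v) i ∈ 𝒪[F] := Iff.rfl

lemma mem_latticeOf_mul {l g : GLn h F} {v : Fin (2 * h) → F} :
    v ∈ latticeOf (l * g) ↔ ((l⁻¹ : GLn h F) : Mat h F) *ᵥ v ∈ latticeOf g := by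
  rw [mem_latticeOf, mem_latticeOf, Matrix.mulVec_mulVec, mul_inv_rev, Units.val_mul]

lemma mulVec_mem_latticeOf_iff {g g' : GLn h F} {m : Mat h F} :
    (∀ v ∈ latticeOf g', m *ᵥ v ∈ latticeOf g) ↔
      ∀ i j, (((g⁻¹ : GLn h F) : Mat h F) * m * g') i j ∈ 𝒪[F] := by
  constructor
  · intro H i j
    have h1 : (g' : Mat h F) *ᵥ Pi.single j 1 ∈ latticeOf g' := fun k => by
      rw [Matrix.mulVec_mulVec, ← Units.val_mul, inv_mul_cancel, Units.val_one, Matrix.one_mulVec,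
        Pi.single_apply]
      split_ifs
      exacts [one_mem _, zero_mem _]
    have h2 := H _ h1 i
    rwa [Matrix.mulVec_mulVec, Matrix.mulVec_mulVec, Matrix.mulVec_single_one] at h2
  · intro H v hv i
    have h1 : ((g⁻¹ : GLn h F) : Mat h F) *ᵥ (m *ᵥ v) =
        (((g⁻¹ : GLn h F) : Mat h F) * m * (g' : Mat h F)) *ᵥ (((g'⁻¹ : GLn h F) : Mat h F) *ᵥ v) := by
      rw [Matrix.mulVec_mulVec, Matrix.mulVec_mulVec, mul_assoc _ (g' : Mat h F), ← Units.val_mul,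
        mul_inv_cancel, Units.val_one, mul_one]
    rw [h1, Matrix.mulVec_eq_sum, Finset.sum_apply]
    exact sum_mem fun j _ => mul_mem (H i j) (hv j)

lemma latticeOf_eq_iff {g g' : GLn h F} : latticeOf g = latticeOf g' ↔ g⁻¹ * g' ∈ GLO h F := by
  have key : ∀ g g' : GLn h F, latticeOf g' ≤ latticeOf g ↔
      ∀ i j, ((g⁻¹ * g' : GLn h F) : Mat h F) i j ∈ 𝒪[F] := fun g g' => by
    have := mulVec_mem_latticeOf_iff (g := g) (g' := g') (m := 1)
    simp only [Matrix.one_mulVec, mul_one] at this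
    exact this
  rw [mem_GLO_iff, ← key, mul_inv_rev, inv_inv, ← key]
  exact ⟨fun h => ⟨h.ge, h.le⟩, fun h => le_antisymm h.2 h.1⟩

lemma mem_stabilizerAlgebra_latticeOf {g : GLn h F} {m : Mat h F} :
    m ∈ stabilizerAlgebra (latticeOf g) ↔
      ∀ i j, (((g⁻¹ : GLn h F) : Mat h F) * m * g) i j ∈ 𝒪[F] :=
  mulVec_mem_latticeOf_iff

lemma matImage_stdLattice (g : GLn h F) :
    matImage (g : Mat h F) (stdLattice h F) = (latticeOf g).toAddSubgroup := by
  ext v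
  have hstd : ∀ u : Fin (2 * h) → F, u ∈ stdLattice h F ↔ ∀ i, u i ∈ 𝒪[F] := fun u => by
    simp [stdLattice, AddSubgroup.mem_pi]
  constructor
  · rintro ⟨u, hu, rfl⟩ i
    change (_ *ᵥ ((g : Mat h F) *ᵥ u)) i ∈ _
    rw [Matrix.mulVec_mulVec, ← Units.val_mul, inv_mul_cancel, Units.val_one, Matrix.one_mulVec]
    exact (hstd u).1 hu i
  · intro hv
    refine ⟨_, (hstd _).2 hv, ?_⟩
    change (g : Mat h F) *ᵥ _ = v
    rw [Matrix.mulVec_mulVec, ← Units.val_mul, mul_inv_cancel, Units.val_one, Matrix.one_mulVec]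

lemma fg_latticeOf (g : GLn h F) : (latticeOf g).FG := by
  let f : (Fin (2 * h) → 𝒪[F]) →ₗ[𝒪[F]] (Fin (2 * h) → F) :=
    ((g : Mat h F).mulVecLin.restrictScalars 𝒪[F]).comp
      (LinearMap.pi fun i => (Algebra.linearMap 𝒪[F] F).comp (LinearMap.proj i))
  have : latticeOf g = LinearMap.range f := by
    ext v
    constructor
    · intro hv
      refine ⟨fun i => ⟨_, hv i⟩, ?_⟩
      change (g : Mat h F) *ᵥ (((g⁻¹ : GLn h F) : Mat h F) *ᵥ v) = v
      rw [Matrix.mulVec_mulVec, ← Units.val_mul, mul_inv_cancel, Units.val_one, Matrix.one_mulVec]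
    · rintro ⟨u, rfl⟩ i
      change (((g⁻¹ : GLn h F) : Mat h F) *ᵥ ((g : Mat h F) *ᵥ fun i => (u i : F))) i ∈ _
      rw [Matrix.mulVec_mulVec, ← Units.val_mul, inv_mul_cancel, Units.val_one, Matrix.one_mulVec]
      exact (u i).2
  rw [this, LinearMap.range_eq_map]
  exact (Module.Finite.fg_top).map f

lemma exists_smul_mem_latticeOf (g : GLn h F) (v : Fin (2 * h) → F) :
    ∃ r : 𝒪[F], r ≠ 0 ∧ r • v ∈ latticeOf g := by
  obtain ⟨b, hb⟩ := IsLocalization.exist_integer_multiples_of_finite (nonZeroDivisors 𝒪[F])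
    (((g⁻¹ : GLn h F) : Mat h F) *ᵥ v)
  refine ⟨b, nonZeroDivisors.ne_zero b.2, fun i => ?_⟩
  have : (b : 𝒪[F]) • v = ((b : 𝒪[F]) : F) • v := rfl
  rw [this, Matrix.mulVec_smul]
  obtain ⟨x, hx⟩ := hb i
  have hx' : (algebraMap 𝒪[F] F x) = (((b : 𝒪[F]) : F) • ((g⁻¹ : GLn h F) : Mat h F) *ᵥ v) i := hx
  rw [← hx']
  exact x.2

variable [TopologicalSpace F] [IsNonarchimedeanLocalField F]
  {A : Type*} [CommRing A] [Algebra F A] [Module.Finite F A]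
  [Algebra.FormallyUnramified F A]

/-- The centralizer of a free embedding of an étale algebra acts transitively on the lattices
that are stable under its maximal order. -/
lemma exists_centralizer_latticeOf_eq {e : A →ₐ[F] Mat h F} (he : IsFreeEmbedding e) {g : GLn h F}
    (hg : ∀ a, IsIntegral 𝒪[F] a → e a ∈ stabilizerAlgebra (latticeOf g))
    {Λ : Submodule 𝒪[F] (Fin (2 * h) → F)} (hfg : Λ.FG)
    (hspan : ∀ v, ∃ r : 𝒪[F], r ≠ 0 ∧ r • v ∈ Λ)
    (hstab : ∀ a, IsIntegral 𝒪[F] a → e a ∈ stabilizerAlgebra Λ) :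
    ∃ t ∈ centralizerGL e, latticeOf (t * g) = Λ := by
  obtain ⟨φ, hφ⟩ := he
  have key : ∀ Λ : Submodule 𝒪[F] (Fin (2 * h) → F), Λ.FG →
      (∀ v, ∃ r : 𝒪[F], r ≠ 0 ∧ r • v ∈ Λ) →
      (∀ a, IsIntegral 𝒪[F] a → e a ∈ stabilizerAlgebra Λ) →
      ∃ P : (Fin h → A) ≃ₗ[A] (Fin h → A), ∀ v, φ (P v) ∈ Λ ↔ ∀ j, IsIntegral 𝒪[F] (v j) := by
    intro Λ hfg hspan hstab
    let φ' : (Fin h → A) ≃ₗ[𝒪[F]] (Fin (2 * h) → F) := φ.restrictScalars 𝒪[F]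
    have hφ' : Λ.comap φ'.toLinearMap = Λ.map φ'.symm.toLinearMap :=
      Submodule.comap_equiv_eq_map_symm φ' Λ
    obtain ⟨P, hP⟩ := exists_linearEquiv_of_lattice F (Λ.comap φ'.toLinearMap)
      (hφ' ▸ hfg.map _)
      (fun v => by
        obtain ⟨r, hr, h⟩ := hspan (φ v)
        refine ⟨r, hr, ?_⟩
        rw [Submodule.mem_comap, map_smul]
        exact h)
      (fun a ha v hv => by
        change φ (a • v) ∈ Λ
        rw [hφ]
        exact hstab a ha _ hv)
    exact ⟨P, hP⟩
  -- Both lattices are images of the standard lattice of `A^h` under `A`-linear automorphisms. Their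
  -- quotient carries one lattice to the other and commutes with `A`.
  obtain ⟨P, hP⟩ := key Λ hfg hspan hstab
  obtain ⟨P₀, hP₀⟩ := key _ (fg_latticeOf g) (exists_smul_mem_latticeOf g) hg
  let ψ : (Fin (2 * h) → F) ≃ₗ[F] (Fin (2 * h) → F) :=
    φ.symm.trans (((P₀.symm.trans P).restrictScalars F).trans φ)
  have hψ : ∀ v, ψ v ∈ Λ ↔ v ∈ latticeOf g := fun v => by
    have h1 : ψ v = φ (P (P₀.symm (φ.symm v))) := rfl
    have h2 : v = φ (P₀ (P₀.symm (φ.symm v))) := by simp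
    rw [h1, hP, ← hP₀, ← h2]
  have hψe : ∀ a v, ψ (e a *ᵥ v) = e a *ᵥ ψ v := fun a v => by
    have h1 : φ.symm (e a *ᵥ v) = a • φ.symm v := by
      rw [LinearEquiv.symm_apply_eq, hφ, LinearEquiv.apply_symm_apply]
    change φ (P (P₀.symm (φ.symm (e a *ᵥ v)))) = e a *ᵥ φ (P (P₀.symm (φ.symm v)))
    rw [h1, map_smul, map_smul, hφ]
  have hm : ∀ f : (Fin (2 * h) → F) →ₗ[F] (Fin (2 * h) → F), ∀ v,
      LinearMap.toMatrix' f *ᵥ v = f v := fun f v => by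
    rw [← Matrix.toLin'_apply, Matrix.toLin'_toMatrix']
  have hψinv : ∀ f f' : (Fin (2 * h) → F) ≃ₗ[F] (Fin (2 * h) → F), (∀ v, f (f' v) = v) →
      LinearMap.toMatrix' f.toLinearMap * LinearMap.toMatrix' f'.toLinearMap = 1 := by
    intro f f' hff
    rw [← LinearMap.toMatrix'_comp, ← LinearMap.toMatrix'_id]
    exact congrArg _ (LinearMap.ext hff)
  let t : GLn h F := ⟨LinearMap.toMatrix' ψ.toLinearMap, LinearMap.toMatrix' ψ.symm.toLinearMap,
    hψinv _ _ ψ.apply_symm_apply, hψinv _ _ ψ.symm_apply_apply⟩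
  refine ⟨t, fun a => Matrix.ext_of_mulVec_single fun i => ?_, ?_⟩
  · rw [← Matrix.mulVec_mulVec, ← Matrix.mulVec_mulVec]
    exact (hm _ _).trans ((hψe _ _).trans (congrArg _ (hm _ _).symm))
  · ext v
    rw [mem_latticeOf_mul, ← hψ]
    have : ((t⁻¹ : GLn h F) : Mat h F) *ᵥ v = ψ.symm v := hm _ _
    rw [this, LinearEquiv.apply_symm_apply]

end Lattices

section Generators
variable {F : Type*} [Field F] [ValuativeRel F] {A B : Type*} [CommRing A] [Algebra F A]
  [CommRing B] [Algebra F B] {h : ℕ}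

/-- `ζ` and its conjugate `ζ'` have trace `T` and norm `N`, and `ζ` generates the ring of
integers. -/
structure IsIntegralGenerator (ζ ζ' : A) (T N : 𝒪[F]) : Prop where
  add : ζ + ζ' = algebraMap 𝒪[F] A T
  mul : ζ * ζ' = algebraMap 𝒪[F] A N
  adjoin : Algebra.adjoin 𝒪[F] {ζ} = integralClosure 𝒪[F] A

namespace IsIntegralGenerator
variable {ζ ζ' : A} {T N : 𝒪[F]}

lemma mem_stabilizerAlgebra (hζ : IsIntegralGenerator ζ ζ' T N) {e : A →ₐ[F] Mat h F}
    {Λ : Submodule 𝒪[F] (Fin (2 * h) → F)} (hΛ : e ζ ∈ stabilizerAlgebra Λ) {a : A}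
    (ha : IsIntegral 𝒪[F] a) : e a ∈ stabilizerAlgebra Λ := by
  have h1 : Algebra.adjoin 𝒪[F] {ζ} ≤ (stabilizerAlgebra Λ).comap (e.restrictScalars 𝒪[F]) :=
    Algebra.adjoin_le (Set.singleton_subset_iff.2 hΛ)
  rw [hζ.adjoin] at h1
  exact h1 ha

/-- Commuting with ζ gives commuting with all integral elements, and every element of `A` becomes
integral after a nonzero scaling from 𝒪_F. -/
lemma commute [Module.Finite F A] (hζ : IsIntegralGenerator ζ ζ' T N) {e : A →ₐ[F] Mat h F}
    {m : Mat h F} (hm : m * e ζ = e ζ * m) (a : A) : m * e a = e a * m := by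
  have h1 : Algebra.adjoin 𝒪[F] {ζ} ≤
      (Subalgebra.centralizer 𝒪[F] {m}).comap (e.restrictScalars 𝒪[F]) := by
    refine Algebra.adjoin_le (Set.singleton_subset_iff.2 ?_)
    exact (Subalgebra.mem_centralizer_iff 𝒪[F]).2 fun g hg => by rwa [Set.mem_singleton_iff.1 hg]
  rw [hζ.adjoin] at h1
  obtain ⟨r, hr, hra⟩ := exists_smul_isIntegral (F := F) a
  have h2 := (Subalgebra.mem_centralizer_iff 𝒪[F]).1 (h1 hra) m rfl
  have h3 : e (r • a) = (r : F) • e a := map_smul e (r : F) a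
  have h4 : m * e (r • a) = e (r • a) * m := h2
  rw [h3, mul_smul_comm, smul_mul_assoc] at h4
  have hr' : (r : F) ≠ 0 := fun h => hr (Subtype.ext h)
  exact smul_right_injective _ hr' h4

lemma map_add_eq (hζ : IsIntegralGenerator ζ ζ' T N) (e : A →ₐ[F] Mat h F) :
    e ζ + e ζ' = (T : F) • (1 : Mat h F) := by
  rw [← map_add, hζ.add, IsScalarTower.algebraMap_apply 𝒪[F] F A, AlgHom.commutes,
    Algebra.algebraMap_eq_smul_one]
  rfl

lemma map_mul_eq (hζ : IsIntegralGenerator ζ ζ' T N) (e : A →ₐ[F] Mat h F) :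
    e ζ * e ζ' = (N : F) • (1 : Mat h F) := by
  rw [← map_mul, hζ.mul, IsScalarTower.algebraMap_apply 𝒪[F] F A, AlgHom.commutes,
    Algebra.algebraMap_eq_smul_one]
  rfl

end IsIntegralGenerator
end Generators

/-! ### The correspondence Λ = M ⊕ ζM -/

section FrameLattice
variable {F : Type*} [Field F] [ValuativeRel F] {h : ℕ} {ζ ϖ z' w : Mat h F}
  {v₀ : Fin (2 * h) → F}

/-- The intersection of a lattice in `F^{2h}` with the first copy of `F[𝐰]`. -/
noncomputable def frameLattice (ζ w : Mat h F) (v₀ : Fin (2 * h) → F)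
    (Λ : Submodule 𝒪[F] (Fin (2 * h) → F)) : Submodule 𝒪[F] (AdjoinRoot (minpoly F w)) :=
  Λ.comap (((frameMap ζ w v₀).comp (LinearMap.inl F _ _)).restrictScalars 𝒪[F])

lemma mem_frameLattice {Λ : Submodule 𝒪[F] (Fin (2 * h) → F)} {x : AdjoinRoot (minpoly F w)} :
    x ∈ frameLattice ζ w v₀ Λ ↔ frameMap ζ w v₀ (x, 0) ∈ Λ := Iff.rfl

lemma exists_smul_mem_frameLattice {Λ : Submodule 𝒪[F] (Fin (2 * h) → F)}
    (hspan : ∀ v, ∃ r : 𝒪[F], r ≠ 0 ∧ r • v ∈ Λ)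
    (x : AdjoinRoot (minpoly F w)) : ∃ r : 𝒪[F], r ≠ 0 ∧ r • x ∈ frameLattice ζ w v₀ Λ := by
  obtain ⟨r, hr, h⟩ := hspan (frameMap ζ w v₀ (x, 0))
  refine ⟨r, hr, ?_⟩
  rw [frameLattice, Submodule.mem_comap, map_smul]
  exact h

namespace IsLatticeFrame
variable (H : IsLatticeFrame ζ ϖ z' w v₀)
include H

lemma frameMap_mul (u x y : AdjoinRoot (minpoly F w)) :
    frameMap ζ w v₀ (u * x, u * y) = polyAction w u *ᵥ frameMap ζ w v₀ (x, y) := by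
  simp only [frameMap_apply]
  rw [map_mul, map_mul, Matrix.mulVec_add, ← Matrix.mulVec_mulVec, ← Matrix.mulVec_mulVec,
    Matrix.mulVec_mulVec _ ζ, H.comm_ζ, ← Matrix.mulVec_mulVec]

variable {Λ Λ' : Submodule 𝒪[F] (Fin (2 * h) → F)}

lemma frameMap_mem_iff (h1 : ζ ∈ stabilizerAlgebra Λ) (h2 : ϖ ∈ stabilizerAlgebra Λ)
    (x y : AdjoinRoot (minpoly F w)) :
    frameMap ζ w v₀ (x, y) ∈ Λ ↔ x ∈ frameLattice ζ w v₀ Λ ∧ y ∈ frameLattice ζ w v₀ Λ := by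
  obtain ⟨M, -, hM⟩ := (H.stable_iff Λ).1 ⟨h1, h2⟩
  simp only [mem_frameLattice, hM, M.zero_mem, and_true]

lemma root_mul_mem (h1 : ζ ∈ stabilizerAlgebra Λ) (h2 : ϖ ∈ stabilizerAlgebra Λ)
    {x : AdjoinRoot (minpoly F w)} (hx : x ∈ frameLattice ζ w v₀ Λ) :
    AdjoinRoot.root (minpoly F w) * x ∈ frameLattice ζ w v₀ Λ := by
  obtain ⟨M, hθ, hM⟩ := (H.stable_iff Λ).1 ⟨h1, h2⟩
  simp only [mem_frameLattice, hM, M.zero_mem, and_true] at hx ⊢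
  exact hθ x hx

lemma eq_of_frameLattice_eq (h1 : ζ ∈ stabilizerAlgebra Λ) (h2 : ϖ ∈ stabilizerAlgebra Λ)
    (h1' : ζ ∈ stabilizerAlgebra Λ') (h2' : ϖ ∈ stabilizerAlgebra Λ')
    (hM : frameLattice ζ w v₀ Λ = frameLattice ζ w v₀ Λ') : Λ = Λ' := by
  ext v
  obtain ⟨⟨x, y⟩, rfl⟩ := H.bijective.2 v
  rw [H.frameMap_mem_iff h1 h2, H.frameMap_mem_iff h1' h2', hM]

/-- The lattice is M ⊕ ζM in the coordinates of the frame; `stable_iff` provides its stability. -/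
lemma exists_frameLattice_eq {M : Submodule 𝒪[F] (AdjoinRoot (minpoly F w))} (hfg : M.FG)
    (hspan : ∀ x, ∃ r : 𝒪[F], r ≠ 0 ∧ r • x ∈ M)
    (hθ : ∀ x ∈ M, AdjoinRoot.root (minpoly F w) * x ∈ M) :
    ∃ Λ : Submodule 𝒪[F] (Fin (2 * h) → F), Λ.FG ∧ (∀ v, ∃ r : 𝒪[F], r ≠ 0 ∧ r • v ∈ Λ) ∧
      ζ ∈ stabilizerAlgebra Λ ∧ ϖ ∈ stabilizerAlgebra Λ ∧ frameLattice ζ w v₀ Λ = M := by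
  set Λ := (M.prod M).map ((frameMap ζ w v₀).restrictScalars 𝒪[F]) with hΛ
  have hmem : ∀ x y, frameMap ζ w v₀ (x, y) ∈ Λ ↔ x ∈ M ∧ y ∈ M := by
    intro x y
    constructor
    · rintro ⟨q, hq, hqe⟩
      obtain rfl : q = (x, y) := H.bijective.1 hqe
      exact hq
    · intro h
      exact ⟨(x, y), h, rfl⟩
  obtain ⟨h1, h2⟩ := (H.stable_iff Λ).2 ⟨M, hθ, hmem⟩
  refine ⟨Λ, (hfg.prod hfg).map _, fun v => ?_, h1, h2, ?_⟩
  · obtain ⟨⟨x, y⟩, rfl⟩ := H.bijective.2 v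
    obtain ⟨r, hr, hx⟩ := hspan x
    obtain ⟨s, hs, hy⟩ := hspan y
    refine ⟨r * s, mul_ne_zero hr hs, ?_⟩
    have : (r * s) • frameMap ζ w v₀ (x, y) = frameMap ζ w v₀ ((r * s) • x, (r * s) • y) :=
      (map_smul ((frameMap ζ w v₀).restrictScalars 𝒪[F]) (r * s) (x, y)).symm
    rw [this, hmem]
    refine ⟨?_, ?_⟩
    · rw [mul_comm r s, mul_smul]
      exact M.smul_mem s hx
    · rw [mul_smul]
      exact M.smul_mem r hy
  · ext x
    rw [mem_frameLattice, hmem]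
    exact and_iff_left M.zero_mem

lemma fg_frameLattice [TopologicalSpace F] [IsNonarchimedeanLocalField F] (hfg : Λ.FG) :
    (frameLattice ζ w v₀ Λ).FG := by
  set f := ((frameMap ζ w v₀).comp (LinearMap.inl F _ _)).restrictScalars 𝒪[F] with hf
  have hinj : Function.Injective f := fun x y hxy =>
    congrArg Prod.fst (H.bijective.1 hxy)
  refine Submodule.fg_of_fg_map_injective f hinj ?_
  have : IsNoetherian 𝒪[F] Λ := isNoetherian_of_fg_of_noetherian Λ hfg
  exact Submodule.FG.of_le hfg (Submodule.map_comap_le _ _)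

end IsLatticeFrame
end FrameLattice

/-! ### The common setting for α and β -/

section Pairs
variable {F A B : Type*} [Field F] [ValuativeRel F] [CommRing A] [Algebra F A] [CommRing B]
  [Algebra F B] {h : ℕ}

/-- A regular semisimple pair over integral generators, conjugate to an integral pair, for which `𝐳`
and its inverse `z'` are integral. -/
structure IsUnitPair (p r : EmbeddingPair F A B h) (g₁ g₂ : GLn h F) (ζ ζ' : A) (ϖ ϖ' : B)
    (T N t n : 𝒪[F]) (z' : Mat h F) : Prop where
  conj : p.IsConjOf r g₁ g₂
  integral : r.IsIntegralPair
  gen₁ : IsIntegralGenerator ζ ζ' T N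
  gen₂ : IsIntegralGenerator ϖ ϖ' t n
  isUnit_disc : IsUnit (T ^ 2 - 4 * N)
  regular : p.IsRegularSemisimple ζ ζ' ϖ ϖ'
  z_mul : p.z ζ ϖ * z' = 1
  isIntegral_z : IsIntegral 𝒪[F] (p.z ζ ϖ)
  isIntegral_inv : IsIntegral 𝒪[F] z'

namespace IsUnitPair
variable {p r : EmbeddingPair F A B h} {g₁ g₂ : GLn h F} {ζ ζ' : A} {ϖ ϖ' : B} {T N t n : 𝒪[F]}
  {z' : Mat h F} (S : IsUnitPair p r g₁ g₂ ζ ζ' ϖ ϖ' T N t n z')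
include S

lemma exists_isLatticeFrame [TopologicalSpace F] [IsNonarchimedeanLocalField F] [Nontrivial A] :
    ∃ v₀, IsLatticeFrame (p.e₁ ζ) (p.e₂ ϖ) z' (p.w ζ ζ' ϖ ϖ') v₀ :=
  BiquadraticFL.exists_isLatticeFrame
    ⟨S.gen₁.map_add_eq p.e₁, S.gen₁.map_mul_eq p.e₁, S.gen₂.map_add_eq p.e₂, S.gen₂.map_mul_eq p.e₂⟩
    S.isUnit_disc rfl rfl S.z_mul S.isIntegral_z S.isIntegral_inv S.regular.minpoly_w.1

/-- Counting dimensions in the frame gives 2 deg = 2h, so the minimal polynomial of `𝐰` has degree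
exactly h. In that degree regular semisimplicity makes it separable. -/
lemma formallyUnramified [TopologicalSpace F] [IsNonarchimedeanLocalField F] [Nontrivial A] :
    Algebra.FormallyUnramified F (AdjoinRoot (minpoly F (p.w ζ ζ' ϖ ϖ'))) := by
  obtain ⟨v₀, H⟩ := S.exists_isLatticeFrame
  refine formallyUnramified_adjoinRoot (S.regular.minpoly_w.2 ?_)
  set w := p.w ζ ζ' ϖ ϖ'
  have hw : IsIntegral F w := Algebra.IsIntegral.isIntegral w
  have h1 := (LinearEquiv.ofBijective _ H.bijective).finrank_eq
  let pb := AdjoinRoot.powerBasis (minpoly.ne_zero hw)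
  have : Module.Finite F (AdjoinRoot (minpoly F w)) := pb.finite
  rw [Module.finrank_prod, Module.finrank_fin_fun, pb.finrank, AdjoinRoot.powerBasis_dim] at h1
  omega

end IsUnitPair
end Pairs

/-! ### Centralizers acting on stable lattices, and the torus L^× -/

section Orbits
variable {F A B : Type*} [Field F] [CommRing A] [Algebra F A] [CommRing B] [Algebra F B] {h : ℕ}

lemma commute_conj_iff {e e' : A →ₐ[F] Mat h F} {g : GLn h F}
    (hconj : ∀ a, e a = (g : Mat h F) * e' a * ((g⁻¹ : GLn h F) : Mat h F)) (x : GLn h F) (a : A) :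
    (x : Mat h F) * e' a = e' a * x ↔ ((g * x * g⁻¹ : GLn h F) : Mat h F) * e a =
      e a * ((g * x * g⁻¹ : GLn h F) : Mat h F) := by
  have h1 : ((g * x * g⁻¹ : GLn h F) : Mat h F) * e a =
      g * ((x : Mat h F) * e' a) * ((g⁻¹ : GLn h F) : Mat h F) := by
    calc _ = (g : Mat h F) * x * (((g⁻¹ : GLn h F) : Mat h F) * (g : Mat h F)) * e' a *
            ((g⁻¹ : GLn h F) : Mat h F) := by
          rw [hconj, Units.val_mul, Units.val_mul]
          simp only [mul_assoc]
      _ = _ := by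
          rw [Units.inv_mul, mul_one]
          simp only [mul_assoc]
  have h2 : e a * ((g * x * g⁻¹ : GLn h F) : Mat h F) =
      g * (e' a * (x : Mat h F)) * ((g⁻¹ : GLn h F) : Mat h F) := by
    calc _ = (g : Mat h F) * e' a * (((g⁻¹ : GLn h F) : Mat h F) * (g : Mat h F)) * x *
            ((g⁻¹ : GLn h F) : Mat h F) := by
          rw [hconj, Units.val_mul, Units.val_mul]
          simp only [mul_assoc]
      _ = _ := by
          rw [Units.inv_mul, mul_one]
          simp only [mul_assoc]
  rw [h1, h2, Units.mul_left_inj, Units.mul_right_inj]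

variable [ValuativeRel F]

lemma mem_stabilizerAlgebra_of_conj {e e' : A →ₐ[F] Mat h F} {g : GLn h F}
    (hconj : ∀ a, e a = (g : Mat h F) * e' a * ((g⁻¹ : GLn h F) : Mat h F))
    (hint : ∀ a, IsIntegral 𝒪[F] a → ∀ i j, e' a i j ∈ 𝒪[F]) (x : centralizerGL e') {a : A}
    (ha : IsIntegral 𝒪[F] a) : e a ∈ stabilizerAlgebra (latticeOf (g * (x : GLn h F))) := by
  rw [mem_stabilizerAlgebra_latticeOf]
  have hx : ((x : GLn h F) : Mat h F) * e' a = e' a * (x : GLn h F) := x.2 a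
  have : (((g * x)⁻¹ : GLn h F) : Mat h F) * e a * ((g * x : GLn h F) : Mat h F) = e' a := by
    calc (((g * x)⁻¹ : GLn h F) : Mat h F) * e a * ((g * x : GLn h F) : Mat h F)
        = (((x : GLn h F)⁻¹ : GLn h F) : Mat h F) * (((g⁻¹ : GLn h F) : Mat h F) * (g : Mat h F)) *
            e' a * (((g⁻¹ : GLn h F) : Mat h F) * (g : Mat h F)) * (x : GLn h F) := by
          rw [hconj, mul_inv_rev, Units.val_mul, Units.val_mul]
          simp only [mul_assoc]
      _ = e' a := by
          rw [Units.inv_mul, mul_one, mul_one, mul_assoc, ← hx, ← mul_assoc, Units.inv_mul, one_mul]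
  rw [this]
  exact hint a ha

variable [TopologicalSpace F] [IsNonarchimedeanLocalField F] in
/-- The centralizer of an embedding acts transitively on the stable lattices. -/
lemma exists_latticeOf_mul_eq [Module.Finite F A] [Algebra.FormallyUnramified F A]
    {e e' : A →ₐ[F] Mat h F} (he : IsFreeEmbedding e) {g : GLn h F}
    (hconj : ∀ a, e a = (g : Mat h F) * e' a * ((g⁻¹ : GLn h F) : Mat h F))
    (hint : ∀ a, IsIntegral 𝒪[F] a → ∀ i j, e' a i j ∈ 𝒪[F])
    {Λ : Submodule 𝒪[F] (Fin (2 * h) → F)} (hfg : Λ.FG)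
    (hspan : ∀ v, ∃ r : 𝒪[F], r ≠ 0 ∧ r • v ∈ Λ)
    (hstab : ∀ a, IsIntegral 𝒪[F] a → e a ∈ stabilizerAlgebra Λ) :
    ∃ x : centralizerGL e', latticeOf (g * (x : GLn h F)) = Λ := by
  obtain ⟨t, ht, rfl⟩ := exists_centralizer_latticeOf_eq he (g := g) (fun a ha => by
    have := mem_stabilizerAlgebra_of_conj hconj hint 1 ha
    rwa [Subgroup.coe_one, mul_one] at this) hfg hspan hstab
  have hg : g * (g⁻¹ * t * g) * g⁻¹ = t := by group
  refine ⟨⟨g⁻¹ * t * g, fun a => ?_⟩, ?_⟩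
  · rw [commute_conj_iff hconj, hg]
    exact ht a
  · congr 1
    group

/-- The group `L^×` fixing both embeddings of a pair is the group of units of `F[𝐰]`. -/
lemma exists_unitsHom [Module.Finite F A] [Module.Finite F B] {p r : EmbeddingPair F A B h}
    {g₁ g₂ : GLn h F} (hconj : p.IsConjOf r g₁ g₂) {ζ ζ' : A} {ϖ ϖ' : B} {T N t n : 𝒪[F]}
    (hζ : IsIntegralGenerator ζ ζ' T N) (hϖ : IsIntegralGenerator ϖ ϖ' t n) {z' w : Mat h F}
    {v₀ : Fin (2 * h) → F} (H : IsLatticeFrame (p.e₁ ζ) (p.e₂ ϖ) z' w v₀) :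
    ∃ Φ : stabilizerL r g₁ g₂ →* (AdjoinRoot (minpoly F w))ˣ, Function.Surjective Φ ∧
      ∀ n, ((g₁ * (n.1.1 : GLn h F) * g₁⁻¹ : GLn h F) : Mat h F) =
        polyAction (F := F) w (Φ n : AdjoinRoot (minpoly F w)) := by
  have hinj := polyAction_injective (F := F) w
  have hex : ∀ n : stabilizerL r g₁ g₂, ∃ x,
      ((g₁ * (n.1.1 : GLn h F) * g₁⁻¹ : GLn h F) : Mat h F) = polyAction (F := F) w x := by
    intro n
    -- The conjugates by g₁ and g₂ of the two components agree, so this one matrix commutes with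
    -- both embeddings.
    refine H.commutant _ ((commute_conj_iff hconj.1 _ _).1 (n.1.1.2 ζ)) ?_
    have h2 := (commute_conj_iff hconj.2 _ _).1 (n.1.2.2 ϖ)
    rwa [← show g₁ * (n.1.1 : GLn h F) * g₁⁻¹ = g₂ * (n.1.2 : GLn h F) * g₂⁻¹ from n.2] at h2
  choose φ hφ using hex
  let Φ₀ : stabilizerL r g₁ g₂ →* AdjoinRoot (minpoly F w) :=
    { toFun := φ
      map_one' := hinj (by rw [← hφ]; simp)
      map_mul' := fun m n => hinj (by
        rw [map_mul, ← hφ, ← hφ, ← hφ, ← Units.val_mul]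
        congr 1
        simp [mul_assoc]) }
  refine ⟨Φ₀.toHomUnits, fun u => ?_, fun n => hφ n⟩
  let U : GLn h F := Units.map (polyAction (F := F) w : _ →* Mat h F) u
  have hg : ∀ g : GLn h F, g * (g⁻¹ * U * g) * g⁻¹ = U := fun g => by group
  have hU₁ : g₁⁻¹ * U * g₁ ∈ centralizerGL r.e₁ := fun a => by
    rw [commute_conj_iff hconj.1, hg]
    exact hζ.commute (H.comm_ζ _).symm a
  have hU₂ : g₂⁻¹ * U * g₂ ∈ centralizerGL r.e₂ := fun a => by
    rw [commute_conj_iff hconj.2, hg]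
    exact hϖ.commute (H.comm_ϖ _).symm a
  refine ⟨⟨(⟨_, hU₁⟩, ⟨_, hU₂⟩), (hg g₁).trans (hg g₂).symm⟩, Units.ext (hinj ?_)⟩
  refine (hφ _).symm.trans ?_
  exact congrArg Units.val (hg g₁)

end Orbits

/-! ### Measure-theoretic preliminaries on subgroups and products -/

section Haar
open MeasureTheory

/-- Translates of one neighbourhood of finite measure make the measure locally finite, and second
countability does the rest; local compactness of the group is not needed. -/
lemma sigmaFinite_of_mem_nhds {G : Type*} [Group G] [TopologicalSpace G] [ContinuousMul G]
    [SecondCountableTopology G] [MeasurableSpace G] [MeasurableMul G] (μ : Measure G)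
    [μ.IsMulLeftInvariant] {U : Set G} (hU : U ∈ nhds (1 : G)) (hμ : μ U ≠ ⊤) : SigmaFinite μ := by
  have : IsLocallyFiniteMeasure μ := by
    refine ⟨fun x => ⟨(fun y => x⁻¹ * y) ⁻¹' U, ?_, ?_⟩⟩
    · refine (continuous_const_mul x⁻¹).continuousAt.preimage_mem_nhds ?_
      rwa [inv_mul_cancel]
    · rw [measure_preimage_mul]
      exact hμ.lt_top
  infer_instance

lemma measurableMul₂_subgroup {G : Type*} [Group G] [MeasurableSpace G] [MeasurableMul₂ G]
    (H : Subgroup G) : MeasurableMul₂ H :=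
  ⟨((measurable_subtype_coe.comp measurable_fst).mul
    (measurable_subtype_coe.comp measurable_snd)).subtype_mk⟩

lemma measurableInv_subgroup {G : Type*} [Group G] [MeasurableSpace G] [MeasurableInv G]
    (H : Subgroup G) : MeasurableInv H :=
  ⟨measurable_subtype_coe.inv.subtype_mk⟩

lemma measurableMul₂_prod {G H : Type*} [Group G] [MeasurableSpace G] [MeasurableMul₂ G]
    [Group H] [MeasurableSpace H] [MeasurableMul₂ H] : MeasurableMul₂ (G × H) :=
  ⟨((measurable_fst.comp measurable_fst).mul (measurable_fst.comp measurable_snd)).prodMk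
    ((measurable_snd.comp measurable_fst).mul (measurable_snd.comp measurable_snd))⟩

lemma measurableInv_prod {G H : Type*} [Group G] [MeasurableSpace G] [MeasurableInv G]
    [Group H] [MeasurableSpace H] [MeasurableInv H] : MeasurableInv (G × H) :=
  ⟨measurable_fst.inv.prodMk measurable_snd.inv⟩

end Haar

section Integrality
variable {F : Type*} [Field F] [ValuativeRel F] {h : ℕ}

lemma isIntegral_of_mem_GLO {g : GLn h F} (hg : g ∈ GLO h F) : IsIntegral 𝒪[F] (g : Mat h F) := by
  obtain ⟨u, rfl⟩ := hg
  have h1 : IsIntegral 𝒪[F] (u : Matrix (Fin (2 * h)) (Fin (2 * h)) 𝒪[F]) :=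
    Algebra.IsIntegral.isIntegral _
  exact h1.map (Algebra.ofId 𝒪[F] F).mapMatrix

lemma isIntegral_conj_iff (g : GLn h F) (m : Mat h F) :
    IsIntegral 𝒪[F] ((g : Mat h F) * m * ((g⁻¹ : GLn h F) : Mat h F)) ↔ IsIntegral 𝒪[F] m := by
  have key : ∀ (g : GLn h F) (m : Mat h F), IsIntegral 𝒪[F] m →
      IsIntegral 𝒪[F] ((g : Mat h F) * m * ((g⁻¹ : GLn h F) : Mat h F)) := by
    intro g m hm
    exact hm.map (MulSemiringAction.toAlgHom 𝒪[F] (Mat h F) (ConjAct.toConjAct g))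
  refine ⟨fun h => ?_, key g m⟩
  have := key g⁻¹ _ h
  rwa [inv_inv, ← mul_assoc, ← mul_assoc, Units.inv_mul, one_mul, mul_assoc, Units.inv_mul,
    mul_one] at this

end Integrality

/-! ### The support of the orbital integral -/

section OrbitSupport
variable {F A B : Type*} [Field F] [ValuativeRel F] [CommRing A] [Algebra F A] [CommRing B]
  [Algebra F B] {h : ℕ}

/-- The pairs `(h₁, h₂)` with `g₁ h₁ 𝒪_F^{2h} = g₂ h₂ 𝒪_F^{2h}`. -/
def orbitSupport (r : EmbeddingPair F A B h) (g₁ g₂ : GLn h F) :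
    Set (centralizerGL r.e₁ × centralizerGL r.e₂) :=
  {x | latticeOf (g₁ * (x.1 : GLn h F)) = latticeOf (g₂ * (x.2 : GLn h F))}

variable {p r : EmbeddingPair F A B h} {g₁ g₂ : GLn h F}

lemma mem_orbitSupport {x : centralizerGL r.e₁ × centralizerGL r.e₂} :
    x ∈ orbitSupport r g₁ g₂ ↔
      latticeOf (g₁ * (x.1 : GLn h F)) = latticeOf (g₂ * (x.2 : GLn h F)) := Iff.rfl

lemma mem_orbitSupport_iff {x : centralizerGL r.e₁ × centralizerGL r.e₂} :
    x ∈ orbitSupport r g₁ g₂ ↔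
      (x.1 : GLn h F)⁻¹ * g₁⁻¹ * g₂ * (x.2 : GLn h F) ∈ GLO h F := by
  rw [mem_orbitSupport, latticeOf_eq_iff]
  simp only [mul_inv_rev, mul_assoc]

lemma latticeOf_mul_eq_iff (l g g' : GLn h F) :
    latticeOf (l * g) = latticeOf (l * g') ↔ latticeOf g = latticeOf g' := by
  rw [latticeOf_eq_iff, latticeOf_eq_iff, show (l * g)⁻¹ * (l * g') = g⁻¹ * g' by group]

lemma mul_mem_orbitSupport_iff (n : stabilizerL r g₁ g₂)
    (x : centralizerGL r.e₁ × centralizerGL r.e₂) :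
    (n : centralizerGL r.e₁ × centralizerGL r.e₂) * x ∈ orbitSupport r g₁ g₂ ↔
      x ∈ orbitSupport r g₁ g₂ := by
  have hn : g₁ * (n.1.1 : GLn h F) * g₁⁻¹ = g₂ * (n.1.2 : GLn h F) * g₂⁻¹ := n.2
  have e₁ : g₁ * ((n.1 * x).1 : GLn h F) = g₁ * (n.1.1 : GLn h F) * g₁⁻¹ * (g₁ * x.1) := by
    rw [Prod.fst_mul, Subgroup.coe_mul]; group
  have e₂ : g₂ * ((n.1 * x).2 : GLn h F) = g₂ * (n.1.2 : GLn h F) * g₂⁻¹ * (g₂ * x.2) := by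
    rw [Prod.snd_mul, Subgroup.coe_mul]; group
  rw [mem_orbitSupport, mem_orbitSupport, e₁, e₂, hn, latticeOf_mul_eq_iff]

/-- The support is a union of L^×-orbits, so the choice of representatives by `out` is harmless. -/
lemma mk_preimage_orbitSupport : Quotient.mk (QuotientGroup.rightRel (stabilizerL r g₁ g₂)) ⁻¹'
    {x | x.out ∈ orbitSupport r g₁ g₂} = orbitSupport r g₁ g₂ := by
  ext g
  have h1 : g * ((Quotient.mk (QuotientGroup.rightRel (stabilizerL r g₁ g₂)) g).out)⁻¹ ∈
      stabilizerL r g₁ g₂ := QuotientGroup.rightRel_apply.1 (Quotient.mk_out g)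
  rw [← mul_mem_orbitSupport_iff ⟨_, h1⟩⁻¹ g]
  simp

namespace IsUnitPair
variable {ζ ζ' : A} {ϖ ϖ' : B} {T N t n : 𝒪[F]}
  {z' : Mat h F} (S : IsUnitPair p r g₁ g₂ ζ ζ' ϖ ϖ' T N t n z')
include S

/-- The lattice attached to a point of the support has two descriptions, through g₁h₁ and through
g₂h₂. The first gives stability under ζ, the second under ϖ. -/
lemma mem_stabilizerAlgebra {x : centralizerGL r.e₁ × centralizerGL r.e₂}
    (hx : x ∈ orbitSupport r g₁ g₂) :
    p.e₁ ζ ∈ stabilizerAlgebra (latticeOf (g₁ * (x.1 : GLn h F))) ∧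
      p.e₂ ϖ ∈ stabilizerAlgebra (latticeOf (g₁ * (x.1 : GLn h F))) := by
  have h1 : IsIntegral 𝒪[F] ζ := by
    have : ζ ∈ Algebra.adjoin 𝒪[F] {ζ} := Algebra.self_mem_adjoin_singleton _ _
    rwa [S.gen₁.adjoin] at this
  have h2 : IsIntegral 𝒪[F] ϖ := by
    have : ϖ ∈ Algebra.adjoin 𝒪[F] {ϖ} := Algebra.self_mem_adjoin_singleton _ _
    rwa [S.gen₂.adjoin] at this
  refine ⟨mem_stabilizerAlgebra_of_conj S.conj.1 S.integral.1 x.1 h1, ?_⟩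
  rw [mem_orbitSupport.1 hx]
  exact mem_stabilizerAlgebra_of_conj S.conj.2 S.integral.2 x.2 h2

end IsUnitPair
end OrbitSupport

/-! ### Points of the support and primitive lattices -/

section Count
open MeasureTheory
lemma finite_adjoinRoot_minpoly {F : Type*} [Field F] {h : ℕ} (w : Mat h F) : Module.Finite F (AdjoinRoot (minpoly F w)) :=
  (AdjoinRoot.powerBasis (minpoly.ne_zero (Algebra.IsIntegral.isIntegral w))).finite

variable {F A B : Type*} [Field F] [ValuativeRel F] [CommRing A] [Algebra F A] [CommRing B]
  [Algebra F B] {h : ℕ} {p r : EmbeddingPair F A B h} {g₁ g₂ : GLn h F} {ζ ζ' : A} {ϖ ϖ' : B}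
  {T N t n : 𝒪[F]} {z' : Mat h F}

/-- The action of `L^×` on the lattices in `L`. -/
lemma frameLattice_mul (n : stabilizerL r g₁ g₂) (x : centralizerGL r.e₁ × centralizerGL r.e₂)
    {ξ ϖ₁ w : Mat h F} {v₀ : Fin (2 * h) → F} (H : IsLatticeFrame ξ ϖ₁ z' w v₀)
    {u : (AdjoinRoot (minpoly F w))ˣ}
    (hu : ((g₁ * (n.1.1 : GLn h F) * g₁⁻¹ : GLn h F) : Mat h F) =
      polyAction (F := F) w (u : AdjoinRoot (minpoly F w))) :
    frameLattice ξ w v₀ (latticeOf (g₁ * ((n.1 * x).1 : GLn h F))) =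
      (frameLattice ξ w v₀ (latticeOf (g₁ * (x.1 : GLn h F)))).map
        (LinearMap.mulLeft 𝒪[F] (u : AdjoinRoot (minpoly F w))) := by
  have e₁ : g₁ * ((n.1 * x).1 : GLn h F) = g₁ * (n.1.1 : GLn h F) * g₁⁻¹ * (g₁ * x.1) := by
    rw [Prod.fst_mul, Subgroup.coe_mul]; group
  have hu' : (((g₁ * (n.1.1 : GLn h F) * g₁⁻¹)⁻¹ : GLn h F) : Mat h F) =
      polyAction (F := F) w ((u⁻¹ : (AdjoinRoot (minpoly F w))ˣ) : AdjoinRoot (minpoly F w)) := by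
    have h1 : g₁ * (n.1.1 : GLn h F) * g₁⁻¹ = Units.map (polyAction (F := F) w : _ →* Mat h F) u :=
      Units.ext hu
    rw [h1, ← map_inv]
    rfl
  have key : ∀ y, y ∈ frameLattice ξ w v₀ (latticeOf (g₁ * ((n.1 * x).1 : GLn h F))) ↔
      ((u⁻¹ : (AdjoinRoot (minpoly F w))ˣ) : AdjoinRoot (minpoly F w)) * y ∈
        frameLattice ξ w v₀ (latticeOf (g₁ * (x.1 : GLn h F))) := fun y => by
    rw [mem_frameLattice, mem_frameLattice, e₁, mem_latticeOf_mul, hu', ← H.frameMap_mul, mul_zero]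
  ext y
  rw [key, Submodule.mem_map]
  constructor
  · intro hy
    exact ⟨_, hy, by simp⟩
  · rintro ⟨y, hy, rfl⟩
    simpa using hy

lemma mem_integralUnitsL_iff (n : stabilizerL r g₁ g₂) {w : Mat h F}
    {u : (AdjoinRoot (minpoly F w))ˣ}
    (hu : ((g₁ * (n.1.1 : GLn h F) * g₁⁻¹ : GLn h F) : Mat h F) =
      polyAction (F := F) w (u : AdjoinRoot (minpoly F w))) :
    n ∈ integralUnitsL r g₁ g₂ ↔ IsIntegral 𝒪[F] (u : AdjoinRoot (minpoly F w)) ∧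
      IsIntegral 𝒪[F] ((u⁻¹ : (AdjoinRoot (minpoly F w))ˣ) : AdjoinRoot (minpoly F w)) := by
  have hu' : ((g₁ * (n.1.1 : GLn h F)⁻¹ * g₁⁻¹ : GLn h F) : Mat h F) =
      polyAction (F := F) w ((u⁻¹ : (AdjoinRoot (minpoly F w))ˣ) : AdjoinRoot (minpoly F w)) := by
    have h1 : g₁ * (n.1.1 : GLn h F) * g₁⁻¹ = Units.map (polyAction (F := F) w : _ →* Mat h F) u :=
      Units.ext hu
    have h2 : g₁ * (n.1.1 : GLn h F)⁻¹ * g₁⁻¹ = (g₁ * (n.1.1 : GLn h F) * g₁⁻¹)⁻¹ := by group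
    rw [h2, h1, ← map_inv]
    rfl
  have hi : ∀ x : AdjoinRoot (minpoly F w),
      IsIntegral 𝒪[F] (polyAction (F := F) w x) ↔ IsIntegral 𝒪[F] x := fun x =>
    isIntegral_algHom_iff ((polyAction (F := F) w).restrictScalars 𝒪[F]) (polyAction_injective w)
  rw [← hi, ← hi, ← hu, ← hu', Units.val_mul, Units.val_mul, Units.val_mul, Units.val_mul,
    isIntegral_conj_iff, isIntegral_conj_iff]
  rfl

namespace IsUnitPair
variable (S : IsUnitPair p r g₁ g₂ ζ ζ' ϖ ϖ' T N t n z')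
include S

/-- The two points of the support of the orbital integral that belong to the same lattice differ by
an element of the maximal compact subgroup. -/
lemma frameLattice_eq_iff
    {v₀ : Fin (2 * h) → F} (H : IsLatticeFrame (p.e₁ ζ) (p.e₂ ϖ) z' (p.w ζ ζ' ϖ ϖ') v₀)
    {x : centralizerGL r.e₁ × centralizerGL r.e₂} (hx : x ∈ orbitSupport r g₁ g₂)
    (x' : centralizerGL r.e₁ × centralizerGL r.e₂) :
    (x' ∈ orbitSupport r g₁ g₂ ∧ frameLattice (p.e₁ ζ) (p.w ζ ζ' ϖ ϖ') v₀
        (latticeOf (g₁ * (x.1 : GLn h F))) = frameLattice (p.e₁ ζ) (p.w ζ ζ' ϖ ϖ') v₀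
        (latticeOf (g₁ * (x'.1 : GLn h F)))) ↔
      ((x⁻¹ * x').1 : GLn h F) ∈ GLO h F ∧ ((x⁻¹ * x').2 : GLn h F) ∈ GLO h F := by
  have e₁ : ((x⁻¹ * x').1 : GLn h F) ∈ GLO h F ↔
      latticeOf (g₁ * (x.1 : GLn h F)) = latticeOf (g₁ * (x'.1 : GLn h F)) := by
    rw [latticeOf_mul_eq_iff, latticeOf_eq_iff]
    rfl
  have e₂ : ((x⁻¹ * x').2 : GLn h F) ∈ GLO h F ↔
      latticeOf (g₂ * (x.2 : GLn h F)) = latticeOf (g₂ * (x'.2 : GLn h F)) := by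
    rw [latticeOf_mul_eq_iff, latticeOf_eq_iff]
    rfl
  have hx0 := mem_orbitSupport.1 hx
  obtain ⟨h1, h2⟩ := S.mem_stabilizerAlgebra hx
  rw [e₁, e₂]
  constructor
  · rintro ⟨hx', hM⟩
    obtain ⟨h1', h2'⟩ := S.mem_stabilizerAlgebra hx'
    have h3 := H.eq_of_frameLattice_eq h1 h2 h1' h2' hM
    exact ⟨h3, hx0.symm.trans (h3.trans (mem_orbitSupport.1 hx'))⟩
  · rintro ⟨h3, h4⟩
    exact ⟨mem_orbitSupport.2 (h3.symm.trans (hx0.trans h4)), by rw [h3]⟩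

variable [TopologicalSpace F] [IsNonarchimedeanLocalField F] [Nontrivial A]

/-- All primitive lattices lie between c𝒪_L and 𝒪_L for a single nonzero c. -/
lemma finite_primitiveLattices : (primitiveLattices (p.w ζ ζ' ϖ ϖ')).Finite := by
  have := finite_adjoinRoot_minpoly (p.w ζ ζ' ϖ ϖ')
  have := S.formallyUnramified
  obtain ⟨c, hc, hcM⟩ := exists_smul_le_of_span_eq_one (F := F)
    (AdjoinRoot.adjoinRoot_eq_top (f := minpoly F (p.w ζ ζ' ϖ ϖ')))
  refine (finite_setOf_le_le (finite_integralClosure F (R := 𝒪[F])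
    (AdjoinRoot (minpoly F (p.w ζ ζ' ϖ ϖ')))) hc).subset fun M hM => ⟨le_of_span_eq_one hM.2, ?_⟩
  exact hcM M hM.1 hM.2

lemma fg_of_mem_primitiveLattices {M : Submodule 𝒪[F] (AdjoinRoot (minpoly F (p.w ζ ζ' ϖ ϖ')))}
    (hM : M ∈ primitiveLattices (p.w ζ ζ' ϖ ϖ')) :
    M.FG ∧ ∀ x, ∃ r : 𝒪[F], r ≠ 0 ∧ r • x ∈ M := by
  have := finite_adjoinRoot_minpoly (p.w ζ ζ' ϖ ϖ')
  have := S.formallyUnramified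
  have hO := finite_integralClosure F (R := 𝒪[F]) (AdjoinRoot (minpoly F (p.w ζ ζ' ϖ ϖ')))
  obtain ⟨c, hc, hcM⟩ := exists_smul_le_of_span_eq_one (F := F)
    (AdjoinRoot.adjoinRoot_eq_top (f := minpoly F (p.w ζ ζ' ϖ ϖ')))
  refine ⟨?_, fun x => ?_⟩
  · have : IsNoetherian 𝒪[F] (integralClosure 𝒪[F] (AdjoinRoot (minpoly F (p.w ζ ζ' ϖ ϖ')))).toSubmodule :=
      isNoetherian_of_fg_of_noetherian _ hO
    exact Submodule.FG.of_le hO (le_of_span_eq_one hM.2)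
  · obtain ⟨r, hr, h⟩ := exists_smul_isIntegral (F := F) x
    refine ⟨c * r, mul_ne_zero hc hr, ?_⟩
    have : (c * r) • x = c • r • x := mul_smul c r x
    rw [this]
    exact hcM M hM.1 hM.2 _ h

variable [Module.Finite F A] [Module.Finite F B] [Algebra.FormallyUnramified F A]
  [Algebra.FormallyUnramified F B]

/-- Every primitive lattice arises from a point of the support of the orbital integral. -/
lemma exists_frameLattice_eq
    {v₀ : Fin (2 * h) → F} (H : IsLatticeFrame (p.e₁ ζ) (p.e₂ ϖ) z' (p.w ζ ζ' ϖ ϖ') v₀)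
    {M : Submodule 𝒪[F] (AdjoinRoot (minpoly F (p.w ζ ζ' ϖ ϖ')))}
    (hM : M ∈ primitiveLattices (p.w ζ ζ' ϖ ϖ')) :
    ∃ x ∈ orbitSupport r g₁ g₂, frameLattice (p.e₁ ζ) (p.w ζ ζ' ϖ ϖ') v₀
      (latticeOf (g₁ * (x.1 : GLn h F))) = M := by
  obtain ⟨hfg, hspan⟩ := S.fg_of_mem_primitiveLattices hM
  obtain ⟨Λ, h1, h2, h3, h4, rfl⟩ := H.exists_frameLattice_eq hfg hspan hM.1
  obtain ⟨x₁, hx₁⟩ := exists_latticeOf_mul_eq p.free₁ S.conj.1 S.integral.1 h1 h2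
    fun a ha => S.gen₁.mem_stabilizerAlgebra h3 ha
  obtain ⟨x₂, hx₂⟩ := exists_latticeOf_mul_eq p.free₂ S.conj.2 S.integral.2 h1 h2
    fun a ha => S.gen₂.mem_stabilizerAlgebra h4 ha
  exact ⟨(x₁, x₂), hx₁.trans hx₂.symm, by rw [hx₁]⟩

end IsUnitPair
end Count

/-! ### The volume of the support -/

section OrbitalIntegral
open MeasureTheory
variable {F A B : Type*} [Field F] [ValuativeRel F] [TopologicalSpace F]
  [IsNonarchimedeanLocalField F] [MeasurableSpace F] [BorelSpace F]
  [CommRing A] [Algebra F A] [CommRing B] [Algebra F B] {h : ℕ}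
  {p r : EmbeddingPair F A B h} {g₁ g₂ : GLn h F} {ζ ζ' : A} {ϖ ϖ' : B} {T N t n : 𝒪[F]}
  {z' : Mat h F}

lemma sigmaFinite_centralizerGL {e : A →ₐ[F] Mat h F} (μ : Measure (centralizerGL e))
    [μ.IsMulLeftInvariant] (hμ : μ {x | (x : GLn h F) ∈ GLO h F} = 1) : SigmaFinite μ := by
  have := secondCountableTopology_GLn (F := F) (h := h)
  have := measurableMul₂_GLn (F := F) (h := h)
  have := measurableMul₂_subgroup (centralizerGL e)
  have : SecondCountableTopology (centralizerGL e) :=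
    Topology.IsInducing.subtypeVal.secondCountableTopology
  refine sigmaFinite_of_mem_nhds μ (U := {x | (x : GLn h F) ∈ GLO h F}) ?_ (by simp [hμ])
  exact (isOpen_GLO.preimage continuous_subtype_val).mem_nhds (one_mem (GLO h F))

lemma OrbitalMeasures.sigmaFinite_lam (m : OrbitalMeasures r g₁ g₂) : SigmaFinite m.lam := by
  have := secondCountableTopology_GLn (F := F) (h := h)
  have := measurableMul₂_GLn (F := F) (h := h)
  have := measurableMul₂_subgroup (centralizerGL r.e₁)
  have := measurableMul₂_subgroup (centralizerGL r.e₂)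
  have := measurableMul₂_prod (G := centralizerGL r.e₁) (H := centralizerGL r.e₂)
  have := measurableMul₂_subgroup (stabilizerL r g₁ g₂)
  have := m.haarL
  have : SecondCountableTopology (centralizerGL r.e₁) :=
    Topology.IsInducing.subtypeVal.secondCountableTopology
  have : SecondCountableTopology (centralizerGL r.e₂) :=
    Topology.IsInducing.subtypeVal.secondCountableTopology
  have : SecondCountableTopology (stabilizerL r g₁ g₂) :=
    Topology.IsInducing.subtypeVal.secondCountableTopology
  refine sigmaFinite_of_mem_nhds m.lam (U := {x | (x.1.1 : GLn h F) ∈ GLO h F}) ?_ ?_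
  · refine (isOpen_GLO.preimage ?_).mem_nhds (one_mem (GLO h F))
    exact continuous_subtype_val.comp (continuous_fst.comp continuous_subtype_val)
  -- An open neighbourhood of 1 of finite measure: if the first component lies in GL_{2h}(𝒪_F), then
  -- it and its inverse are integral, so the point lies in the normalized set 𝒪_L^×.
  · refine ne_top_of_le_ne_top ENNReal.one_ne_top ((measure_mono fun x hx => ?_).trans m.normL.le)
    exact ⟨isIntegral_of_mem_GLO hx, isIntegral_of_mem_GLO ((GLO h F).inv_mem hx)⟩

lemma measurableSet_orbitSupport : MeasurableSet (orbitSupport r g₁ g₂) := by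
  have := measurableMul₂_GLn (F := F) (h := h)
  have := measurableInv_GLn (F := F) (h := h)
  have : orbitSupport r g₁ g₂ = (fun x : centralizerGL r.e₁ × centralizerGL r.e₂ =>
      (x.1 : GLn h F)⁻¹ * g₁⁻¹ * g₂ * (x.2 : GLn h F)) ⁻¹' (GLO h F : Set (GLn h F)) := by
    ext x
    exact mem_orbitSupport_iff
  rw [this]
  have h1 : Measurable fun x : centralizerGL r.e₁ × centralizerGL r.e₂ => (x.1 : GLn h F) :=
    measurable_subtype_coe.comp measurable_fst
  have h2 : Measurable fun x : centralizerGL r.e₁ × centralizerGL r.e₂ => (x.2 : GLn h F) :=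
    measurable_subtype_coe.comp measurable_snd
  exact (((h1.inv.mul_const _).mul_const _).mul h2) measurableSet_GLO

lemma measurableSet_out_mem_orbitSupport :
    MeasurableSet {x : Quotient (QuotientGroup.rightRel (stabilizerL r g₁ g₂)) |
      x.out ∈ orbitSupport r g₁ g₂} := by
  rw [measurableSet_quotient]
  exact (congrArg MeasurableSet (mk_preimage_orbitSupport (g₁ := g₁) (g₂ := g₂))).mpr
    measurableSet_orbitSupport

/-- The quotient measure of the support of the orbital integral is the number of primitive
lattices. -/
theorem IsUnitPair.measure_orbitSupport [Nontrivial A] [Module.Finite F A] [Module.Finite F B]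
    [Algebra.FormallyUnramified F A] [Algebra.FormallyUnramified F B]
    (S : IsUnitPair p r g₁ g₂ ζ ζ' ϖ ϖ' T N t n z') (m : OrbitalMeasures r g₁ g₂) :
    m.μ {x | x.out ∈ orbitSupport r g₁ g₂} = (primitiveLattices (p.w ζ ζ' ϖ ϖ')).ncard := by
  have := measurableMul₂_GLn (F := F) (h := h)
  have := measurableInv_GLn (F := F) (h := h)
  have := measurableMul₂_subgroup (centralizerGL r.e₁)
  have := measurableMul₂_subgroup (centralizerGL r.e₂)
  have := measurableInv_subgroup (centralizerGL r.e₁)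
  have := measurableInv_subgroup (centralizerGL r.e₂)
  have := measurableMul₂_prod (G := centralizerGL r.e₁) (H := centralizerGL r.e₂)
  have := measurableInv_prod (G := centralizerGL r.e₁) (H := centralizerGL r.e₂)
  have := measurableMul₂_subgroup (stabilizerL r g₁ g₂)
  have := m.haar₁
  have := m.haar₂
  have := m.haarL
  have := sigmaFinite_centralizerGL m.ν₁ m.norm₁
  have := sigmaFinite_centralizerGL m.ν₂ m.norm₂
  have := m.sigmaFinite_lam
  have := finite_adjoinRoot_minpoly (p.w ζ ζ' ϖ ϖ')
  have := S.formallyUnramified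
  obtain ⟨v₀, H⟩ := S.exists_isLatticeFrame
  obtain ⟨Φ, hΦ, hΦl⟩ := exists_unitsHom S.conj S.gen₁ S.gen₂ H
  let c : centralizerGL r.e₁ × centralizerGL r.e₂ → Submodule 𝒪[F] (AdjoinRoot (minpoly F (p.w ζ ζ' ϖ ϖ'))) :=
    fun x => frameLattice (p.e₁ ζ) (p.w ζ ζ' ϖ ϖ') v₀ (latticeOf (g₁ * (x.1 : GLn h F)))
  -- `P` is the slice of points with primitive lattice. The fibres of `c` on `P` are left cosets of
  -- `K`, a set of volume 1, so `P` has volume the number of primitive lattices. It meets each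
  -- L^×-orbit of the support in a coset of 𝒪_L^×, also of volume 1.
  let P : Set (centralizerGL r.e₁ × centralizerGL r.e₂) :=
    {x | x ∈ orbitSupport r g₁ g₂ ∧ c x ∈ primitiveLattices (p.w ζ ζ' ϖ ϖ')}
  let K : Set (centralizerGL r.e₁ × centralizerGL r.e₂) :=
    {x : centralizerGL r.e₁ | (x : GLn h F) ∈ GLO h F} ×ˢ
      {x : centralizerGL r.e₂ | (x : GLn h F) ∈ GLO h F}
  have hK : (m.ν₁.prod m.ν₂) K = 1 := by
    rw [Measure.prod_prod, m.norm₁, m.norm₂, one_mul]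
  have hKm : MeasurableSet K := (measurable_subtype_coe measurableSet_GLO).prod
    (measurable_subtype_coe measurableSet_GLO)
  obtain ⟨hPm, hPν⟩ := measure_eq_ncard hK S.finite_primitiveLattices hKm (P := P) c
    (fun M hM => by
      obtain ⟨x, hx, rfl⟩ := S.exists_frameLattice_eq H hM
      exact ⟨x, ⟨hx, hM⟩, rfl⟩)
    (fun x hx => hx.2)
    (fun x hx x' => by
      refine Iff.trans ⟨?_, ?_⟩ (S.frameLattice_eq_iff H hx.1 x')
      · rintro ⟨h1, h2⟩
        exact ⟨h1.1, h2⟩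
      · rintro ⟨h1, h2⟩
        refine ⟨⟨h1, ?_⟩, h2⟩
        have h3 := hx.2
        rwa [show c x = c x' from h2] at h3)
  rw [← hPν]
  have hmem : ∀ (k : stabilizerL r g₁ g₂) x, x ∈ orbitSupport r g₁ g₂ → (k.1 * x ∈ P ↔
      Submodule.span (integralClosure 𝒪[F] (AdjoinRoot (minpoly F (p.w ζ ζ' ϖ ϖ')))) ((c x).map
        (LinearMap.mulLeft 𝒪[F] (Φ k : AdjoinRoot (minpoly F (p.w ζ ζ' ϖ ϖ')))) :
          Set (AdjoinRoot (minpoly F (p.w ζ ζ' ϖ ϖ')))) = 1) := fun k x hx => by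
    have h1 : c (k.1 * x) = (c x).map (LinearMap.mulLeft 𝒪[F] (Φ k : AdjoinRoot (minpoly F (p.w ζ ζ' ϖ ϖ')))) :=
      frameLattice_mul k x H (hΦl k)
    have h2 := (mul_mem_orbitSupport_iff k x).2 hx
    obtain ⟨h3, h4⟩ := S.mem_stabilizerAlgebra h2
    rw [← h1]
    exact ⟨fun h => h.2.2, fun h => ⟨h2, fun y hy => H.root_mul_mem h3 h4 hy, h⟩⟩
  -- Take k₀ moving the lattice of x to a primitive one. Then kx has a primitive lattice exactly
  -- when k and k₀ differ by an integral unit.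
  have hfib : ∀ x ∈ orbitSupport r g₁ g₂, ∃ k₀ : stabilizerL r g₁ g₂, ∀ k : stabilizerL r g₁ g₂,
      k.1 * x ∈ P ↔ k₀⁻¹ * k ∈ integralUnitsL r g₁ g₂ := by
    intro x hx
    obtain ⟨u, hu⟩ := exists_span_map_eq_one (F := F) (H.fg_frameLattice (fg_latticeOf
      (g₁ * (x.1 : GLn h F)))) (exists_smul_mem_frameLattice (exists_smul_mem_latticeOf _))
    obtain ⟨k₀, hk₀⟩ := hΦ u
    refine ⟨k₀, fun k => ?_⟩
    have h1 : (c x).map (LinearMap.mulLeft 𝒪[F] (Φ k : AdjoinRoot (minpoly F (p.w ζ ζ' ϖ ϖ')))) =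
        ((c x).map (LinearMap.mulLeft 𝒪[F] (u : AdjoinRoot (minpoly F (p.w ζ ζ' ϖ ϖ'))))).map
          (LinearMap.mulLeft 𝒪[F] (Φ (k₀⁻¹ * k) : AdjoinRoot (minpoly F (p.w ζ ζ' ϖ ϖ')))) := by
      rw [← Submodule.map_comp]
      congr 1
      ext y
      rw [map_mul, map_inv, hk₀, mul_comm u⁻¹]
      simp
    rw [hmem k x hx, h1]
    exact (span_map_eq_one_iff (F := F) hu _).trans (mem_integralUnitsL_iff _ (hΦl _)).symm
  -- L^× is commutative because it maps to the units of F[`𝐰`]; this supplies the slice condition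
  -- for inverses.
  have hcomm : ∀ a b : stabilizerL r g₁ g₂, a * b ∈ integralUnitsL r g₁ g₂ ↔
      a⁻¹ * b⁻¹ ∈ integralUnitsL r g₁ g₂ := fun a b => by
    rw [mem_integralUnitsL_iff _ (hΦl _), mem_integralUnitsL_iff _ (hΦl _), ← map_inv Φ,
      ← map_inv Φ, map_mul, mul_inv_rev, mul_inv_rev, inv_inv, inv_inv, map_mul, map_mul, map_mul,
      mul_comm (Φ b⁻¹), mul_comm (Φ b), and_comm]
  refine quotientMeasure_apply_eq measurableSet_out_mem_orbitSupport hPm (fun g hg => ?_)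
    (fun g hg => ?_) fun g hg => ?_
  · have : g ∈ Quotient.mk (QuotientGroup.rightRel (stabilizerL r g₁ g₂)) ⁻¹'
        {x | x.out ∈ orbitSupport r g₁ g₂} := by
      rw [mk_preimage_orbitSupport]
      exact hg.1
    exact this
  all_goals
    replace hg : g ∈ orbitSupport r g₁ g₂ := by
      rw [← mk_preimage_orbitSupport]
      exact hg
    obtain ⟨k₀, hk₀⟩ := hfib g hg
  · have : {k : stabilizerL r g₁ g₂ | k.1 * g ∈ P} =
        (fun k => k₀⁻¹ * k) ⁻¹' integralUnitsL r g₁ g₂ := Set.ext hk₀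
    rw [this, measure_preimage_mul, m.normL]
  · have : {k : stabilizerL r g₁ g₂ | (k.1)⁻¹ * g ∈ P} =
        (fun k => k₀ * k) ⁻¹' integralUnitsL r g₁ g₂ := Set.ext fun k =>
      (hk₀ k⁻¹).trans (hcomm k₀ k).symm
    rw [this, measure_preimage_mul, m.normL]

end OrbitalIntegral

/-! ### Evaluation of the two integrals -/

section Integrals
open MeasureTheory
variable {F A B : Type*} [Field F] [ValuativeRel F] [CommRing A] [Algebra F A] [CommRing B]
  [Algebra F B] {h : ℕ} {p r : EmbeddingPair F A B h} {g₁ g₂ : GLn h F} {ζ ζ' : A} {ϖ ϖ' : B}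
  {T N t n : 𝒪[F]} {z' : Mat h F}

lemma geometricIntegrand_unitTest : geometricIntegrand r g₁ g₂ (unitTest h F) =
    Set.indicator {x | x.out ∈ orbitSupport r g₁ g₂} 1 := by
  classical
  ext x
  simp only [geometricIntegrand, unitTest, Set.indicator_apply, Set.mem_ofPred_eq,
    mem_orbitSupport_iff, SetLike.mem_coe, Pi.one_apply]

lemma transferFactor_eq_one {e e' z : Mat h F} {Λ : AddSubgroup (Fin (2 * h) → F)}
    (hΛ : matImage e' Λ = matImage z (matImage e Λ)) : transferFactor e e' z Λ 0 = 1 := by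
  simp [transferFactor, hΛ, latticeIndex]

/-- On the support Λ is stable under `𝐳` and `𝐳⁻¹`, so `𝐳`Λ = Λ. Since `𝐳ζ = ζ'𝐳`, this gives ζ'Λ =
`𝐳`ζΛ: the index is 1 and its logarithm 0. -/
lemma IsUnitPair.transferFactor_eq_one [TopologicalSpace F] [IsNonarchimedeanLocalField F]
    [Nontrivial A] (S : IsUnitPair p r g₁ g₂ ζ ζ' ϖ ϖ' T N t n z')
    {x : centralizerGL r.e₁ × centralizerGL r.e₂} (hx : x ∈ orbitSupport r g₁ g₂) :
    transferFactor (p.e₁ ζ) (p.e₁ ζ') (p.z ζ ϖ)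
      (matImage ((g₁ * (x.1 : GLn h F) : GLn h F) : Mat h F) (stdLattice h F)) 0 = 1 := by
  obtain ⟨v₀, H⟩ := S.exists_isLatticeFrame
  obtain ⟨h1, h2⟩ := S.mem_stabilizerAlgebra hx
  have hz' := H.inv_mem _ h1 h2
  have hz : p.z ζ ϖ ∈ stabilizerAlgebra (latticeOf (g₁ * (x.1 : GLn h F))) :=
    sub_mem (mul_mem h2 h1) (mul_mem h1 h2)
  have hQ : IsQuadraticPair (p.e₁ ζ) (p.e₁ ζ') (p.e₂ ϖ) (p.e₂ ϖ') (T : F) N t n :=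
    ⟨S.gen₁.map_add_eq p.e₁, S.gen₁.map_mul_eq p.e₁, S.gen₂.map_add_eq p.e₂,
      S.gen₂.map_mul_eq p.e₂⟩
  have hzζ : p.z ζ ϖ * p.e₁ ζ = p.e₁ ζ' * p.z ζ ϖ := hQ.z_mul_ζ
  have hz'z : z' * p.z ζ ϖ = 1 := mul_eq_one_comm.1 S.z_mul
  apply BiquadraticFL.transferFactor_eq_one
  rw [matImage_stdLattice]
  ext v
  constructor
  · rintro ⟨u, hu, rfl⟩
    refine ⟨p.e₁ ζ *ᵥ (z' *ᵥ u), ⟨_, hz' _ hu, rfl⟩, ?_⟩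
    change p.z ζ ϖ *ᵥ (p.e₁ ζ *ᵥ (z' *ᵥ u)) = p.e₁ ζ' *ᵥ u
    rw [Matrix.mulVec_mulVec, Matrix.mulVec_mulVec, hzζ, mul_assoc, S.z_mul, mul_one]
  · rintro ⟨_, ⟨u, hu, rfl⟩, rfl⟩
    refine ⟨p.z ζ ϖ *ᵥ u, hz _ hu, ?_⟩
    change p.e₁ ζ' *ᵥ (p.z ζ ϖ *ᵥ u) = p.z ζ ϖ *ᵥ (p.e₁ ζ *ᵥ u)
    rw [Matrix.mulVec_mulVec, Matrix.mulVec_mulVec, hzζ]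

lemma IsUnitPair.analyticIntegrand_unitTest [TopologicalSpace F] [IsNonarchimedeanLocalField F]
    [Nontrivial A] (S : IsUnitPair p r g₁ g₂ ζ ζ' ϖ ϖ' T N t n z') :
    analyticIntegrand r g₁ g₂ (p.e₁ ζ) (p.e₁ ζ') (p.z ζ ϖ) (unitTest h F) 0 =
      geometricIntegrand r g₁ g₂ (unitTest h F) := by
  ext x
  rw [analyticIntegrand, geometricIntegrand_unitTest]
  by_cases hx : x.out ∈ orbitSupport r g₁ g₂
  · rw [S.transferFactor_eq_one hx, mul_one]
  · rw [Set.indicator_of_notMem (by exact hx), zero_mul]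

variable [TopologicalSpace F] [IsNonarchimedeanLocalField F] [MeasurableSpace F] [BorelSpace F]
  [Nontrivial A] [Module.Finite F A] [Module.Finite F B]
  [Algebra.FormallyUnramified F A] [Algebra.FormallyUnramified F B]

lemma IsUnitPair.integrable_geometricIntegrand (S : IsUnitPair p r g₁ g₂ ζ ζ' ϖ ϖ' T N t n z')
    (m : OrbitalMeasures r g₁ g₂) :
    Integrable (geometricIntegrand r g₁ g₂ (unitTest h F)) m.μ := by
  rw [geometricIntegrand_unitTest]
  refine (integrableOn_const (C := (1 : ℂ)) ?_).integrable_indicator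
    measurableSet_out_mem_orbitSupport
  rw [S.measure_orbitSupport m]
  exact ENNReal.natCast_ne_top _

/-- The orbital integral of the unit element counts primitive lattices. -/
lemma IsUnitPair.orb_unitTest (S : IsUnitPair p r g₁ g₂ ζ ζ' ϖ ϖ' T N t n z')
    (m : OrbitalMeasures r g₁ g₂) :
    orb m (unitTest h F) = ((primitiveLattices (p.w ζ ζ' ϖ ϖ')).ncard : ℂ) := by
  rw [orb, geometricIntegrand_unitTest, integral_indicator measurableSet_out_mem_orbitSupport]
  simp [Measure.real, S.measure_orbitSupport m]

lemma IsUnitPair.integrable_analyticIntegrand (S : IsUnitPair p r g₁ g₂ ζ ζ' ϖ ϖ' T N t n z')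
    (m : OrbitalMeasures r g₁ g₂) :
    Integrable (analyticIntegrand r g₁ g₂ (p.e₁ ζ) (p.e₁ ζ') (p.z ζ ϖ) (unitTest h F) 0) m.μ := by
  rw [S.analyticIntegrand_unitTest]
  exact S.integrable_geometricIntegrand m

lemma IsUnitPair.twistedOrb_unitTest (S : IsUnitPair p r g₁ g₂ ζ ζ' ϖ ϖ' T N t n z')
    (m : OrbitalMeasures r g₁ g₂) :
    twistedOrb m (p.e₁ ζ) (p.e₁ ζ') (p.z ζ ϖ) (unitTest h F) 0 =
      ((primitiveLattices (p.w ζ ζ' ϖ ϖ')).ncard : ℂ) := by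
  rw [twistedOrb, S.analyticIntegrand_unitTest]
  exact S.orb_unitTest m

end Integrals

/-! ### Rings of integers of quadratic algebras -/

section QuadraticAlgebras
variable {F : Type*} [Field F] [ValuativeRel F] {K : Type*} [CommRing K] [Algebra F K]

lemma exists_algebraMap_eq_of_isIntegral [Nontrivial K] {a : F}
    (ha : IsIntegral 𝒪[F] (algebraMap F K a)) : ∃ b : 𝒪[F], algebraMap 𝒪[F] F b = a :=
  IsIntegrallyClosed.isIntegral_iff.1
    ((isIntegral_algHom_iff ((Algebra.ofId F K).restrictScalars 𝒪[F])
      (algebraMap F K).injective).1 ha)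

lemma IsQuadraticInvolution.exists_algebraMap_eq [Nontrivial K] {σ : K ≃ₐ[F] K}
    (hσ : IsQuadraticInvolution σ) {x : K} (hx : σ x = x) (hint : IsIntegral 𝒪[F] x) :
    ∃ b : 𝒪[F], algebraMap 𝒪[F] K b = x := by
  obtain ⟨a, rfl⟩ := hσ.2 x hx
  obtain ⟨b, rfl⟩ := exists_algebraMap_eq_of_isIntegral hint
  exact ⟨b, IsScalarTower.algebraMap_apply 𝒪[F] F K b⟩

lemma isIntegral_of_adjoin_eq {ζ : K} (h : Algebra.adjoin 𝒪[F] {ζ} = integralClosure 𝒪[F] K) :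
    IsIntegral 𝒪[F] ζ := by
  have : ζ ∈ Algebra.adjoin 𝒪[F] {ζ} := Algebra.self_mem_adjoin_singleton _ _
  rwa [h] at this

lemma IsQuadraticInvolution.exists_isIntegralGenerator [Nontrivial K] {σ : K ≃ₐ[F] K}
    (hσ : IsQuadraticInvolution σ) {ζ : K}
    (h : Algebra.adjoin 𝒪[F] {ζ} = integralClosure 𝒪[F] K) :
    ∃ T N : 𝒪[F], IsIntegralGenerator ζ (σ ζ) T N := by
  have h1 : IsIntegral 𝒪[F] ζ := isIntegral_of_adjoin_eq h
  have h2 : IsIntegral 𝒪[F] (σ ζ) := h1.map (σ.toAlgHom.restrictScalars 𝒪[F])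
  obtain ⟨T, hT⟩ := hσ.exists_algebraMap_eq (x := ζ + σ ζ)
    (by rw [map_add, hσ.1, add_comm]) (h1.add h2)
  obtain ⟨N, hN⟩ := hσ.exists_algebraMap_eq (x := ζ * σ ζ)
    (by rw [map_mul, hσ.1, mul_comm]) (h1.mul h2)
  exact ⟨T, N, hT.symm, hN.symm, h⟩

namespace IsIntegralGenerator
variable {ζ ζ' : K} {T N : 𝒪[F]} (H : IsIntegralGenerator ζ ζ' T N)
include H

lemma isIntegral : IsIntegral 𝒪[F] ζ := isIntegral_of_adjoin_eq H.adjoin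

lemma sq_eq : ζ ^ 2 = algebraMap 𝒪[F] K T * ζ - algebraMap 𝒪[F] K N := by
  rw [← H.add, ← H.mul]
  ring

lemma sub_sq_eq : (ζ - ζ') ^ 2 = algebraMap 𝒪[F] K (T ^ 2 - 4 * N) := by
  rw [map_sub, map_pow, map_mul, map_ofNat, ← H.add, ← H.mul]
  ring

lemma exists_eq_add {x : K} (hx : IsIntegral 𝒪[F] x) :
    ∃ a b : 𝒪[F], x = algebraMap 𝒪[F] K a + algebraMap 𝒪[F] K b * ζ := by
  have hx' : x ∈ Algebra.adjoin 𝒪[F] {ζ} := by rwa [H.adjoin]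
  clear hx
  induction hx' using Algebra.adjoin_induction with
  | mem x hx => exact ⟨0, 1, by simp [Set.mem_singleton_iff.1 hx]⟩
  | algebraMap r => exact ⟨r, 0, by simp⟩
  | add x y hx hy h1 h2 =>
    obtain ⟨a, b, rfl⟩ := h1
    obtain ⟨c, d, rfl⟩ := h2
    exact ⟨a + c, b + d, by simp only [map_add]; ring⟩
  | mul x y hx hy h1 h2 =>
    obtain ⟨a, b, rfl⟩ := h1
    obtain ⟨c, d, rfl⟩ := h2
    refine ⟨a * c - b * d * N, a * d + b * c + b * d * T, ?_⟩
    simp only [map_add, map_sub, map_mul]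
    linear_combination algebraMap 𝒪[F] K b * algebraMap 𝒪[F] K d * H.sq_eq

variable [Module.Finite F K]

lemma exists_eq_add' (x : K) : ∃ a b : F, x = algebraMap F K a + algebraMap F K b * ζ := by
  obtain ⟨r, hr, hrx⟩ := exists_smul_isIntegral (F := F) x
  obtain ⟨a, b, hab⟩ := H.exists_eq_add hrx
  have hr' : (r : F) ≠ 0 := fun h => hr (Subtype.ext h)
  refine ⟨(r : F)⁻¹ * a, (r : F)⁻¹ * b, ?_⟩
  have h1 : (r : F) • x = algebraMap F K a + algebraMap F K b * ζ := hab
  rw [map_mul, map_mul, mul_assoc, ← mul_add, ← h1, ← Algebra.smul_def, smul_smul,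
    inv_mul_cancel₀ hr', one_smul]

lemma adjoin_eq_top : Algebra.adjoin F {ζ} = ⊤ := by
  refine Algebra.eq_top_iff.2 fun x => ?_
  obtain ⟨a, b, rfl⟩ := H.exists_eq_add' x
  exact add_mem (Subalgebra.algebraMap_mem _ _) (mul_mem (Subalgebra.algebraMap_mem _ _)
    (Algebra.self_mem_adjoin_singleton _ _))

lemma formallyUnramified (hs : IsUnit (ζ - ζ')) : Algebra.FormallyUnramified F K := by
  refine formallyUnramified_of_generator ζ H.adjoin_eq_top
    (Polynomial.X ^ 2 - Polynomial.C (T : F) * Polynomial.X + Polynomial.C (N : F)) ?_ ?_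
  · have h1 : algebraMap F K (T : F) = ζ + ζ' := H.add.symm
    have h2 : algebraMap F K (N : F) = ζ * ζ' := H.mul.symm
    simp only [map_add, map_sub, map_mul, map_pow, Polynomial.aeval_X, Polynomial.aeval_C, h1, h2]
    ring
  · have h1 : algebraMap F K (T : F) = ζ + ζ' := H.add.symm
    have h2 : Polynomial.aeval ζ (Polynomial.derivative (Polynomial.X ^ 2 -
        Polynomial.C (T : F) * Polynomial.X + Polynomial.C (N : F))) = ζ - ζ' := by
      simp [h1]
      ring
    rwa [h2]

end IsIntegralGenerator

end QuadraticAlgebras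

/-! ### Unramified implies unit discriminant -/

section Unramified

/-- The identity and τ agree modulo s. Since (s)/(s²) has square zero, uniqueness of lifts makes
them agree modulo s². Applied to z, this puts s = z - τz in (s²). -/
lemma exists_mul_sq_eq_of_formallyUnramified {R O : Type*} [CommRing R] [CommRing O] [Algebra R O]
    [Algebra.FormallyUnramified R O] (τ : O →ₐ[R] O) (s : O)
    (hs : ∀ x, x - τ x ∈ Ideal.span {s}) (z : O) (hz : z - τ z = s) : ∃ c, c * s ^ 2 = s := by
  let J : Ideal O := Ideal.span {s ^ 2}
  have hI : ((Ideal.span {s}).map (Ideal.Quotient.mk J)) ^ 2 = ⊥ := by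
    rw [← Ideal.map_pow, Ideal.span_singleton_pow, Ideal.map_quotient_self]
  have key : Ideal.Quotient.mkₐ R J = (Ideal.Quotient.mkₐ R J).comp τ := by
    refine Algebra.FormallyUnramified.iff_comp_injective.1 inferInstance _ hI ?_
    ext x
    simp only [AlgHom.comp_apply, Ideal.Quotient.mkₐ_eq_mk]
    rw [Ideal.Quotient.eq, ← map_sub]
    exact Ideal.mem_map_of_mem _ (hs x)
  have h1 : z - τ z ∈ J := Ideal.Quotient.eq.1 (DFunLike.congr_fun key z)
  rw [hz] at h1
  exact Ideal.mem_span_singleton'.1 h1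

variable {F : Type*} [Field F] [ValuativeRel F] {K : Type*} [Field K] [Algebra F K]

/-- The discriminant of a generator of an unramified ring of integers is a unit. -/
lemma IsIntegralGenerator.isUnit_disc [Algebra.FormallyUnramified 𝒪[F] (integralClosure 𝒪[F] K)]
    {σ : K ≃ₐ[F] K} {ζ : K} {T N : 𝒪[F]}
    (H : IsIntegralGenerator ζ (σ ζ) T N) (hs : ζ - σ ζ ≠ 0) : IsUnit (T ^ 2 - 4 * N) := by
  let O := integralClosure 𝒪[F] K
  let z : O := ⟨ζ, H.isIntegral⟩
  let τ : O →ₐ[𝒪[F]] O := ((σ.toAlgHom.restrictScalars 𝒪[F]).comp O.val).codRestrict O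
    fun x => x.2.map (σ.toAlgHom.restrictScalars 𝒪[F])
  let s : O := z - τ z
  have hmem : ∀ x : O, x - τ x ∈ Ideal.span {s} := by
    intro x
    obtain ⟨a, b, hab⟩ := H.exists_eq_add x.2
    have : x = algebraMap 𝒪[F] O a + algebraMap 𝒪[F] O b * z := Subtype.ext hab
    rw [this, map_add, map_mul, AlgHom.commutes, AlgHom.commutes, add_sub_add_left_eq_sub, ← mul_sub]
    exact Ideal.mul_mem_left _ _ (Ideal.mem_span_singleton_self s)
  obtain ⟨c, hc⟩ := exists_mul_sq_eq_of_formallyUnramified (R := 𝒪[F]) (O := O) τ s hmem z rfl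
  -- Cancelling s = ζ - σζ ≠ 0 in c s² = s shows that s has the integral inverse c, and T² - 4N =
  -- s². The inverse of T² - 4N is then integral and in F, so it lies in 𝒪_F.
  have hcs : (c : K) * (ζ - σ ζ) = 1 := by
    have h2 : (c : K) * (ζ - σ ζ) ^ 2 = ζ - σ ζ := congrArg Subtype.val hc
    refine mul_right_cancel₀ hs ?_
    rw [mul_assoc, ← sq, h2, one_mul]
  have h3 : (c : K) ^ 2 * algebraMap F K ((T ^ 2 - 4 * N : 𝒪[F]) : F) = 1 := by
    have : algebraMap F K ((T ^ 2 - 4 * N : 𝒪[F]) : F) = (ζ - σ ζ) ^ 2 := H.sub_sq_eq.symm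
    rw [this, ← mul_pow, hcs, one_pow]
  have hδ : ((T ^ 2 - 4 * N : 𝒪[F]) : F) ≠ 0 := by
    intro h
    rw [h, map_zero, mul_zero] at h3
    exact zero_ne_one h3
  obtain ⟨b, hb⟩ := exists_algebraMap_eq_of_isIntegral (K := K)
    (a := ((T ^ 2 - 4 * N : 𝒪[F]) : F)⁻¹) (by
      rw [map_inv₀, ← eq_inv_of_mul_eq_one_left h3]
      exact c.2.pow 2)
  refine IsUnit.of_mul_eq_one b (Subtype.ext ?_)
  have hb' : (b : F) = ((T ^ 2 - 4 * N : 𝒪[F]) : F)⁻¹ := hb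
  rw [Subring.coe_mul, hb', mul_inv_cancel₀ hδ]
  rfl

end Unramified

/-! ### Galois descent for rings of integers -/

section Descent
variable {F : Type*} [Field F] [ValuativeRel F] {K R : Type*} [CommRing K] [Algebra F K]
  [CommRing R] [Algebra F R]

lemma algHom_algebraMap (i : K →ₐ[F] R) (a : 𝒪[F]) :
    i (algebraMap 𝒪[F] K a) = algebraMap 𝒪[F] R a :=
  i.commutes (a : F)

lemma isIntegral_algHom (i : K →ₐ[F] R) {x : K} (hx : IsIntegral 𝒪[F] x) :
    IsIntegral 𝒪[F] (i x) :=
  hx.map (i.restrictScalars 𝒪[F])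

/-- The `F`-algebra `R` is the extension of scalars of `i : K → R` to the quadratic algebra
generated by `Z`, which has trace `T`, norm `N` and invertible discriminant; `τ` is the nontrivial
automorphism of `R` over `K`, and `ρ` is a descent datum that induces `σ` on `K`. -/
structure IsQuadraticDescent (i : K →ₐ[F] R) (σ : K ≃ₐ[F] K) (ρ τ : R →ₐ[F] R) (Z Z' : R)
    (T N : 𝒪[F]) : Prop where
  injective : Function.Injective i
  exists_eq : ∀ y, ∃ p q, y = i p + Z * i q
  add : Z + Z' = algebraMap 𝒪[F] R T
  mul : Z * Z' = algebraMap 𝒪[F] R N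
  isIntegral : IsIntegral 𝒪[F] Z
  isIntegral' : IsIntegral 𝒪[F] Z'
  isUnit_disc : IsUnit (T ^ 2 - 4 * N)
  map_gen : ρ Z = Z'
  map_incl : ∀ x, ρ (i x) = i (σ x)
  conj_gen : τ Z = Z'
  conj_incl : ∀ x, τ (i x) = i x

namespace IsQuadraticDescent
variable {i : K →ₐ[F] R} {σ : K ≃ₐ[F] K} {ρ τ : R →ₐ[F] R} {Z Z' : R} {T N : 𝒪[F]}
  (H : IsQuadraticDescent i σ ρ τ Z Z' T N)
include H

lemma exists_inv_disc : ∃ e : 𝒪[F], e * (T ^ 2 - 4 * N) = 1 := H.isUnit_disc.exists_left_inv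

lemma sub_sq_eq : (Z - Z') ^ 2 = algebraMap 𝒪[F] R (T ^ 2 - 4 * N) := by
  rw [map_sub, map_pow, map_mul, map_ofNat, ← H.add, ← H.mul]
  ring

/-- The conjugation τ isolates the coefficient of Z up to the discriminant. As that is a unit,
coefficients of integral elements are integral (`isIntegral_coeff`) and the representation is unique
(`eq_zero`). -/
lemma sub_conj (p q : K) : (Z - Z') * ((i p + Z * i q) - τ (i p + Z * i q)) =
    algebraMap 𝒪[F] R (T ^ 2 - 4 * N) * i q := by
  rw [← H.sub_sq_eq, map_add, map_mul, H.conj_gen, H.conj_incl, H.conj_incl]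
  ring

lemma eq_zero {p q : K} (h : i p + Z * i q = 0) : p = 0 ∧ q = 0 := by
  obtain ⟨e, he⟩ := H.exists_inv_disc
  have h1 := H.sub_conj p q
  rw [h, map_zero, sub_zero, mul_zero] at h1
  have h2 : i q = 0 := by
    have h3 : algebraMap 𝒪[F] R e * algebraMap 𝒪[F] R (T ^ 2 - 4 * N) = 1 := by
      rw [← map_mul, he, map_one]
    linear_combination (-algebraMap 𝒪[F] R e) * h1 - i q * h3
  have hq : q = 0 := H.injective (h2.trans (map_zero i).symm)
  refine ⟨H.injective ?_, hq⟩
  rw [h2, mul_zero, add_zero] at h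
  rw [h, map_zero]

lemma isIntegral_incl_iff {x : K} : IsIntegral 𝒪[F] (i x) ↔ IsIntegral 𝒪[F] x :=
  isIntegral_algHom_iff (i.restrictScalars 𝒪[F]) H.injective

lemma isIntegral_coeff {p q : K} (h : IsIntegral 𝒪[F] (i p + Z * i q)) :
    IsIntegral 𝒪[F] p ∧ IsIntegral 𝒪[F] q := by
  obtain ⟨e, he⟩ := H.exists_inv_disc
  have hq : IsIntegral 𝒪[F] (i q) := by
    have h1 : IsIntegral 𝒪[F] (algebraMap 𝒪[F] R e *
        ((Z - Z') * ((i p + Z * i q) - τ (i p + Z * i q)))) :=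
      isIntegral_algebraMap.mul ((H.isIntegral.sub H.isIntegral').mul
        (h.sub (h.map (τ.restrictScalars 𝒪[F]))))
    rwa [H.sub_conj, ← mul_assoc, ← map_mul, he, map_one, one_mul] at h1
  refine ⟨H.isIntegral_incl_iff.1 ?_, H.isIntegral_incl_iff.1 hq⟩
  have h2 := h.sub (H.isIntegral.mul hq)
  rwa [add_sub_cancel_right] at h2

variable [Nontrivial K] (hσ : IsQuadraticInvolution σ) {ϖ : K} {t n : 𝒪[F]}
  (G : IsIntegralGenerator ϖ (σ ϖ) t n) {η : R} {p₀ : K} {ε ε' : 𝒪[F]}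
include hσ G

/-- Integral elements fixed by the descent datum are integral combinations of `1` and of one
well-chosen element `η`. -/
lemma exists_eq_add (hε : ε' * ε = 1) (hη : ρ η = η) (hη_int : IsIntegral 𝒪[F] η)
    (hη_eq : η = i p₀ + Z * i (algebraMap 𝒪[F] K ε * (ϖ - σ ϖ)))
    {y : R} (hy : ρ y = y) (hint : IsIntegral 𝒪[F] y) :
    ∃ a b : 𝒪[F], y = algebraMap 𝒪[F] R a + algebraMap 𝒪[F] R b * η := by
  have hσa : ∀ a : 𝒪[F], σ (algebraMap 𝒪[F] K a) = algebraMap 𝒪[F] K a := fun a =>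
    σ.commutes (a : F)
  obtain ⟨p, q, rfl⟩ := H.exists_eq y
  obtain ⟨hp, hq⟩ := H.isIntegral_coeff hint
  obtain ⟨c, d, hcd⟩ := G.exists_eq_add hp
  obtain ⟨a, b, hab⟩ := G.exists_eq_add hq
  -- Comparing coefficients in ρ(y) = y, with Z' = T - Z, yields σq = -q and p - σp = Tσq = -Tq.
  have h0 : i (p - σ p - algebraMap 𝒪[F] K T * σ q) + Z * i (q + σ q) = 0 := by
    have h1 := hy
    rw [map_add, map_mul, H.map_gen, H.map_incl, H.map_incl] at h1
    rw [map_sub, map_sub, map_mul, algHom_algebraMap i, map_add]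
    linear_combination - h1 + i (σ q) * H.add
  obtain ⟨h1, h2⟩ := H.eq_zero h0
  have hσp : σ p = algebraMap 𝒪[F] K c + algebraMap 𝒪[F] K d * σ ϖ := by
    rw [hcd, map_add, map_mul, hσa, hσa]
  have hσq : σ q = algebraMap 𝒪[F] K a + algebraMap 𝒪[F] K b * σ ϖ := by
    rw [hab, map_add, map_mul, hσa, hσa]
  obtain ⟨e, he⟩ := H.exists_inv_disc
  -- With q = a + bϖ and p = c + dϖ, the relations read 2q = b(ϖ - σϖ) and Tq = -d(ϖ - σϖ). Their
  -- combination with coefficients -2N and T gives (T² - 4N)q, so no division by 2 is needed.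
  let u : 𝒪[F] := e * (-T * d - 2 * N * b)
  have hqu : q = algebraMap 𝒪[F] K u * (ϖ - σ ϖ) := by
    have h3 : algebraMap 𝒪[F] K e *
        (algebraMap 𝒪[F] K T ^ 2 - 4 * algebraMap 𝒪[F] K N) = 1 := by
      rw [← map_one (algebraMap 𝒪[F] K), ← he]
      simp only [map_mul, map_sub, map_pow, map_ofNat]
    have h4 : p - σ p = algebraMap 𝒪[F] K d * (ϖ - σ ϖ) := by rw [hσp, hcd]; ring
    have h5 : q - σ q = algebraMap 𝒪[F] K b * (ϖ - σ ϖ) := by rw [hσq, hab]; ring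
    simp only [u, map_mul, map_sub, map_neg, map_ofNat]
    linear_combination (-q) * h3 + algebraMap 𝒪[F] K e * (algebraMap 𝒪[F] K T * (h1 - h4)
      - 2 * algebraMap 𝒪[F] K N * h5
      + (algebraMap 𝒪[F] K T ^ 2 - 2 * algebraMap 𝒪[F] K N) * h2)
  -- Subtracting v η removes the Z-component. What remains is integral and fixed by σ, hence in 𝒪_F.
  let v : 𝒪[F] := u * ε'
  have hy' : i p + Z * i q - algebraMap 𝒪[F] R v * η =
      i (p - algebraMap 𝒪[F] K v * p₀) := by
    have h6 : algebraMap 𝒪[F] R v * algebraMap 𝒪[F] R ε = algebraMap 𝒪[F] R u := by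
      rw [← map_mul, mul_assoc, hε, mul_one]
    rw [hη_eq, hqu, map_sub i, map_mul i, map_mul i, map_mul i, algHom_algebraMap i,
      algHom_algebraMap i, algHom_algebraMap i]
    linear_combination (-Z * i (ϖ - σ ϖ)) * h6
  obtain ⟨w, hw⟩ := hσ.exists_algebraMap_eq (x := p - algebraMap 𝒪[F] K v * p₀)
    (H.injective (by
      rw [← H.map_incl, ← hy', map_sub, hy, map_mul, hη]
      congr 2
      exact ρ.commutes (v : F)))
    (H.isIntegral_incl_iff.1 (by rw [← hy']; exact hint.sub (isIntegral_algebraMap.mul hη_int)))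
  refine ⟨w, v, ?_⟩
  rw [← algHom_algebraMap i, hw, ← hy']
  ring

/-- The fixed algebra of the descent datum has the ring of integers generated by `η`. -/
lemma adjoin_eq {S : Subalgebra F R} (hS : ∀ y, y ∈ S ↔ ρ y = y) {η : S} (hε : ε' * ε = 1)
    (hη_int : IsIntegral 𝒪[F] (η : R))
    (hη_eq : (η : R) = i p₀ + Z * i (algebraMap 𝒪[F] K ε * (ϖ - σ ϖ))) :
    Algebra.adjoin 𝒪[F] {η} = integralClosure 𝒪[F] S := by
  have hint : ∀ x : S, IsIntegral 𝒪[F] (x : R) ↔ IsIntegral 𝒪[F] x := fun x =>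
    isIntegral_algHom_iff (S.val.restrictScalars 𝒪[F]) Subtype.val_injective
  refine le_antisymm (Algebra.adjoin_le ?_) fun x hx => ?_
  · rw [Set.singleton_subset_iff]
    exact (hint η).1 hη_int
  · obtain ⟨a, b, hab⟩ := H.exists_eq_add hσ G hε ((hS _).1 η.2) hη_int hη_eq
      ((hS _).1 x.2) ((hint x).2 hx)
    have : x = algebraMap 𝒪[F] S a + algebraMap 𝒪[F] S b * η := Subtype.ext hab
    rw [this]
    exact add_mem (Subalgebra.algebraMap_mem _ _) (mul_mem (Subalgebra.algebraMap_mem _ _)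
      (Algebra.self_mem_adjoin_singleton _ _))

end IsQuadraticDescent
end Descent

section Tensor
variable {F : Type*} [Field F] [ValuativeRel F] {K₁ K : Type*} [Field K₁] [Algebra F K₁]
  [CommRing K] [Algebra F K] [Module.Finite F K₁]

/-- K₁ ⊗ K is the scalar extension of K to K₁, with Z = ζ ⊗ 1. The descent datum σ₁ ⊗ σ cuts out K₀
or K₃, while σ₁ ⊗ id is the conjugation over K. -/
lemma IsIntegralGenerator.isQuadraticDescent {σ₁ : K₁ ≃ₐ[F] K₁} {ζ : K₁} {T N : 𝒪[F]} (H : IsIntegralGenerator ζ (σ₁ ζ) T N) (hδ : IsUnit (T ^ 2 - 4 * N))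
    (σ : K ≃ₐ[F] K) :
    IsQuadraticDescent (Algebra.TensorProduct.includeRight : K →ₐ[F] K₁ ⊗[F] K) σ
      (Algebra.TensorProduct.map σ₁.toAlgHom σ.toAlgHom)
      (Algebra.TensorProduct.map σ₁.toAlgHom (AlgHom.id F K)) (ζ ⊗ₜ 1) (σ₁ ζ ⊗ₜ 1) T N where
  injective := Algebra.TensorProduct.includeRight_injective (algebraMap F K₁).injective
  exists_eq y := by
    induction y with
    | zero => exact ⟨0, 0, by simp⟩
    | tmul a x =>
      obtain ⟨c, d, rfl⟩ := H.exists_eq_add' a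
      refine ⟨c • x, d • x, ?_⟩
      rw [Algebra.algebraMap_eq_smul_one, ← Algebra.smul_def, TensorProduct.add_tmul,
        TensorProduct.smul_tmul, TensorProduct.smul_tmul]
      simp
    | add x y hx hy =>
      obtain ⟨a, b, rfl⟩ := hx
      obtain ⟨c, d, rfl⟩ := hy
      exact ⟨a + c, b + d, by simp only [map_add]; ring⟩
  add := by
    rw [← TensorProduct.add_tmul, H.add]
    rfl
  mul := by
    rw [Algebra.TensorProduct.tmul_mul_tmul, H.mul, mul_one]
    rfl
  isIntegral := isIntegral_algHom
    (Algebra.TensorProduct.includeLeft : K₁ →ₐ[F] K₁ ⊗[F] K) H.isIntegral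
  isIntegral' := isIntegral_algHom
    (Algebra.TensorProduct.includeLeft : K₁ →ₐ[F] K₁ ⊗[F] K)
    (isIntegral_algHom σ₁.toAlgHom H.isIntegral)
  isUnit_disc := hδ
  map_gen := by simp
  map_incl x := by simp
  conj_gen := by simp
  conj_incl x := by simp

end Tensor

/-! ### The generators ζ₀ and ϖ₃ -/

section Generators
variable {F : Type*} [Field F] [ValuativeRel F] {K : Type*} [CommRing K] [Algebra F K]

lemma IsIntegralGenerator.isUnit_sub {ζ ζ' : K} {T N : 𝒪[F]} (H : IsIntegralGenerator ζ ζ' T N)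
    (hd : T ^ 2 - 4 * N ≠ 0) : IsUnit (ζ - ζ') := by
  have h1 : IsUnit ((ζ - ζ') ^ 2) := by
    rw [H.sub_sq_eq]
    exact (IsUnit.mk0 ((T ^ 2 - 4 * N : 𝒪[F]) : F) fun h => hd (Subtype.ext h)).map
      (algebraMap F K)
  exact (isUnit_pow_iff two_ne_zero).1 h1

/-- If the discriminant vanished, reducedness would give σϖ = ϖ, so ϖ would lie in F and K would
have dimension at most one. -/
lemma IsIntegralGenerator.disc_ne_zero [Module.Finite F K] [Algebra.FormallyUnramified F K]
    [Nontrivial K] {σ : K ≃ₐ[F] K} (hσ : IsQuadraticInvolution σ) (hK : Module.finrank F K = 2)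
    {ϖ : K} {t n : 𝒪[F]} (H : IsIntegralGenerator ϖ (σ ϖ) t n) : t ^ 2 - 4 * n ≠ 0 := by
  intro h0
  have : IsReduced K := Algebra.FormallyUnramified.isReduced_of_field F K
  have h1 : (ϖ - σ ϖ) ^ 2 = 0 := by rw [H.sub_sq_eq, h0, map_zero]
  have h2 : σ ϖ = ϖ := (sub_eq_zero.1 (eq_zero_of_pow_eq_zero h1)).symm
  obtain ⟨c, hc⟩ := hσ.2 ϖ h2
  have h3 : Module.finrank F K ≤ 1 := finrank_le_one (1 : K) fun x => by
    obtain ⟨a, b, rfl⟩ := H.exists_eq_add' x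
    exact ⟨a + b * c, by rw [← hc, Algebra.smul_def, mul_one, map_add, map_mul]⟩
  omega

end Generators

namespace IsQuadraticDescent
variable {F : Type*} [Field F] [ValuativeRel F] {K R : Type*} [CommRing K] [Algebra F K]
  [CommRing R] [Algebra F R] {i : K →ₐ[F] R} {σ : K ≃ₐ[F] K} {ρ τ : R →ₐ[F] R} {Z Z' : R}
  {T N : 𝒪[F]} (H : IsQuadraticDescent i σ ρ τ Z Z' T N) [Nontrivial K]
  (hσ : IsQuadraticInvolution σ) {ϖ : K} {S : Subalgebra F R}
include H hσ

lemma isIntegralGenerator_trace {t n : 𝒪[F]} (G : IsIntegralGenerator ϖ (σ ϖ) t n)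
    (hS : ∀ y, y ∈ S ↔ ρ y = y) {x x' : S} (hx : (x : R) = Z * i ϖ + Z' * i (σ ϖ))
    (hx' : (x' : R) = Z' * i ϖ + Z * i (σ ϖ)) :
    IsIntegralGenerator x x' (T * t) (N * t ^ 2 + n * T ^ 2 - 4 * n * N) := by
  have hb : i ϖ + i (σ ϖ) = algebraMap 𝒪[F] R t := by
    rw [← map_add, G.add, algHom_algebraMap]
  have hb' : i ϖ * i (σ ϖ) = algebraMap 𝒪[F] R n := by
    rw [← map_mul, G.mul, algHom_algebraMap]
  refine ⟨Subtype.ext ?_, Subtype.ext ?_, ?_⟩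
  · change (x : R) + x' = algebraMap 𝒪[F] R (T * t)
    rw [hx, hx', map_mul, ← H.add, ← hb]
    ring
  · change (x : R) * x' = algebraMap 𝒪[F] R (N * t ^ 2 + n * T ^ 2 - 4 * n * N)
    simp only [hx, hx', map_add, map_sub, map_mul, map_pow, map_ofNat]
    rw [← H.add, ← hb, ← H.mul, ← hb']
    ring
  · have hϖ := isIntegral_algHom i G.isIntegral
    have hϖ' := isIntegral_algHom i (isIntegral_algHom σ.toAlgHom G.isIntegral)
    -- Replacing Z' by T - Z gives x = Tσϖ + Z(ϖ - σϖ).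
    refine H.adjoin_eq hσ G hS (ε := 1) (ε' := 1)
      (p₀ := algebraMap 𝒪[F] K T * σ ϖ) (one_mul 1) ?_ ?_
    · rw [hx]
      exact (H.isIntegral.mul hϖ).add (H.isIntegral'.mul hϖ')
    · rw [hx, map_one, one_mul, map_mul, algHom_algebraMap, ← H.add, map_sub]
      ring

lemma isIntegralGenerator_idempotent (G : IsIntegralGenerator ϖ (σ ϖ) T N)
    (hS : ∀ y, y ∈ S ↔ ρ y = y) {x x' : S} {E : R} (hE : E * (Z ^ 2 - Z' ^ 2) = 1)
    (hx : (x : R) = E * (Z * i ϖ - Z' * i (σ ϖ)))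
    (hx' : (x' : R) = E * (Z * i (σ ϖ) - Z' * i ϖ)) :
    IsIntegralGenerator x x' (1 : 𝒪[F]) 0 := by
  have hb : i ϖ + i (σ ϖ) = Z + Z' := by
    rw [← map_add, G.add, algHom_algebraMap, H.add]
  have hb' : i ϖ * i (σ ϖ) = Z * Z' := by
    rw [← map_mul, G.mul, algHom_algebraMap, H.mul]
  refine ⟨Subtype.ext ?_, Subtype.ext ?_, ?_⟩
  · change (x : R) + x' = algebraMap 𝒪[F] R 1
    rw [hx, hx', map_one]
    linear_combination hE + E * (Z - Z') * hb
  · change (x : R) * x' = algebraMap 𝒪[F] R 0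
    rw [hx, hx', map_zero]
    linear_combination E ^ 2 * ((Z ^ 2 + Z' ^ 2 + 2 * Z * Z') * hb'
      - Z * Z' * (i ϖ + i (σ ϖ) + Z + Z') * hb)
  · obtain ⟨ε, hε⟩ := H.exists_inv_disc
    -- As ϖ and Z have the same trace, Zϖ - Z'σϖ = (Z + Z')(ϖ - Z'). The factor Z + Z', which need
    -- not be an integral unit, cancels, and x = ε(Z - Z')(ϖ - Z') with ε the inverse of the
    -- discriminant.
    have hη : (x : R) = i (algebraMap 𝒪[F] K ε *
        (algebraMap 𝒪[F] K (T ^ 2 - 2 * N) - algebraMap 𝒪[F] K T * ϖ)) +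
        Z * i (algebraMap 𝒪[F] K ε * (ϖ - σ ϖ)) := by
      have hε' : algebraMap 𝒪[F] R ε * (Z - Z') ^ 2 = 1 := by
        rw [H.sub_sq_eq, ← map_mul, hε, map_one]
      have hσϖ : i (σ ϖ) = Z + Z' - i ϖ := by rw [← hb]; ring
      simp only [hx, map_mul, map_sub, map_pow, map_ofNat, algHom_algebraMap]
      rw [← H.add, ← H.mul, hσϖ]
      linear_combination algebraMap 𝒪[F] R ε * (Z - Z') * (i ϖ - Z') * hE
        - E * (Z + Z') * (i ϖ - Z') * hε'
    refine H.adjoin_eq hσ G hS (ε := ε) (ε' := T ^ 2 - 4 * N) (by rw [mul_comm, hε]) ?_ hη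
    rw [hη]
    exact (isIntegral_algHom i (isIntegral_algebraMap.mul (isIntegral_algebraMap.sub
      (isIntegral_algebraMap.mul G.isIntegral)))).add (H.isIntegral.mul (isIntegral_algHom i
      (isIntegral_algebraMap.mul (G.isIntegral.sub
        (isIntegral_algHom σ.toAlgHom G.isIntegral)))))

end IsQuadraticDescent

namespace QuadraticData
variable {F K₁ K₂ : Type*} [Field F] [ValuativeRel F] [Field K₁] [CommRing K₂]
  [Algebra F K₁] [Algebra F K₂] (D : QuadraticData F K₁ K₂)

lemma mem_K₀ (y : K₁ ⊗[F] K₁) :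
    y ∈ D.K₀ ↔ Algebra.TensorProduct.map D.σ₁.toAlgHom D.σ₁.toAlgHom y = y := Iff.rfl

lemma mem_K₃ (y : K₁ ⊗[F] K₂) :
    y ∈ D.K₃ ↔ Algebra.TensorProduct.map D.σ₁.toAlgHom D.σ₂.toAlgHom y = y := Iff.rfl

lemma isUnit_sub : IsUnit (D.ζ₁ - D.σ₁ D.ζ₁) := isUnit_of_mul_isUnit_left D.isUnit_zeta

lemma disc_ne_zero : D.disc ≠ 0 := by
  have : D.disc = (D.ζ₁ - D.σ₁ D.ζ₁) * (D.ζ₁ + D.σ₁ D.ζ₁) := by rw [disc]; ring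
  rw [this]
  exact D.isUnit_zeta.ne_zero

section
variable [Module.Finite F K₁] {T N : 𝒪[F]} (G : IsIntegralGenerator D.ζ₁ (D.σ₁ D.ζ₁) T N)
  (hδ : IsUnit (T ^ 2 - 4 * N))
include G hδ

lemma isIntegralGenerator_ϖ₃ [Nontrivial K₂] {t n : 𝒪[F]}
    (G₂ : IsIntegralGenerator D.ϖ₂ (D.σ₂ D.ϖ₂) t n) :
    IsIntegralGenerator D.ϖ₃ D.ϖ₃c (T * t) (N * t ^ 2 + n * T ^ 2 - 4 * n * N) :=
  (G.isQuadraticDescent hδ D.σ₂).isIntegralGenerator_trace D.invol₂ G₂ D.mem_K₃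
    (by simp [ϖ₃]) (by simp [ϖ₃c])

lemma isIntegralGenerator_ζ₀ : IsIntegralGenerator D.ζ₀ D.ζ₀c (1 : 𝒪[F]) 0 := by
  refine (G.isQuadraticDescent hδ D.σ₁).isIntegralGenerator_idempotent D.invol₁ G D.mem_K₀
    (E := D.disc⁻¹ ⊗ₜ 1) ?_ ?_ ?_
  · have h1 : ((D.ζ₁ ⊗ₜ 1) ^ 2 - (D.σ₁ D.ζ₁ ⊗ₜ 1) ^ 2 : K₁ ⊗[F] K₁) = D.disc ⊗ₜ 1 := by
      simp [disc, TensorProduct.sub_tmul]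
    rw [h1, Algebra.TensorProduct.tmul_mul_tmul, inv_mul_cancel₀ D.disc_ne_zero, mul_one,
      Algebra.TensorProduct.one_def]
  · simp [ζ₀, mul_sub, div_eq_inv_mul]
  · simp [ζ₀c, mul_sub, div_eq_inv_mul]

end
end QuadraticData

/-! ### Base change of `𝐳` and `𝐰` -/

section Commutator
variable {k R : Type*} [CommRing k] [Ring R] [Algebra k R] {x x' y y' : R} {T t A A' B B' : k}
  (hx : x + x' = T • (1 : R)) (hy : y + y' = t • (1 : R))
include hx hy

/-- Modulo scalars x' = -x and y' = -y, so only the product of the coefficients B - B' and A + A'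
enters the commutator. For ζ₀ and ϖ₃ it is (ζ₁² - (ζ₁^{σ₁})²) divided by itself. -/
lemma commutator_of_conjugates (h : (B - B') * (A + A') = 1) :
    (B • y + B' • y') * (A • x - A' • x') - (A • x - A' • x') * (B • y + B' • y') =
      y * x - x * y := by
  obtain rfl := eq_sub_of_add_eq' hx
  obtain rfl := eq_sub_of_add_eq' hy
  simp only [mul_sub, sub_mul, mul_add, add_mul, smul_mul_assoc, mul_smul_comm, smul_sub,
    one_mul, mul_one, smul_smul]
  linear_combination (norm := module) h • (y * x - x * y)

lemma anticommutator_of_conjugates (h : A * B - A' * B' = 1) (h' : A * B' = A' * B) :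
    (A • x - A' • x') * (B • y + B' • y') + (B' • y + B • y') * (A • x' - A' • x) =
      x * y + y' * x' := by
  obtain rfl := eq_sub_of_add_eq' hx
  obtain rfl := eq_sub_of_add_eq' hy
  simp only [mul_sub, sub_mul, mul_add, add_mul, smul_mul_assoc, mul_smul_comm, smul_sub,
    one_mul, mul_one, smul_smul]
  linear_combination (norm := module) h • (y * x + x * y - T • y - t • x + (T * t) • (1 : R))
    + h' • (t • x + T • y - x * y - y * x)

end Commutator

lemma IsQuadraticInvolution.exists_smul_one {F K k R : Type*} [Field F] [CommRing K] [Algebra F K]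
    [CommRing k] [Algebra F k] [Ring R] [Algebra F R] [Algebra k R] [IsScalarTower F k R]
    {σ : K ≃ₐ[F] K} (hσ : IsQuadraticInvolution σ) (e : K →ₐ[F] R) (x : K) :
    ∃ T : k, e x + e (σ x) = T • (1 : R) := by
  obtain ⟨c, hc⟩ := hσ.2 (x + σ x) (by rw [map_add, hσ.1, add_comm])
  refine ⟨algebraMap F k c, ?_⟩
  rw [← map_add, ← hc, AlgHom.commutes, algebraMap_smul, Algebra.algebraMap_eq_smul_one]

/-! ### Transfer between matching pairs -/

section Matching
variable {F : Type*} [Field F] [ValuativeRel F]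

lemma isIntegral_algHom_iff_of_injective {A B : Type*} [Ring A] [Algebra F A] [Ring B]
    [Algebra F B] (f : A →ₐ[F] B) (hf : Function.Injective f) {x : A} :
    IsIntegral 𝒪[F] (f x) ↔ IsIntegral 𝒪[F] x :=
  isIntegral_algHom_iff (f.restrictScalars 𝒪[F]) hf

variable {K₁ K₂ : Type*} [Field K₁] [CommRing K₂] [Algebra F K₁] [Algebra F K₂]
  {D : QuadraticData F K₁ K₂} {h : ℕ} {α : EmbeddingPair F K₁ K₂ h}
  {β : EmbeddingPair F D.K₀ D.K₃ h}

/-- Over `K₁`, the elements `𝐰` and `𝐳` of matching pairs are conjugate. -/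
lemma Matches.exists_algHom (H : Matches D α β) :
    ∃ f g : Mat h F →ₐ[F] K₁ ⊗[F] Mat h F, Function.Injective f ∧ Function.Injective g ∧
      f (β.z D.ζ₀ D.ϖ₃) = g (α.z D.ζ₁ D.ϖ₂) ∧
      f (β.w D.ζ₀ D.ζ₀c D.ϖ₃ D.ϖ₃c) = g (α.w D.ζ₁ (D.σ₁ D.ζ₁) D.ϖ₂ (D.σ₂ D.ϖ₂)) := by
  obtain ⟨j, hj₀, hj₃⟩ := H
  let g : Mat h F →ₐ[F] K₁ ⊗[F] Mat h F := Algebra.TensorProduct.includeRight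
  -- Both matrix algebras embed in one algebra over K₁, the second through `j`. There the images of
  -- ζ₀ and ϖ₃ become K₁-combinations of conjugates of ζ₁ and ϖ₂.
  let f : Mat h F →ₐ[F] K₁ ⊗[F] Mat h F := (j.toAlgHom.restrictScalars F).comp g
  have hg : Function.Injective g :=
    Algebra.TensorProduct.includeRight_injective (algebraMap F K₁).injective
  have hsmul : ∀ (a : K₁) (m : Mat h F), a ⊗ₜ m = a • g m := fun a m => by
    simp [g, TensorProduct.smul_tmul']
  have h₀ : f (β.e₁ D.ζ₀) = (D.ζ₁ / D.disc) • g (α.e₁ D.ζ₁) -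
      (D.σ₁ D.ζ₁ / D.disc) • g (α.e₁ (D.σ₁ D.ζ₁)) := by
    refine (hj₀ 1 D.ζ₀).trans ?_
    rw [one_smul, ← hsmul, ← hsmul]
    simp [QuadraticData.ζ₀]
  have h₀c : f (β.e₁ D.ζ₀c) = (D.ζ₁ / D.disc) • g (α.e₁ (D.σ₁ D.ζ₁)) -
      (D.σ₁ D.ζ₁ / D.disc) • g (α.e₁ D.ζ₁) := by
    refine (hj₀ 1 D.ζ₀c).trans ?_
    rw [one_smul, ← hsmul, ← hsmul]
    simp [QuadraticData.ζ₀c]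
  have h₃ : f (β.e₂ D.ϖ₃) = D.ζ₁ • g (α.e₂ D.ϖ₂) + D.σ₁ D.ζ₁ • g (α.e₂ (D.σ₂ D.ϖ₂)) := by
    refine (hj₃ 1 D.ϖ₃).trans ?_
    rw [one_smul, ← hsmul, ← hsmul]
    simp [QuadraticData.ϖ₃]
  have h₃c : f (β.e₂ D.ϖ₃c) = D.σ₁ D.ζ₁ • g (α.e₂ D.ϖ₂) + D.ζ₁ • g (α.e₂ (D.σ₂ D.ϖ₂)) := by
    refine (hj₃ 1 D.ϖ₃c).trans ?_
    rw [one_smul, ← hsmul, ← hsmul]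
    simp [QuadraticData.ϖ₃c]
  obtain ⟨T, hT⟩ := D.invol₁.exists_smul_one (k := K₁) (g.comp α.e₁) D.ζ₁
  obtain ⟨t, ht⟩ := D.invol₂.exists_smul_one (k := K₁) (g.comp α.e₂) D.ϖ₂
  have hd := D.disc_ne_zero
  have hd' : D.disc = D.ζ₁ ^ 2 - D.σ₁ D.ζ₁ ^ 2 := rfl
  refine ⟨f, g, j.injective.comp hg, hg, ?_, ?_⟩
  · simp only [EmbeddingPair.z, map_sub, map_mul, h₀, h₃]
    refine commutator_of_conjugates hT ht ?_
    field_simp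
    rw [hd']
    ring
  · simp only [EmbeddingPair.w, map_add, map_mul, h₀, h₃, h₀c, h₃c]
    refine anticommutator_of_conjugates hT ht ?_ ?_
    · field_simp
      rw [hd']
    · ring

lemma Matches.minpoly_eq (H : Matches D α β) :
    minpoly F (β.w D.ζ₀ D.ζ₀c D.ϖ₃ D.ϖ₃c) =
      minpoly F (α.w D.ζ₁ (D.σ₁ D.ζ₁) D.ϖ₂ (D.σ₂ D.ϖ₂)) := by
  obtain ⟨f, g, hf, hg, -, hw⟩ := H.exists_algHom
  rw [← minpoly.algHom_eq f hf, hw, minpoly.algHom_eq g hg]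

lemma Matches.isIntegral_z (H : Matches D α β) (hz : IsIntegral 𝒪[F] (α.z D.ζ₁ D.ϖ₂)) :
    IsIntegral 𝒪[F] (β.z D.ζ₀ D.ϖ₃) := by
  obtain ⟨f, g, hf, hg, h, -⟩ := H.exists_algHom
  rwa [← isIntegral_algHom_iff_of_injective f hf, h, isIntegral_algHom_iff_of_injective g hg]

lemma Matches.isIntegral_z_inv (H : Matches D α β) {u v : Mat h F}
    (hu : u * α.z D.ζ₁ D.ϖ₂ = 1) (hu' : IsIntegral 𝒪[F] u) (hv : β.z D.ζ₀ D.ϖ₃ * v = 1) :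
    IsIntegral 𝒪[F] v := by
  obtain ⟨f, g, hf, hg, h, -⟩ := H.exists_algHom
  have h1 : g u * f (β.z D.ζ₀ D.ϖ₃) = 1 := by rw [h, ← map_mul, hu, map_one]
  have h2 : f (β.z D.ζ₀ D.ϖ₃) * f v = 1 := by rw [← map_mul, hv, map_one]
  rwa [← isIntegral_algHom_iff_of_injective f hf, ← left_inv_eq_right_inv h1 h2,
    isIntegral_algHom_iff_of_injective g hg]

/-- The number of primitive lattices only depends on the minimal polynomial. -/
lemma ncard_primitiveLattices_congr {w w' : Mat h F} (hw : minpoly F w = minpoly F w') :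
    (primitiveLattices w).ncard = (primitiveLattices w').ncard := by
  let P (f : Polynomial F) : Set (Submodule 𝒪[F] (AdjoinRoot f)) :=
    {Λ | (∀ x ∈ Λ, AdjoinRoot.root f * x ∈ Λ) ∧
      Submodule.span (integralClosure 𝒪[F] (AdjoinRoot f)) (Λ : Set (AdjoinRoot f)) = 1}
  -- The ambient ring depends on the polynomial, so the equality is substituted for a free
  -- polynomial.
  have key : ∀ f g : Polynomial F, f = g → (P f).ncard = (P g).ncard := by
    rintro f _ rfl
    rfl
  exact key _ _ hw

end Matching

end BiquadraticFL

/-! ### The comparison of orbital integrals -/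

theorem theorem1p4
    {F : Type*} [Field F] [ValuativeRel F] [TopologicalSpace F] [IsNonarchimedeanLocalField F]
    [MeasurableSpace F] [BorelSpace F]
    -- `K₁/F` is an unramified quadratic field extension, `K₂/F` is a quadratic étale algebra
    {K₁ K₂ : Type*} [Field K₁] [Algebra F K₁] [CommRing K₂] [Algebra F K₂]
    (hK₁ : Module.finrank F K₁ = 2)
    [Algebra.FormallyUnramified 𝒪[F] (integralClosure 𝒪[F] K₁)]
    (hK₂ : Module.finrank F K₂ = 2) [Algebra.Etale F K₂]
    (D : BiquadraticFL.QuadraticData F K₁ K₂)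
    {h : ℕ} (hh : 1 ≤ h)
    -- the pairs `α`, `β`: regular semisimple and matching
    (α : BiquadraticFL.EmbeddingPair F K₁ K₂ h)
    (β : BiquadraticFL.EmbeddingPair F D.K₀ D.K₃ h)
    (hα : α.IsRegularSemisimple D.ζ₁ (D.σ₁ D.ζ₁) D.ϖ₂ (D.σ₂ D.ϖ₂))
    (hβ : β.IsRegularSemisimple D.ζ₀ D.ζ₀c D.ϖ₃ D.ϖ₃c)
    (hαβ : BiquadraticFL.Matches D α β)
    -- the element `𝐳` is a unit
    (hz : ∃ u ∈ BiquadraticFL.GLO h F,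
      (u : BiquadraticFL.Mat h F) = α.z D.ζ₁ D.ϖ₂)
    -- integral reference pairs, and elements conjugating them to `α` and `β`
    (αref : BiquadraticFL.EmbeddingPair F K₁ K₂ h) (hαref : αref.IsIntegralPair)
    (βref : BiquadraticFL.EmbeddingPair F D.K₀ D.K₃ h) (hβref : βref.IsIntegralPair)
    (g₁ g₂ g₀ g₃ : BiquadraticFL.GLn h F)
    (hg₁₂ : α.IsConjOf αref g₁ g₂) (hg₀₃ : β.IsConjOf βref g₀ g₃)
    (mα : BiquadraticFL.OrbitalMeasures αref g₁ g₂)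
    (mβ : BiquadraticFL.OrbitalMeasures βref g₀ g₃) :
    -- both orbital integrals converge and agree
    MeasureTheory.Integrable
      (BiquadraticFL.geometricIntegrand αref g₁ g₂ (BiquadraticFL.unitTest h F)) mα.μ ∧
    MeasureTheory.Integrable
      (BiquadraticFL.analyticIntegrand βref g₀ g₃ (β.e₁ D.ζ₀) (β.e₁ D.ζ₀c) (β.z D.ζ₀ D.ϖ₃)
        (BiquadraticFL.unitTest h F) 0) mβ.μ ∧
    BiquadraticFL.orb mα (BiquadraticFL.unitTest h F) =
      BiquadraticFL.twistedOrb mβ (β.e₁ D.ζ₀) (β.e₁ D.ζ₀c) (β.z D.ζ₀ D.ϖ₃)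
        (BiquadraticFL.unitTest h F) 0 ∧
    -- and both count the primitive lattices in `L = F[𝐰]`
    (BiquadraticFL.primitiveLattices (α.w D.ζ₁ (D.σ₁ D.ζ₁) D.ϖ₂ (D.σ₂ D.ϖ₂))).Finite ∧
    BiquadraticFL.orb mα (BiquadraticFL.unitTest h F) =
      ((BiquadraticFL.primitiveLattices
        (α.w D.ζ₁ (D.σ₁ D.ζ₁) D.ϖ₂ (D.σ₂ D.ϖ₂))).ncard : ℂ) := by
  have : Module.Finite F K₁ := Module.finite_of_finrank_pos (by omega)
  have : Module.Finite F K₂ := Module.finite_of_finrank_pos (by omega)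
  have : Nontrivial K₂ := Module.nontrivial_of_finrank_pos (R := F) (by omega)
  have : Module.Finite F D.K₀ :=
    Module.Finite.of_injective D.K₀.val.toLinearMap Subtype.val_injective
  have : Module.Finite F D.K₃ :=
    Module.Finite.of_injective D.K₃.val.toLinearMap Subtype.val_injective
  obtain ⟨T, N, G₁⟩ := D.invol₁.exists_isIntegralGenerator D.adjoin_zeta
  obtain ⟨t, n, G₂⟩ := D.invol₂.exists_isIntegralGenerator D.adjoin_varpi
  have hδ : IsUnit (T ^ 2 - 4 * N) := G₁.isUnit_disc D.isUnit_sub.ne_zero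
  have G₀ := D.isIntegralGenerator_ζ₀ G₁ hδ
  have G₃ := D.isIntegralGenerator_ϖ₃ G₁ hδ G₂
  have hd : t ^ 2 - 4 * n ≠ 0 := G₂.disc_ne_zero D.invol₂ hK₂
  have : Algebra.FormallyUnramified F K₁ := G₁.formallyUnramified D.isUnit_sub
  have : Algebra.FormallyUnramified F D.K₀ :=
    G₀.formallyUnramified (G₀.isUnit_sub (by simp))
  have : Algebra.FormallyUnramified F D.K₃ := by
    refine G₃.formallyUnramified (G₃.isUnit_sub ?_)
    -- The discriminant of ϖ₃ is the product of those of ζ₁ and ϖ₂, so it is nonzero and K₃ is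
    -- étale.
    rw [show (T * t) ^ 2 - 4 * (N * t ^ 2 + n * T ^ 2 - 4 * n * N) =
      (T ^ 2 - 4 * N) * (t ^ 2 - 4 * n) by ring]
    exact mul_ne_zero hδ.ne_zero hd
  obtain ⟨u, hu, huz⟩ := hz
  have huv : α.z D.ζ₁ D.ϖ₂ * ((u⁻¹ : BiquadraticFL.GLn h F) : BiquadraticFL.Mat h F) = 1 := by
    rw [← huz, Units.mul_inv]
  have hvu : ((u⁻¹ : BiquadraticFL.GLn h F) : BiquadraticFL.Mat h F) * α.z D.ζ₁ D.ϖ₂ = 1 := by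
    rw [← huz, Units.inv_mul]
  have hz_int : IsIntegral 𝒪[F] (α.z D.ζ₁ D.ϖ₂) := by
    rw [← huz]
    exact BiquadraticFL.isIntegral_of_mem_GLO hu
  have hv_int := BiquadraticFL.isIntegral_of_mem_GLO (inv_mem hu)
  obtain ⟨v, hv⟩ := hβ.2.exists_right_inv
  have Sα : BiquadraticFL.IsUnitPair α αref g₁ g₂ D.ζ₁ (D.σ₁ D.ζ₁) D.ϖ₂ (D.σ₂ D.ϖ₂) T N t n _ :=
    ⟨hg₁₂, hαref, G₁, G₂, hδ, hα, huv, hz_int, hv_int⟩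
  -- The split case T = 1, N = 0 of the same setting: ζ₀ is an idempotent and its discriminant is 1.
  -- Integrality of `𝐳` and of its inverse `v` comes from α by matching.
  have Sβ : BiquadraticFL.IsUnitPair β βref g₀ g₃ D.ζ₀ D.ζ₀c D.ϖ₃ D.ϖ₃c 1 0 _ _ v :=
    ⟨hg₀₃, hβref, G₀, G₃, by simp, hβ, hv, hαβ.isIntegral_z hz_int,
      hαβ.isIntegral_z_inv hvu hv_int hv⟩
  refine ⟨Sα.integrable_geometricIntegrand mα, Sβ.integrable_analyticIntegrand mβ, ?_,
    Sα.finite_primitiveLattices, Sα.orb_unitTest mα⟩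
  rw [Sα.orb_unitTest mα, Sβ.twistedOrb_unitTest mβ,
    BiquadraticFL.ncard_primitiveLattices_congr hαβ.minpoly_eq]
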